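/- **Setting.** Let $\mathcal P_1(\mathbb R_+)$ be the set of Borel probability measures on $\mathbb R_+=[0,\infty)$ with finite first moment, equipped with the distance $\mathbb E|X_\mu-X_{\nu}|$, where $X_\mu:=F_\mu^{-1}(U)$, $F_\mu^{-1}(r):=\inf\{s\ge 0:\mu([0,s])>r\}$ and $U$ is uniform on $[0,1]$. A measure $\mu$ of finite support is written $\mu=\sum_{\ell=0}^k(\zeta_{\ell+1}-\zeta_\ell)\delta_{q_\ell}$ with $0=\zeta_0<\zeta_1<\dots<\zeta_k<\zeta_{k+1}=1$ and $0=q_{-1}\le q_0<q_1<\dots<q_k$. Let $(v_\alpha)_{\alpha\in\mathbb N^k}$ be the Poisson–Dirichlet cascade with parameters $(\zeta_\ell)_{1\le\ell\le k}$: the children of each vertex of depth $\ell\in\{0,\dots,k-1\}$ of the tree $\mathbb N^0\cup\dots\cup\mathbb N^k$ are decorated with the points of an independent Poisson point process on $(0,\infty)$ with intensity $\zeta_{\ell+1}x^{-1-\zeta_{\ell+1}}\,dx$, the weight of a leaf is the product of the decorations along the path from the root to the leaf, and the weights of the leaves are normalized to have sum $1$ ($v_\emptyset=1$ if $k=0$).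 Let $z_\beta$, for $\beta$ in the tree, be independent standard Gaussian vectors in $\mathbb R^N$, independent of $(v_\alpha)$, let $\alpha_{|\ell}$ be the ancestor of depth $\ell$ of the leaf $\alpha$, and for a probability measure $P_N$ on $\mathbb R^N$ set $$F_N(0,\mu):=-\frac1N\log\int\sum_{\alpha\in\mathbb N^k}\exp\Big(\sum_{\ell=0}^k(2q_\ell-2q_{\ell-1})^{1/2}z_{\alpha_{|\ell}}\cdot\sigma-q_k|\sigma|^2\Big)v_\alpha\,dP_N(\sigma),\qquad \overline F_N(0,\mu):=\mathbb E[F_N(0,\mu)].$$ In both cases below and for every $N\ge1$, $F_N(0,\mu)$ is integrable for every $\mu$ of finite support, and $\mu\mapsto\overline F_N(0,\mu)$ extends in a unique way to a continuous function on $\mathcal P_1(\mathbb R_+)$, still denoted by $\overline F_N(0,\cdot)$. **Proposition (Convergence of initial condition).** (1) If $P_N=P_1^{\otimes N}$ for every $N\ge1$, where $P_1$ is a probability measure on $\mathbb R$ with bounded support, then $\overline F_N(0,\cdot)=\overline F_1(0,\cdot)$ on $\mathcal P_1(\mathbb R_+)$ for every $N\ge1$. (2) For every probability measure $\mu$ on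 $\mathbb R_+$ with compact support and every $q\ge0$ such that $\mu([0,q])=1$, let $$\psi^\circ(\mu):=-\inf\left\{\int_0^q\frac{1}{b-2\int_s^q\mu([0,r])\,dr}\,ds+\frac12\,(b-1-\log b)-q\ :\ b>2\int_0^q\mu([0,r])\,dr\right\}.$$ The right side does not depend on the choice of $q$ satisfying $\mu([0,q])=1$, and $\mu\mapsto\psi^\circ(\mu)$ extends in a unique way to a continuous function on $\mathcal P_1(\mathbb R_+)$, still denoted by $\psi^\circ$. Moreover, if $P_N$ is the uniform probability measure on the sphere $\{\sigma\in\mathbb R^N:|\sigma|^2=N\}$ for every $N\ge1$, then for every $\mu\in\mathcal P_1(\mathbb R_+)$, $$\lim_{N\to\infty}\overline F_N(0,\mu)=\psi^\circ(\mu).$$ -/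

import Mathlib

open MeasureTheory ProbabilityTheory Filter Topology Set
open scoped NNReal ENNReal BigOperators

noncomputable section

namespace SpinGlass

/-! ### The Wasserstein space of probability measures on the half-line -/

/-- Borel probability measures on `[0, ∞)` with finite first moment. -/
structure P1 where
  /-- the underlying measure -/
  meas : Measure ℝ≥0
  isProb : IsProbabilityMeasure meas
  finite_moment : ∫⁻ s, (s : ℝ≥0∞) ∂meas < ∞

/-- The inverse distribution function `F_μ⁻¹(u) = inf {s ≥ 0 : μ([0,s]) > u}`. -/
def quantile (μ : Measure ℝ≥0) (u : ℝ) : ℝ≥0 :=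
  sInf {s : ℝ≥0 | ENNReal.ofReal u < μ (Iic s)}

theorem quantile_monotoneOn (μ : Measure ℝ≥0) [IsProbabilityMeasure μ] :
    MonotoneOn (quantile μ) (Ioo 0 1) := by
  intro u _ v hv huv
  refine csInf_le_csInf (OrderBot.bddBelow _) ?_ ?_
  · have h1 : Tendsto (fun s : ℝ≥0 => μ (Iic s)) atTop (𝓝 (μ univ)) :=
      tendsto_measure_Iic_atTop μ
    rw [measure_univ] at h1
    have h2 : ENNReal.ofReal v < 1 := by
      rw [← ENNReal.ofReal_one]
      exact (ENNReal.ofReal_lt_ofReal_iff one_pos).2 hv.2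
    exact (h1.eventually (lt_mem_nhds h2)).exists
  · intro s hs
    exact lt_of_le_of_lt (ENNReal.ofReal_le_ofReal huv) hs

theorem quantile_aemeasurable (μ : Measure ℝ≥0) [IsProbabilityMeasure μ] :
    AEMeasurable (quantile μ) (volume.restrict (Ioo (0 : ℝ) 1)) :=
  aemeasurable_restrict_of_monotoneOn measurableSet_Ioo (quantile_monotoneOn μ)

/-- The Wasserstein distance `E |X_μ - X_ν|`, where `X_μ = F_μ⁻¹(U)` and `X_ν = F_ν⁻¹(U)` for the
same uniform random variable `U`. -/
instance : PseudoEMetricSpace P1 where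
  edist μ ν := ∫⁻ u in Ioo (0 : ℝ) 1, edist (quantile μ.meas u) (quantile ν.meas u)
  edist_self μ := by simp
  edist_comm μ ν := by simp only [edist_comm]
  edist_triangle μ ν ρ := by
    have := μ.isProb
    have := ν.isProb
    rw [← lintegral_add_left' ((quantile_aemeasurable μ.meas).edist
      (quantile_aemeasurable ν.meas))]
    exact lintegral_mono fun u => edist_triangle _ _ _

/-- `G` is a continuous function on `P1` that takes the value `f i` at every `e i`. -/
def IsContinuousExtension {ι : Type} (e : ι → P1) (f : ι → ℝ) (G : P1 → ℝ) : Prop :=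
  Continuous G ∧ ∀ i, G (e i) = f i

/-- The extension by continuity to `P1` of the function `e i ↦ f i` (meaningful when there is
exactly one). -/
def continuousExtension {ι : Type} (e : ι → P1) (f : ι → ℝ) : P1 → ℝ :=
  Classical.epsilon (IsContinuousExtension e f)

/-! ### Measures of finite support -/

/-- The parameters `0 = ζ_0 < ζ_1 < ⋯ < ζ_k < ζ_{k+1} = 1` and `0 ≤ q_0 < q_1 < ⋯ < q_k`
of a probability measure with finite support in `[0, ∞)`. -/
structure Ladder where
  k : ℕ
  ζ : Fin (k + 2) → ℝ
  q : Fin (k + 1) → ℝ≥0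
  ζ_strictMono : StrictMono ζ
  ζ_zero : ζ 0 = 0
  ζ_last : ζ (Fin.last (k + 1)) = 1
  q_strictMono : StrictMono q

namespace Ladder

/-- The measure `∑_ℓ (ζ_{ℓ+1} - ζ_ℓ) δ_{q_ℓ}`. -/
def measure (d : Ladder) : Measure ℝ≥0 :=
  ∑ ℓ : Fin (d.k + 1), ENNReal.ofReal (d.ζ ℓ.succ - d.ζ ℓ.castSucc) • Measure.dirac (d.q ℓ)

theorem sum_weights (d : Ladder) :
    ∑ ℓ : Fin (d.k + 1), ENNReal.ofReal (d.ζ ℓ.succ - d.ζ ℓ.castSucc) = 1 := by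
  rw [← ENNReal.ofReal_sum_of_nonneg]
  · have h : ∑ ℓ : Fin (d.k + 1), (d.ζ ℓ.succ - d.ζ ℓ.castSucc) = 1 := by
      rw [Finset.sum_sub_distrib]
      have h1 := Fin.sum_univ_succ d.ζ
      have h2 := Fin.sum_univ_castSucc d.ζ
      rw [d.ζ_zero] at h1
      rw [d.ζ_last] at h2
      linarith
    rw [h, ENNReal.ofReal_one]
  · intro ℓ _
    exact sub_nonneg.2 (d.ζ_strictMono (Fin.castSucc_lt_succ (i := ℓ))).le

/-- The measure of a ladder, as a point of `P1`. -/
def toP1 (d : Ladder) : P1 where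
  meas := d.measure
  isProb := ⟨by simpa [measure] using d.sum_weights⟩
  finite_moment := by
    rw [measure, lintegral_finsetSum_measure]
    refine ENNReal.sum_lt_top.2 fun ℓ _ => ?_
    rw [lintegral_smul_measure, lintegral_dirac, smul_eq_mul]
    exact ENNReal.mul_lt_top ENNReal.ofReal_lt_top ENNReal.coe_lt_top

/-- The increment `q_ℓ - q_{ℓ-1}`, with `q_{-1} = 0`. -/
def incr (d : Ladder) (ℓ : Fin (d.k + 1)) : ℝ :=
  (d.q ℓ : ℝ) - Fin.cases (motive := fun _ => ℝ) 0 (fun j : Fin d.k => (d.q j.castSucc : ℝ)) ℓ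

end Ladder

/-! ### Poisson-Dirichlet cascades and the free energy -/

/-- The ancestor of depth `ℓ` of the leaf `α`; vertices of the tree are finite sequences of
natural numbers. -/
def ancestor {k : ℕ} (α : Fin k → ℕ) (ℓ : ℕ) : List ℕ := (List.ofFn α).take ℓ

instance : IsProbabilityMeasure (expMeasure 1) := isProbabilityMeasure_expMeasure one_pos

/-- The underlying randomness: independent standard exponential variables `e (β, n)` and
independent standard Gaussian variables `z (β, i)`, where `β` ranges over the vertices of the
tree. The two families are independent. -/
abbrev Noise (N : ℕ) : Type := (List ℕ × ℕ → ℝ) × (List ℕ × Fin N → ℝ)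

/-- The law of the underlying randomness. -/
def noiseLaw (N : ℕ) : Measure (Noise N) :=
  (Measure.infinitePi fun _ : List ℕ × ℕ => expMeasure 1).prod
    (Measure.infinitePi fun _ : List ℕ × Fin N => gaussianReal 0 1)

/-- The arrival times of independent Poisson processes of unit rate on `(0, ∞)`, one for each
vertex `β`. -/
def arrival (e : List ℕ × ℕ → ℝ) (β : List ℕ) (n : ℕ) : ℝ :=
  ∑ m ∈ Finset.range (n + 1), e (β, m)

/-- The points, in decreasing order, of independent Poisson point processes on `(0, ∞)` with
intensity measure `ζ x^{-1-ζ} dx`, one for each vertex `β`: the image of a Poisson process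
of unit rate under `y ↦ y^{-1/ζ}`, which maps Lebesgue measure to `ζ x^{-1-ζ} dx`. -/
def poissonPoint (ζ : ℝ) (e : List ℕ × ℕ → ℝ) (β : List ℕ) (n : ℕ) : ℝ :=
  arrival e β n ^ (-1 / ζ)

/-- The unnormalized weight of the leaf `α`: the product of the decorations along the path from
the root to `α`. The children of a vertex of depth `ℓ` are decorated with the points of a Poisson
point process with intensity `ζ_{ℓ+1} x^{-1-ζ_{ℓ+1}} dx`. -/
def leafWeight (d : Ladder) (e : List ℕ × ℕ → ℝ) (α : Fin d.k → ℕ) : ℝ≥0∞ :=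
  ∏ ℓ : Fin d.k,
    ENNReal.ofReal (poissonPoint (d.ζ ℓ.castSucc.succ) e (ancestor α ℓ) (α ℓ))

/-- The Poisson-Dirichlet cascade `(v_α)`. -/
def cascade (d : Ladder) (e : List ℕ × ℕ → ℝ) (α : Fin d.k → ℕ) : ℝ≥0∞ :=
  leafWeight d e α / ∑' γ : Fin d.k → ℕ, leafWeight d e γ

/-- The Gaussian field `H'_N(σ,α) = ∑_{ℓ=0}^k (2 q_ℓ - 2 q_{ℓ-1})^{1/2} z_{α|ℓ} ⬝ σ`. -/
def field {N : ℕ} (d : Ladder) (z : List ℕ × Fin N → ℝ) (σ : Fin N → ℝ) (α : Fin d.k → ℕ) : ℝ :=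
  ∑ ℓ : Fin (d.k + 1), √(2 * d.incr ℓ) * ∑ i, z (ancestor α ℓ, i) * σ i

/-- The free energy at time `t = 0` for a measure of finite support,
`F_N(0,μ) = - N⁻¹ log ∫ ∑_α exp (H'_N(σ,α) - q_k |σ|²) v_α dP(σ)`. -/
def freeEnergy (N : ℕ) (P : Measure (Fin N → ℝ)) (d : Ladder) (ω : Noise N) : ℝ :=
  -(1 / (N : ℝ)) * Real.log (ENNReal.toReal (∫⁻ σ, ∑' α : Fin d.k → ℕ,
    ENNReal.ofReal (Real.exp
      (field d ω.2 σ α - (d.q (Fin.last d.k) : ℝ) * ∑ i, σ i ^ 2)) * cascade d ω.1 α ∂P))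

/-- The averaged free energy `E[F_N(0,μ)]` for a measure of finite support. -/
def meanFreeEnergy (N : ℕ) (P : Measure (Fin N → ℝ)) (d : Ladder) : ℝ :=
  ∫ ω, freeEnergy N P d ω ∂(noiseLaw N)

/-- The function `μ ↦ E[F_N(0,μ)]` on `P1`, obtained by continuity from the measures of finite
support. -/
def Fbar (N : ℕ) (P : Measure (Fin N → ℝ)) : P1 → ℝ :=
  continuousExtension Ladder.toP1 (meanFreeEnergy N P)

/-- `F_N(0,μ)` is integrable for every `μ` of finite support, and there is exactly one way to
extend its expectation to a continuous function on `P1`. -/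
def FbarWellDefined (N : ℕ) (P : Measure (Fin N → ℝ)) : Prop :=
  (∀ d : Ladder, Integrable (freeEnergy N P d) (noiseLaw N)) ∧
    ∃! G : P1 → ℝ, IsContinuousExtension Ladder.toP1 (meanFreeEnergy N P) G

/-! ### The uniform measure on the sphere and the limit functional -/

/-- The uniform probability measure on the sphere `{σ : |σ|² = N}`. -/
def sphereLaw (N : ℕ) : Measure (Fin N → ℝ) :=
  let S : Measure (Metric.sphere (0 : EuclideanSpace ℝ (Fin N)) 1) :=
    (volume : Measure (EuclideanSpace ℝ (Fin N))).toSphere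
  Measure.map (fun (x : Metric.sphere (0 : EuclideanSpace ℝ (Fin N)) 1) (i : Fin N) =>
    √(N : ℝ) * x.1 i) ((S univ)⁻¹ • S)

/-- The integral `∫_s^q μ([0,r]) dr`, for `0 ≤ s ≤ q`. -/
def cdfIntegral (μ : Measure ℝ≥0) (s q : ℝ) : ℝ :=
  ∫ r in s..q, μ.real (Iic r.toNNReal)

/-- The expression minimized over `b` in the variational formula. -/
def sphereObjective (μ : Measure ℝ≥0) (q : ℝ≥0) (b : ℝ) : ℝ :=
  (∫ s in (0 : ℝ)..q, 1 / (b - 2 * cdfIntegral μ s q)) + (1 / 2) * (b - 1 - Real.log b) - q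

/-- The functional `ψ°(μ)` for `μ` supported in `[0,q]`:
minus the infimum over `b > 2 ∫_0^q μ([0,r]) dr`. -/
def psiCirc (μ : Measure ℝ≥0) (q : ℝ≥0) : ℝ :=
  -sInf (sphereObjective μ q '' Ioi (2 * cdfIntegral μ 0 q))

/-- Pairs of a measure `μ` and a number `q` such that `μ([0,q]) = 1`. -/
abbrev Bounded : Type := {p : P1 × ℝ≥0 // p.1.meas (Iic p.2) = 1}

/-- The function `ψ°` on `P1`, obtained by continuity from the measures of compact support. -/
def psiExt : P1 → ℝ :=
  continuousExtension (fun p : Bounded => p.1.1) (fun p => psiCirc p.1.1.meas p.1.2)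

end SpinGlass

end

/-! Finite support. The levels of `μ` are the pairs `(m, δ)` of a value of its distribution function
and the length of the interval on which it is taken. The operator `T m δ` sends `f` to `x ↦ m⁻¹ log
E exp (m f (x + √(2δ) z))`, or to the plain mean when `m = 0`, and `val` composes these operators
along a list. With `base P Q x = log ∫ exp (x ⬝ σ - Q |σ|²) dP(σ)`, the cascade recursion says that
`-N E F_N(0, μ)` is `val (base P q_k) levels` at `0` (`integrable_freeEnergy_and_mean`). To prove
it, the Laplace transform of the sum over the leaves is computed level by level from the Laplace
functional of a Poisson process (`integral_lap_treeSum`). It coincides with the transform of the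
unperturbed sum of weights times an independent factor `exp (val f)` at a Gaussian point. Frullani's
integral turns equality of Laplace transforms into equality of mean logarithms, and the contribution
of the normalization cancels (`integral_log_treeSum`).

Extension by continuity. If `|σ| ≤ R` almost surely, `base P Q` is `R`-Lipschitz, and `|T m' δ f - T
m δ f| ≤ |m' - m| R² δ` whatever the dimension (`Reg.abs_T_sub_T_le`): over a short increment `f` is
almost linear, `ℓ ⬝ z` has variance `|ℓ|² ≤ R²`, and the semigroup property in `δ` removes the error
terms. Hence `val` is `R²`-Lipschitz in the `L¹` norm of the step function (`Reg.abs_val_sub_le`),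
which is the Wasserstein distance (`edist_eq`). So the averaged free energy is `R²/N`-Lipschitz on a
dense set and extends uniquely.

Product measures. The terminal function is a sum over coordinates, and the operators preserve such
sums, so `val` in dimension `N` is `N` times its value in dimension one (`val_sum`).

The sphere. Quadratic functions `|x|²/(2D) + c` are mapped by the operators to quadratic functions
with explicit parameters. Concentration of `|z|²/N` gives `base ≤ |x|²/(2b) + N((b - 1 - log b)/2 +
o(1))` for every `b > 0`, hence an upper bound of the limit by the objective at every admissible
`b`. For the lower bound, Jensen's inequality replaces the exponential means by one mean of the
defect `base - quadratic` under a Gaussian of variance `b² vq(b)`. If `b` solves `vq(b) = 1 - 1/b`,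
this variance is `b² - b`, exactly the one at which the quadratic bound is sharp on average
(`eventually_le_integral_base`). The two bounds then meet, and this `b` is the minimizer. Finally
`R² = N` on the sphere, so the functions of `μ` are `1`-Lipschitz for all `N`, and convergence at
finitely supported measures gives convergence everywhere. -/

noncomputable section

namespace SpinGlass

/-! ### The standard Gaussian measure on `ℝ^N` -/

/-- The standard Gaussian measure. -/
def stdG (N : ℕ) : Measure (Fin N → ℝ) := Measure.pi fun _ => gaussianReal 0 1

instance (N : ℕ) : IsProbabilityMeasure (stdG N) := by unfold stdG; infer_instance

/-- The Euclidean length. -/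
def len {N : ℕ} (x : Fin N → ℝ) : ℝ := √(x ⬝ᵥ x)

theorem dot_self_nonneg {N : ℕ} (x : Fin N → ℝ) : 0 ≤ x ⬝ᵥ x :=
  Finset.sum_nonneg fun i _ => mul_self_nonneg (x i)

theorem len_nonneg {N : ℕ} (x : Fin N → ℝ) : 0 ≤ len x := Real.sqrt_nonneg _

theorem len_sq {N : ℕ} (x : Fin N → ℝ) : len x ^ 2 = x ⬝ᵥ x := Real.sq_sqrt (dot_self_nonneg x)

theorem len_smul {N : ℕ} (c : ℝ) (x : Fin N → ℝ) : len (c • x) = |c| * len x := by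
  unfold len
  rw [smul_dotProduct, dotProduct_smul, smul_eq_mul, smul_eq_mul, ← mul_assoc, Real.sqrt_mul
    (mul_self_nonneg c), Real.sqrt_mul_self_eq_abs]

theorem abs_dot_le {N : ℕ} (x y : Fin N → ℝ) : |x ⬝ᵥ y| ≤ len x * len y := by
  unfold len
  rw [← Real.sqrt_mul (dot_self_nonneg x)]
  refine Real.abs_le_sqrt ?_
  have := Finset.sum_mul_sq_le_sq_mul_sq Finset.univ x y
  simpa [dotProduct, sq] using this

@[fun_prop]
theorem continuous_dot {N : ℕ} {X : Type*} [TopologicalSpace X] {f g : X → Fin N → ℝ}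
    (hf : Continuous f) (hg : Continuous g) : Continuous fun x => f x ⬝ᵥ g x := by
  unfold dotProduct; fun_prop

@[fun_prop]
theorem measurable_dot {N : ℕ} {X : Type*} [MeasurableSpace X] {f g : X → Fin N → ℝ}
    (hf : Measurable f) (hg : Measurable g) : Measurable fun x => f x ⬝ᵥ g x := by
  unfold dotProduct; fun_prop

@[fun_prop]
theorem continuous_len {N : ℕ} : Continuous (len : (Fin N → ℝ) → ℝ) := by
  unfold len; fun_prop

@[fun_prop]
theorem measurable_len {N : ℕ} : Measurable (len : (Fin N → ℝ) → ℝ) :=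
  continuous_len.measurable

theorem len_le_sum {N : ℕ} (x : Fin N → ℝ) : len x ≤ ∑ i, |x i| := by
  unfold len
  rw [Real.sqrt_le_left (Finset.sum_nonneg fun i _ => abs_nonneg _)]
  have := Finset.sum_sq_le_sq_sum_of_nonneg (s := Finset.univ) (f := fun i => |x i|)
    fun i _ => abs_nonneg _
  simpa [dotProduct, sq_abs, sq] using this

/-- The density of the standard Gaussian measure. -/
theorem stdG_eq_withDensity (N : ℕ) :
    stdG N = (volume : Measure (Fin N → ℝ)).withDensity
      fun x => ENNReal.ofReal (∏ i, gaussianPDFReal 0 1 (x i)) := by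
  refine Measure.pi_eq fun s hs => ?_
  have hm : Measurable fun x : Fin N → ℝ => ∏ i, gaussianPDFReal 0 1 (x i) := by fun_prop
  have h0 : ∀ x : Fin N → ℝ, 0 ≤ ∏ i, gaussianPDFReal 0 1 (x i) :=
    fun x => Finset.prod_nonneg fun i _ => gaussianPDFReal_nonneg _ _ _
  rw [withDensity_apply _ (MeasurableSet.univ_pi hs), volume_pi, Measure.restrict_pi_pi,
    ← ofReal_integral_eq_lintegral_ofReal]
  · rw [integral_fintype_prod_eq_prod (f := fun _ => gaussianPDFReal 0 1),
      ENNReal.ofReal_prod_of_nonneg]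
    · exact Finset.prod_congr rfl fun i _ => (gaussianReal_apply_eq_integral 0 one_ne_zero _).symm
    · exact fun i _ => integral_nonneg fun x => gaussianPDFReal_nonneg _ _ _
  · exact Integrable.fintype_prod (f := fun _ => gaussianPDFReal 0 1)
      fun i => (integrable_gaussianPDFReal 0 1).restrict
  · exact ae_of_all _ h0

theorem prod_gaussianPDFReal {N : ℕ} (x : Fin N → ℝ) :
    ∏ i, gaussianPDFReal 0 1 (x i) = (√(2 * Real.pi))⁻¹ ^ N * Real.exp (-(x ⬝ᵥ x) / 2) := by
  simp only [gaussianPDFReal, sub_zero, NNReal.coe_one, mul_one, Finset.prod_mul_distrib,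
    Finset.prod_const, Finset.card_univ, Fintype.card_fin, ← Real.exp_sum]
  congr 2
  rw [dotProduct, ← Finset.sum_neg_distrib, Finset.sum_div]
  exact Finset.sum_congr rfl fun i _ => by ring

theorem integral_stdG {N : ℕ} (F : (Fin N → ℝ) → ℝ) :
    ∫ x, F x ∂stdG N = (√(2 * Real.pi))⁻¹ ^ N * ∫ x, Real.exp (-(x ⬝ᵥ x) / 2) * F x := by
  rw [stdG_eq_withDensity, integral_withDensity_eq_integral_toReal_smul (by fun_prop)
    (ae_of_all _ fun _ => ENNReal.ofReal_lt_top), ← integral_const_mul]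
  refine integral_congr_ae (ae_of_all _ fun x => ?_)
  simp only
  rw [ENNReal.toReal_ofReal (Finset.prod_nonneg fun i _ => gaussianPDFReal_nonneg _ _ _),
    prod_gaussianPDFReal, smul_eq_mul, mul_assoc]

/-- Completing the square. -/
theorem integral_stdG_square {N : ℕ} {c : ℝ} (hc : 0 < c) (w : Fin N → ℝ)
    (F : (Fin N → ℝ) → ℝ) :
    ∫ z, Real.exp (w ⬝ᵥ z - (c - 1) * (z ⬝ᵥ z) / 2) * F z ∂stdG N =
      (√c)⁻¹ ^ N * Real.exp (w ⬝ᵥ w / (2 * c)) *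
        ∫ z, F (c⁻¹ • w + (√c)⁻¹ • z) ∂stdG N := by
  have hs : 0 < √c := Real.sqrt_pos.2 hc
  rw [integral_stdG, integral_stdG]
  set G : (Fin N → ℝ) → ℝ := fun z => Real.exp (-(c * (z ⬝ᵥ z)) / 2) * F (c⁻¹ • w + z) with hG
  -- The translation by `c⁻¹ w` removes the linear term; the dilation by `1/√c` below restores the
  -- unit variance.
  have h1 : ∫ z, Real.exp (-(z ⬝ᵥ z) / 2) *
      (Real.exp (w ⬝ᵥ z - (c - 1) * (z ⬝ᵥ z) / 2) * F z) =
      Real.exp (w ⬝ᵥ w / (2 * c)) * ∫ z, G z := by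
    rw [← integral_add_left_eq_self _ (c⁻¹ • w), ← integral_const_mul]
    refine integral_congr_ae (ae_of_all _ fun z => ?_)
    simp only [hG]
    rw [← mul_assoc, ← mul_assoc, ← Real.exp_add, ← Real.exp_add]
    congr 2
    simp only [dotProduct_add, add_dotProduct, smul_dotProduct, dotProduct_smul, smul_eq_mul]
    rw [dotProduct_comm z w]
    field_simp
    ring
  have h2 : ∫ z, Real.exp (-(z ⬝ᵥ z) / 2) * F (c⁻¹ • w + (√c)⁻¹ • z) =
      ∫ z, G ((√c)⁻¹ • z) := by
    refine integral_congr_ae (ae_of_all _ fun z => ?_)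
    simp only [hG, dotProduct_smul, smul_dotProduct, smul_eq_mul]
    congr 2
    have h3 : c * (√c)⁻¹ * (√c)⁻¹ = 1 := by
      rw [mul_assoc, ← mul_inv, Real.mul_self_sqrt hc.le, mul_inv_cancel₀ hc.ne']
    rw [← mul_assoc, ← mul_assoc, h3, one_mul]
  rw [h1, h2, Measure.integral_comp_smul]
  simp only [Module.finrank_fintype_fun_eq_card, Fintype.card_fin, smul_eq_mul]
  rw [abs_of_pos (by positivity)]
  field_simp

theorem integral_exp_dot_stdG {N : ℕ} (w : Fin N → ℝ) :
    ∫ z, Real.exp (w ⬝ᵥ z) ∂stdG N = Real.exp (w ⬝ᵥ w / 2) := by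
  have := integral_stdG_square one_pos w fun _ => 1
  simpa using this

/-- Independent centred Gaussian vectors add up to a Gaussian vector. -/
theorem stdG_prod_map (N : ℕ) (a b : ℝ) :
    ((stdG N).prod (stdG N)).map (fun p => a • p.1 + b • p.2) =
      (stdG N).map fun z => √(a ^ 2 + b ^ 2) • z := by
  have h1 : ((gaussianReal 0 1).prod (gaussianReal 0 1)).map (fun p : ℝ × ℝ => a * p.1 + b * p.2) =
      (gaussianReal 0 1).map fun z => √(a ^ 2 + b ^ 2) * z := by
    have e : (fun p : ℝ × ℝ => a * p.1 + b * p.2) =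
        (fun p : ℝ × ℝ => p.1 + p.2) ∘ Prod.map (a * ·) (b * ·) := rfl
    rw [e, ← Measure.map_map (by fun_prop) (by fun_prop), ← Measure.map_prod_map _ _ (by fun_prop)
      (by fun_prop), gaussianReal_map_const_mul, gaussianReal_map_const_mul,
      gaussianReal_map_const_mul]
    change Measure.conv _ _ = _
    rw [gaussianReal_conv_gaussianReal]
    congr 1
    · simp
    · ext
      simp [Real.sq_sqrt (add_nonneg (sq_nonneg a) (sq_nonneg b))]
  have h2 := (measurePreserving_arrowProdEquivProdArrow ℝ ℝ (Fin N)
    (fun _ => gaussianReal 0 1) (fun _ => gaussianReal 0 1)).map_eq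
  unfold stdG
  rw [← h2, Measure.map_map (by fun_prop) (MeasurableEquiv.measurable _)]
  have e2 : ((fun p : (Fin N → ℝ) × (Fin N → ℝ) => a • p.1 + b • p.2) ∘
      ⇑(MeasurableEquiv.arrowProdEquivProdArrow ℝ ℝ (Fin N))) =
      fun x i => a * (x i).1 + b * (x i).2 := rfl
  have e3 : (fun z : Fin N → ℝ => √(a ^ 2 + b ^ 2) • z) =
      fun z i => √(a ^ 2 + b ^ 2) * z i := rfl
  have e4 := Measure.pi_map_pi (μ := fun _ : Fin N => (gaussianReal 0 1).prod (gaussianReal 0 1))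
    (f := fun _ (p : ℝ × ℝ) => a * p.1 + b * p.2) (fun _ => by fun_prop)
  have e5 := Measure.pi_map_pi (μ := fun _ : Fin N => gaussianReal 0 1)
    (f := fun _ z => √(a ^ 2 + b ^ 2) * z) (fun _ => by fun_prop)
  rw [e2, e3]
  refine e4.trans (Eq.trans ?_ e5.symm)
  simp_rw [h1]

theorem integral_stdG_add {N : ℕ} (a b : ℝ) {F : (Fin N → ℝ) → ℝ} (hF : Measurable F) :
    ∫ p : (Fin N → ℝ) × (Fin N → ℝ), F (a • p.1 + b • p.2) ∂(stdG N).prod (stdG N) =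
      ∫ z, F (√(a ^ 2 + b ^ 2) • z) ∂stdG N := by
  have h := congrArg (fun μ => ∫ x, F x ∂μ) (stdG_prod_map N a b)
  rwa [integral_map (by fun_prop) hF.aestronglyMeasurable,
    integral_map (by fun_prop) hF.aestronglyMeasurable] at h

/-- The Euclidean length is at most the sum of the `|x i|`, so the exponential is dominated by a
product of one-dimensional integrable functions. -/
theorem integrable_exp_len {N : ℕ} (c : ℝ) :
    Integrable (fun z : Fin N → ℝ => Real.exp (c * len z)) (stdG N) := by
  have h1 : Integrable (fun x : ℝ => Real.exp (|c| * |x|)) (gaussianReal 0 1) := by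
    refine Integrable.mono' ((integrable_exp_mul_gaussianReal (μ := 0) (v := 1) |c|).add
      (integrable_exp_mul_gaussianReal (μ := 0) (v := 1) (-|c|))) (by fun_prop)
      (ae_of_all _ fun x => ?_)
    rw [Real.norm_of_nonneg (Real.exp_pos _).le]
    simp only [Pi.add_apply]
    rcases abs_cases x with ⟨h, _⟩ | ⟨h, _⟩ <;> rw [h]
    · exact le_add_of_nonneg_right (Real.exp_pos _).le
    · rw [mul_neg, neg_mul]
      exact le_add_of_nonneg_left (Real.exp_pos _).le
  refine Integrable.mono' (Integrable.fintype_prod (ι := Fin N) (μ := fun _ => gaussianReal 0 1)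
    (f := fun _ x => Real.exp (|c| * |x|)) fun _ => h1) (by fun_prop) (ae_of_all _ fun z => ?_)
  rw [Real.norm_of_nonneg (Real.exp_pos _).le, ← Real.exp_sum, ← Finset.mul_sum]
  refine Real.exp_le_exp.2 ((mul_le_mul_of_nonneg_right (le_abs_self c) (len_nonneg z)).trans ?_)
  exact mul_le_mul_of_nonneg_left (len_le_sum z) (abs_nonneg c)

theorem integrable_len_pow_mul_exp {N : ℕ} (k : ℕ) (c : ℝ) :
    Integrable (fun z : Fin N → ℝ => len z ^ k * Real.exp (c * len z)) (stdG N) := by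
  refine Integrable.mono' ((integrable_exp_len (N := N) (1 + c)).const_mul (k.factorial : ℝ))
    (by fun_prop) (ae_of_all _ fun z => ?_)
  have h0 := len_nonneg z
  rw [Real.norm_of_nonneg (by positivity), add_mul, one_mul, Real.exp_add, ← mul_assoc]
  refine mul_le_mul_of_nonneg_right ?_ (Real.exp_pos _).le
  have := Real.pow_div_factorial_le_exp _ h0 k
  rw [div_le_iff₀ (by positivity)] at this
  linarith

theorem integrable_len_pow {N : ℕ} (k : ℕ) :
    Integrable (fun z : Fin N → ℝ => len z ^ k) (stdG N) := by
  simpa using integrable_len_pow_mul_exp (N := N) k 0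

theorem integral_coord_sq_stdG {N : ℕ} (i : Fin N) : ∫ z, z i ^ 2 ∂stdG N = 1 := by
  have h2 : ∫ z, z i ^ 2 ∂stdG N = ∫ x, x ^ 2 ∂gaussianReal 0 1 := by
    rw [← (measurePreserving_eval (fun _ : Fin N => gaussianReal 0 1) i).map_eq,
      integral_map (measurable_pi_apply i).aemeasurable (by fun_prop)]
    rfl
  rw [h2]
  have h3 := variance_id_gaussianReal (μ := 0) (v := 1)
  rw [variance_eq_sub (memLp_id_gaussianReal 2)] at h3
  simpa using h3

theorem integral_dot_self_stdG {N : ℕ} : ∫ z, z ⬝ᵥ z ∂stdG N = N := by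
  have h : ∀ i : Fin N, Integrable (fun z : Fin N → ℝ => z i * z i) (stdG N) := fun i => by
    refine Integrable.mono' (integrable_len_pow (N := N) 2) (by fun_prop) (ae_of_all _ fun z => ?_)
    rw [len_sq, Real.norm_of_nonneg (mul_self_nonneg _)]
    exact Finset.single_le_sum (f := fun i => z i * z i) (fun j _ => mul_self_nonneg (z j))
      (Finset.mem_univ i)
  unfold dotProduct
  rw [integral_finsetSum _ fun i _ => h i]
  simp_rw [← sq, integral_coord_sq_stdG]
  simp

theorem iIndepFun_coord_stdG (N : ℕ) : iIndepFun (fun (i : Fin N) (z : Fin N → ℝ) => z i) (stdG N) :=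
  iIndepFun_pi (Ω := fun _ : Fin N => ℝ) (μ := fun _ => gaussianReal 0 1) (X := fun _ x => x)
    fun _ => by fun_prop

theorem integral_coord_mul_stdG {N : ℕ} {i j : Fin N} (h : i ≠ j) : ∫ z, z i * z j ∂stdG N = 0 := by
  have hi : ∀ i : Fin N, ∫ z, z i ∂stdG N = 0 := fun i => by
    have h2 : ∫ z, z i ∂stdG N = ∫ x, x ∂gaussianReal 0 1 := by
      rw [← (measurePreserving_eval (fun _ : Fin N => gaussianReal 0 1) i).map_eq,
        integral_map (measurable_pi_apply i).aemeasurable (by fun_prop)]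
      rfl
    simpa using h2
  have := ((iIndepFun_coord_stdG N).indepFun h).integral_mul_eq_mul_integral
    (measurable_pi_apply i).aestronglyMeasurable (measurable_pi_apply j).aestronglyMeasurable
  simpa [hi] using this

theorem integral_dot_sq_stdG {N : ℕ} (w : Fin N → ℝ) : ∫ z, (w ⬝ᵥ z) ^ 2 ∂stdG N = w ⬝ᵥ w := by
  have h : ∀ i j : Fin N, Integrable (fun z : Fin N → ℝ => z i * z j) (stdG N) := fun i j => by
    refine Integrable.mono' (integrable_len_pow (N := N) 2) (by fun_prop) (ae_of_all _ fun z => ?_)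
    have hl : ∀ i, |z i| ≤ len z := fun i => by
      refine Real.abs_le_sqrt ?_
      rw [sq]
      exact Finset.single_le_sum (f := fun i => z i * z i) (fun j _ => mul_self_nonneg (z j))
        (Finset.mem_univ i)
    rw [Real.norm_eq_abs, abs_mul, sq]
    exact mul_le_mul (hl i) (hl j) (abs_nonneg _) (len_nonneg z)
  have e : ∀ z : Fin N → ℝ, (w ⬝ᵥ z) ^ 2 = ∑ i, ∑ j, w i * w j * (z i * z j) := fun z => by
    rw [sq, dotProduct, Finset.sum_mul_sum]
    exact Finset.sum_congr rfl fun i _ => Finset.sum_congr rfl fun j _ => by ring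
  simp_rw [e]
  rw [integral_finsetSum _ fun i _ => integrable_finsetSum _ fun j _ => (h i j).const_mul _]
  refine Finset.sum_congr rfl fun i _ => ?_
  rw [integral_finsetSum _ fun j _ => (h i j).const_mul _, Finset.sum_eq_single i]
  · rw [integral_const_mul]
    simp_rw [← sq, integral_coord_sq_stdG, mul_one]
  · intro j _ hj
    rw [integral_const_mul, integral_coord_mul_stdG hj.symm, mul_zero]
  · simp

/-- The squares of the coordinates are independent, so variances add up. Only the linear growth in
`N` matters for Chebyshev's inequality; the value of `c` is not needed. -/
theorem exists_variance_dot_self_stdG : ∃ c : ℝ, 0 ≤ c ∧ ∀ N : ℕ,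
    Var[fun z : Fin N → ℝ => z ⬝ᵥ z; stdG N] = N * c := by
  refine ⟨Var[fun x : ℝ => x * x; gaussianReal 0 1], variance_nonneg _ _, fun N => ?_⟩
  have hm : MemLp (fun x : ℝ => x * x) 2 (gaussianReal 0 1) := by
    have := memLp_id_gaussianReal (μ := 0) (v := 1) 4
    have h2 := this.norm_rpow_div 2
    have h3 := h2.ae_eq (g := fun x : ℝ => x * x) (ae_of_all _ fun x => by
      simp [sq])
    convert h3 using 1
    rw [ENNReal.eq_div_iff (by simp) (by simp)]
    norm_num
  have hp := fun i : Fin N => measurePreserving_eval (fun _ : Fin N => gaussianReal 0 1) i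
  have e : (fun z : Fin N → ℝ => z ⬝ᵥ z) = ∑ i : Fin N, fun z => z i * z i := by
    ext z; simp [dotProduct]
  rw [e, IndepFun.variance_sum]
  · rw [Finset.sum_congr rfl (g := fun _ => Var[fun x : ℝ => x * x; gaussianReal 0 1])]
    · simp
    · intro i _
      have h2 := variance_map (μ := stdG N) (X := fun x : ℝ => x * x)
        (by fun_prop) (hp i).measurable.aemeasurable
      rw [stdG, (hp i).map_eq] at h2
      exact h2.symm
  · intro i _
    exact hm.comp_measurePreserving (hp i)
  · intro i _ j _ hij
    exact ((iIndepFun_coord_stdG N).indepFun hij).comp (φ := fun x => x * x) (ψ := fun x => x * x)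
      (by fun_prop) (by fun_prop)

/-- The weak law of large numbers for the squared length of a Gaussian vector. -/
theorem tendsto_stdG_concentration {ε : ℝ} (hε : 0 < ε) :
    Tendsto (fun N : ℕ => (stdG N).real {z | ε * N ≤ |z ⬝ᵥ z - N|}) atTop (𝓝 0) := by
  obtain ⟨c, hc, hv⟩ := exists_variance_dot_self_stdG
  have hlim : Tendsto (fun N : ℕ => c / ε ^ 2 * (1 / (N : ℝ))) atTop (𝓝 0) := by
    simpa using tendsto_one_div_atTop_nhds_zero_nat.const_mul (c / ε ^ 2)
  refine squeeze_zero' (Eventually.of_forall fun N => measureReal_nonneg) ?_ hlim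
  filter_upwards [eventually_gt_atTop 0] with N hN
  have hN' : (0 : ℝ) < N := Nat.cast_pos.2 hN
  have hm : MemLp (fun z : Fin N → ℝ => z ⬝ᵥ z) 2 (stdG N) := by
    rw [memLp_two_iff_integrable_sq (by fun_prop)]
    refine (integrable_len_pow (N := N) 4).congr (ae_of_all _ fun z => ?_)
    simp only
    rw [← len_sq]; ring
  have h := meas_ge_le_variance_div_sq hm (mul_pos hε hN')
  rw [hv, integral_dot_self_stdG] at h
  have h2 := ENNReal.toReal_mono ENNReal.ofReal_ne_top h
  rw [ENNReal.toReal_ofReal (by positivity)] at h2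
  refine h2.trans (le_of_eq ?_)
  field_simp


/-! ### Exponential means -/

section ExpMean

variable {Ω : Type*} [MeasurableSpace Ω] {μ : Measure Ω}

/-- The exponential mean `m⁻¹ log E exp (m W)`, equal to the mean for `m = 0`. -/
def expMean (μ : Measure Ω) (m : ℝ) (W : Ω → ℝ) : ℝ :=
  if m = 0 then ∫ ω, W ω ∂μ else m⁻¹ * Real.log (∫ ω, Real.exp (m * W ω) ∂μ)

/-- All exponential moments are finite. -/
def ExpInt (μ : Measure Ω) (W : Ω → ℝ) : Prop := ∀ t : ℝ, Integrable (fun ω => Real.exp (t * W ω)) μ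

theorem ExpInt.aemeasurable [NeZero μ] {W : Ω → ℝ} (h : ExpInt μ W) : AEMeasurable W μ := by
  have := (h 1).aestronglyMeasurable.aemeasurable.log
  simpa using this

theorem ExpInt.eq_univ {W : Ω → ℝ} (h : ExpInt μ W) : integrableExpSet W μ = univ :=
  eq_univ_of_forall h

theorem ExpInt.mem_interior {W : Ω → ℝ} (h : ExpInt μ W) (t : ℝ) :
    t ∈ interior (integrableExpSet W μ) := by
  rw [h.eq_univ, interior_univ]; exact mem_univ _

theorem ExpInt.integrable {W : Ω → ℝ} (h : ExpInt μ W) : Integrable W μ := by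
  simpa using integrable_pow_of_mem_interior_integrableExpSet (h.mem_interior 0) 1

theorem ExpInt.add_const {W : Ω → ℝ} (h : ExpInt μ W) (c : ℝ) : ExpInt μ fun ω => W ω + c := by
  intro t
  simp_rw [mul_add, Real.exp_add]
  exact (h t).mul_const _

theorem expMean_add_const [IsProbabilityMeasure μ] {m : ℝ} {W : Ω → ℝ} (h : ExpInt μ W) (c : ℝ) :
    expMean μ m (fun ω => W ω + c) = expMean μ m W + c := by
  unfold expMean
  split_ifs with hm
  · rw [integral_add h.integrable (integrable_const c)]; simp
  · simp_rw [mul_add, Real.exp_add]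
    rw [integral_mul_const, Real.log_mul (integral_exp_pos (h m)).ne' (Real.exp_pos _).ne',
      Real.log_exp, mul_add, inv_mul_cancel_left₀ hm]

theorem expMean_const [IsProbabilityMeasure μ] (m c : ℝ) : expMean μ m (fun _ => c) = c := by
  unfold expMean
  split_ifs with hm
  · simp
  · simp [hm]

theorem expMean_mono [IsProbabilityMeasure μ] {m : ℝ} (hm : 0 ≤ m) {W V : Ω → ℝ}
    (hW : ExpInt μ W) (hV : Integrable V μ) (hV' : Integrable (fun ω => Real.exp (m * V ω)) μ)
    (h : ∀ᵐ ω ∂μ, W ω ≤ V ω) : expMean μ m W ≤ expMean μ m V := by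
  unfold expMean
  split_ifs with h0
  · exact integral_mono_ae hW.integrable hV h
  · refine mul_le_mul_of_nonneg_left (Real.log_le_log (integral_exp_pos (hW m)) ?_)
      (inv_nonneg.2 hm)
    refine integral_mono_ae (hW m) hV' ?_
    filter_upwards [h] with ω hω
    exact Real.exp_le_exp.2 (mul_le_mul_of_nonneg_left hω hm)

theorem abs_expMean_sub_le [IsProbabilityMeasure μ] {m : ℝ} (hm : 0 ≤ m) {W V : Ω → ℝ}
    (hW : ExpInt μ W) (hV : ExpInt μ V) {c : ℝ} (h : ∀ᵐ ω ∂μ, |W ω - V ω| ≤ c) :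
    |expMean μ m W - expMean μ m V| ≤ c := by
  have h1 := expMean_mono hm hW (hV.add_const c).integrable (hV.add_const c m)
    (by filter_upwards [h] with ω hω; linarith [(abs_le.1 hω).2])
  have h2 := expMean_mono hm hV (hW.add_const c).integrable (hW.add_const c m)
    (by filter_upwards [h] with ω hω; linarith [(abs_le.1 hω).1])
  rw [expMean_add_const hV] at h1
  rw [expMean_add_const hW] at h2
  exact abs_le.2 ⟨by linarith, by linarith⟩

/-- A ratio of exponential moments is an exponential moment under the tilted measure. The increment
of an exponential mean thus becomes the exponential mean of the increment. -/
theorem expMean_add_eq [IsProbabilityMeasure μ] {m : ℝ} {W D : Ω → ℝ}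
    (hW : ExpInt μ W) (hD : Integrable D μ)
    (hWD : Integrable (fun ω => Real.exp (m * (W ω + D ω))) μ) :
    expMean μ m (fun ω => W ω + D ω) =
      expMean μ m W + expMean (μ.tilted fun ω => m * W ω) m D := by
  unfold expMean
  split_ifs with h0
  · have : μ.tilted (fun ω => m * W ω) = μ := by simp [h0]
    rw [this, integral_add hW.integrable hD]
  · have hp : (0 : ℝ) < ∫ ω, Real.exp (m * (W ω + D ω)) ∂μ := integral_exp_pos hWD
    have e := integral_exp_tilted (μ := μ) (fun ω => m * W ω) (fun ω => m * D ω)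
    simp only [Pi.add_apply, ← mul_add] at e
    rw [e, Real.log_div hp.ne' (integral_exp_pos (hW m)).ne']
    ring

theorem expInt_of_bound [IsFiniteMeasure μ] {Y : Ω → ℝ} (hm : AEMeasurable Y μ) {c : ℝ}
    (h : ∀ᵐ ω ∂μ, |Y ω| ≤ c) : ExpInt μ Y := fun t => by
  refine integrable_exp_mul_of_mem_Icc (a := -c) (b := c) hm ?_
  filter_upwards [h] with ω hω using abs_le.1 hω

/-- Hoeffding's bound for the exponential mean of a bounded variable. -/
theorem abs_expMean_sub_integral_le [IsProbabilityMeasure μ] {m : ℝ} (hm : 0 ≤ m) {Y : Ω → ℝ}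
    (hY : AEMeasurable Y μ) {c : ℝ} (hc : 0 ≤ c) (h : ∀ᵐ ω ∂μ, |Y ω| ≤ c) :
    |expMean μ m Y - ∫ ω, Y ω ∂μ| ≤ m * c ^ 2 / 2 := by
  have hE := expInt_of_bound hY h
  unfold expMean
  split_ifs with h0
  · simp [h0]
  have hm' : 0 < m := lt_of_le_of_ne hm (Ne.symm h0)
  have hI : ∀ᵐ ω ∂μ, Y ω ∈ Icc (-c) c := by filter_upwards [h] with ω hω using abs_le.1 hω
  -- Upper bound: Hoeffding's lemma on `[-c, c]`, with variance proxy `c²`.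
  have h1 := (hasSubgaussianMGF_of_mem_Icc hY hI).mgf_le m
  have e1 : mgf (fun ω => Y ω - ∫ ω, Y ω ∂μ) μ m =
      (∫ ω, Real.exp (m * Y ω) ∂μ) * Real.exp (-(m * ∫ ω, Y ω ∂μ)) := by
    unfold mgf
    simp_rw [mul_sub, sub_eq_add_neg, Real.exp_add]
    rw [integral_mul_const]
  rw [e1] at h1
  set A := ∫ ω, Real.exp (m * Y ω) ∂μ with hA
  set y := ∫ ω, Y ω ∂μ with hy
  have hA0 : 0 < A := integral_exp_pos (hE m)
  have h2 := Real.log_le_log (by positivity) h1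
  rw [Real.log_mul hA0.ne' (Real.exp_pos _).ne', Real.log_exp, Real.log_exp] at h2
  -- Lower bound: Jensen's inequality, through the tangent of the exponential at `m * y`.
  have h3 : Real.exp (m * y) ≤ A := by
    have h4 : ∫ ω, Real.exp (m * y) * (1 + m * (Y ω - y)) ∂μ ≤ A := by
      refine integral_mono (((integrable_const _).add
        ((hE.integrable.sub (integrable_const _)).const_mul m)).const_mul _) (hE m) fun ω => ?_
      have := Real.add_one_le_exp (m * (Y ω - y))
      calc _ ≤ Real.exp (m * y) * Real.exp (m * (Y ω - y)) :=
            mul_le_mul_of_nonneg_left (by linarith) (Real.exp_pos _).le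
        _ = _ := by rw [← Real.exp_add]; ring_nf
    have h5 : ∫ ω, (1 + m * (Y ω - y)) ∂μ = 1 := by
      have hi : Integrable (fun ω => m * (Y ω - y)) μ :=
        (hE.integrable.sub (integrable_const y)).const_mul m
      rw [integral_add (integrable_const _) hi,
        integral_const_mul, integral_sub hE.integrable (integrable_const _)]
      simp [← hy]
    rw [integral_const_mul, h5, mul_one] at h4
    exact h4
  have h5 := Real.log_le_log (Real.exp_pos _) h3
  rw [Real.log_exp] at h5
  have h6 : ((((‖c - -c‖₊ / 2) ^ 2 : ℝ≥0)) : ℝ) = c ^ 2 := by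
    push_cast
    rw [Real.norm_of_nonneg (by linarith)]
    ring
  rw [h6] at h2
  rw [abs_le]
  have e : m⁻¹ * Real.log A - y = (Real.log A - m * y) / m := by field_simp
  rw [e]
  constructor
  · have : 0 ≤ (Real.log A - m * y) / m := div_nonneg (by linarith) hm
    nlinarith [mul_nonneg hm (sq_nonneg c)]
  · rw [div_le_iff₀ hm']
    nlinarith

/-- First order expansion of the exponential mean: `D` is an increment and `Y` its linear part.
Under the tilted measure, replacing `D` by `Y` costs `r`, and replacing the exponential mean of `Y`
by its mean costs Hoeffding's `m c² / 2`. -/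
theorem abs_expMean_add_sub_le [IsProbabilityMeasure μ] {m : ℝ} (hm : 0 ≤ m) {W D Y : Ω → ℝ}
    (hW : ExpInt μ W) (hWD : ExpInt μ fun ω => W ω + D ω) (hD : ExpInt μ D)
    (hDt : ExpInt (μ.tilted fun ω => m * W ω) D)
    (hY : Measurable Y) {c r : ℝ} (hc : 0 ≤ c) (hYc : ∀ᵐ ω ∂μ, |Y ω| ≤ c)
    (hr : ∀ᵐ ω ∂μ, |D ω - Y ω| ≤ r) :
    |expMean μ m (fun ω => W ω + D ω) - expMean μ m W -
      ∫ ω, Y ω ∂(μ.tilted fun ω => m * W ω)| ≤ r + m * c ^ 2 / 2 := by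
  have hac := tilted_absolutelyContinuous μ fun ω => m * W ω
  have := isProbabilityMeasure_tilted (hW m)
  rw [expMean_add_eq hW hD.integrable (hWD m), add_sub_cancel_left]
  have h1 := abs_expMean_sub_integral_le hm hY.aemeasurable hc (hac.ae_le hYc)
  have h2 := abs_expMean_sub_le hm hDt (expInt_of_bound hY.aemeasurable (hac.ae_le hYc))
    (hac.ae_le hr)
  have h3 := abs_add_le (expMean (μ.tilted fun ω => m * W ω) m D -
    expMean (μ.tilted fun ω => m * W ω) m Y) (expMean (μ.tilted fun ω => m * W ω) m Y -
    ∫ ω, Y ω ∂(μ.tilted fun ω => m * W ω))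
  rw [sub_add_sub_cancel] at h3
  linarith

/-- The exponential mean at `m` is the slope of the cumulant generating function between `0` and
`m`. Its second derivative is a tilted variance, hence lies between `0` and `B` on `[0, 1]`, so the
slope is nondecreasing in `m` and grows at rate at most `B / 2`. -/
theorem ExpInt.expMean_sub_le {W : Ω → ℝ} [IsProbabilityMeasure μ] (h : ExpInt μ W) {B m m' : ℝ}
    (hm : 0 ≤ m) (hmm : m ≤ m') (hm' : m' ≤ 1)
    (hB : ∀ s ∈ Icc (0 : ℝ) 1, ∫ ω, W ω ^ 2 * Real.exp (s * W ω) ∂μ ≤ B * mgf W μ s) :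
    |expMean μ m' W - expMean μ m W| ≤ (m' - m) / 2 * B := by
  rcases hmm.eq_or_lt with rfl | hlt
  · simp
  have hmpos : 0 < m' := hm.trans_lt hlt
  have hdiff : Differentiable ℝ (cgf W μ) := fun t => (analyticAt_cgf (h.mem_interior t)).differentiableAt
  have hdiff' : Differentiable ℝ (deriv (cgf W μ)) :=
    fun t => (analyticAt_cgf (h.mem_interior t)).deriv.differentiableAt
  have hd2 : ∀ t, deriv (deriv (cgf W μ)) t = iteratedDeriv 2 (cgf W μ) t := fun t => by
    rw [iteratedDeriv_succ, iteratedDeriv_one]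
  have hpos : ∀ t, 0 < mgf W μ t := fun t => integral_exp_pos (h t)
  have hconv : ConvexOn ℝ (Icc 0 1) (cgf W μ) := by
    refine convexOn_of_deriv2_nonneg' (convex_Icc 0 1) hdiff.differentiableOn
      hdiff'.differentiableOn fun t _ => ?_
    simp only [Function.iterate_succ, Function.iterate_zero, Function.comp_apply, id_eq]
    rw [hd2, iteratedDeriv_two_cgf_eq_integral (h.mem_interior t)]
    exact div_nonneg (integral_nonneg fun ω => by positivity) (hpos t).le
  -- The bound on the second derivative, restated as convexity: the tilted variance is at most the
  -- tilted second moment, which `hB` bounds by `B`.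
  have hconc : ConvexOn ℝ (Icc 0 1) fun t => B / 2 * t ^ 2 - cgf W μ t := by
    have hd : deriv (fun t => B / 2 * t ^ 2 - cgf W μ t) = fun t => B * t - deriv (cgf W μ) t := by
      ext t
      rw [deriv_fun_sub (by fun_prop) (hdiff t)]
      simp; ring
    refine convexOn_of_deriv2_nonneg' (convex_Icc 0 1) (by fun_prop) ?_ fun t ht => ?_
    · rw [hd]; fun_prop
    · simp only [Function.iterate_succ, Function.iterate_zero, Function.comp_apply, id_eq]
      rw [hd, deriv_fun_sub (by fun_prop) (hdiff' t), hd2,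
        iteratedDeriv_two_cgf (h.mem_interior t)]
      have := hB t ht
      rw [← div_le_iff₀ (hpos t)] at this
      have e : deriv (fun t => B * t) t = B := by simp
      rw [e]
      nlinarith [sq_nonneg (deriv (cgf W μ) t)]
  have h0 : (0 : ℝ) ∈ Icc (0 : ℝ) 1 := ⟨le_rfl, zero_le_one⟩
  have hmI : m ∈ Icc (0 : ℝ) 1 := ⟨hm, hmm.trans hm'⟩
  have hmI' : m' ∈ Icc (0 : ℝ) 1 := ⟨hmpos.le, hm'⟩
  have hE' : expMean μ m' W = cgf W μ m' / m' := by
    unfold expMean cgf mgf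
    rw [if_neg hmpos.ne', div_eq_inv_mul]
  -- Both parts say that the slope at `0` of a convex function is monotone. For `m = 0` the slope is
  -- replaced by the derivative at `0`, which is the mean of `W`.
  have key : expMean μ m W ≤ cgf W μ m' / m' ∧ 
      (0 - expMean μ m W) + B / 2 * m ≤ (B / 2 * m' - cgf W μ m' / m') := by
    rcases hm.eq_or_lt with rfl | hm0
    · have e0 : expMean μ 0 W = deriv (cgf W μ) 0 := by
        unfold expMean
        rw [if_pos rfl, deriv_cgf_zero (h.mem_interior 0)]; simp
      have h1 := hconv.deriv_le_slope h0 hmI' hmpos (hdiff 0)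
      have h2 := hconc.deriv_le_slope h0 hmI' hmpos (by fun_prop)
      rw [deriv_fun_sub (by fun_prop) (hdiff 0)] at h2
      simp only [slope_def_field, cgf_zero, sub_zero] at h1 h2
      refine ⟨by rw [e0]; exact h1, ?_⟩
      rw [e0]
      simp at h2
      rw [sub_div] at h2
      have e3 : B / 2 * m' ^ 2 / m' = B / 2 * m' := by field_simp
      rw [e3] at h2
      linarith
    · have e0 : expMean μ m W = cgf W μ m / m := by
        unfold expMean cgf mgf
        rw [if_neg hm0.ne', div_eq_inv_mul]
      have h1 := hconv.secant_mono h0 hmI hmI' hm0.ne' hmpos.ne' hmm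
      have h2 := hconc.secant_mono h0 hmI hmI' hm0.ne' hmpos.ne' hmm
      simp only [cgf_zero, sub_zero] at h1 h2
      refine ⟨by rw [e0]; exact h1, ?_⟩
      rw [e0]
      simp at h2
      rw [sub_div, sub_div] at h2
      have e3 : B / 2 * m' ^ 2 / m' = B / 2 * m' := by field_simp
      have e4 : B / 2 * m ^ 2 / m = B / 2 * m := by field_simp
      rw [e3, e4] at h2
      linarith
  rw [hE', abs_of_nonneg (by linarith [key.1])]
  linarith [key.2]

end ExpMean


/-! ### Regular functions -/

variable {N : ℕ}

/-- Lipschitz functions with respect to the Euclidean length. -/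
def Lip (R : ℝ) (f : (Fin N → ℝ) → ℝ) : Prop := ∀ x h, |f (x + h) - f x| ≤ R * len h

theorem Lip.continuous {R : ℝ} {f : (Fin N → ℝ) → ℝ} (hf : Lip R f) : Continuous f := by
  rw [continuous_iff_continuousAt]
  intro x
  rw [ContinuousAt, tendsto_iff_norm_sub_tendsto_zero]
  have h : Tendsto (fun y => R * len (y - x)) (𝓝 x) (𝓝 (R * len (x - x))) :=
    (Continuous.tendsto (by fun_prop) x)
  have h0 : len (x - x) = 0 := by simp [len]
  rw [h0, mul_zero] at h
  refine squeeze_zero (fun _ => norm_nonneg _) (fun y => ?_) h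
  simpa using hf x (y - x)

/-- Measurable functions of at most linear growth. -/
def LinGrowth (V : (Fin N → ℝ) → ℝ) : Prop :=
  Measurable V ∧ ∃ A B : ℝ, ∀ z, |V z| ≤ A + B * len z

theorem LinGrowth.expInt {V : (Fin N → ℝ) → ℝ} (h : LinGrowth V) : ExpInt (stdG N) V := by
  obtain ⟨hm, A, B, hV⟩ := h
  intro t
  refine Integrable.mono' ((integrable_exp_len (N := N) (|t| * B)).const_mul (Real.exp (|t| * A)))
    (by fun_prop) (ae_of_all _ fun z => ?_)
  rw [Real.norm_of_nonneg (Real.exp_pos _).le, ← Real.exp_add]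
  refine Real.exp_le_exp.2 ((le_abs_self _).trans ?_)
  rw [abs_mul]
  have := mul_le_mul_of_nonneg_left (hV z) (abs_nonneg t)
  linarith

theorem Lip.linGrowth {R : ℝ} {f : (Fin N → ℝ) → ℝ} (hf : Lip R f) (x : Fin N → ℝ) (a : ℝ) :
    LinGrowth fun z => f (x + a • z) := by
  have := hf.continuous.measurable
  refine ⟨by fun_prop, |f x|, R * |a|, fun z => ?_⟩
  have h := hf x (a • z)
  rw [len_smul] at h
  have h2 := abs_sub_abs_le_abs_sub (f (x + a • z)) (f x)
  linarith

theorem Lip.expInt {R : ℝ} {f : (Fin N → ℝ) → ℝ} (hf : Lip R f) (x : Fin N → ℝ) (a : ℝ) :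
    ExpInt (stdG N) fun z => f (x + a • z) := (hf.linGrowth x a).expInt

/-- Lipschitz functions with a first order expansion that is uniform in the base point. -/
structure Reg (R M : ℝ) (f : (Fin N → ℝ) → ℝ) : Prop where
  lip : Lip R f
  nonneg : 0 ≤ M
  grad : ∃ ℓ : (Fin N → ℝ) → Fin N → ℝ, Measurable ℓ ∧ (∀ x, len (ℓ x) ≤ R) ∧
    ∀ x h, |f (x + h) - f x - ℓ x ⬝ᵥ h| ≤ M * (h ⬝ᵥ h)

/-- Each coordinate of `ℓ` is the limit of the difference quotients of `f` with step `1/(n+1)`; the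
expansion bounds the error by `M/(n+1)`. -/
theorem measurable_of_expansion {f : (Fin N → ℝ) → ℝ} (hf : Measurable f) {M : ℝ}
    {ℓ : (Fin N → ℝ) → Fin N → ℝ}
    (h : ∀ x h, |f (x + h) - f x - ℓ x ⬝ᵥ h| ≤ M * (h ⬝ᵥ h)) : Measurable ℓ := by
  rw [measurable_pi_iff]
  intro i
  have hm : ∀ n : ℕ, Measurable fun x : Fin N → ℝ =>
      ((n : ℝ) + 1) * (f (x + (1 / ((n : ℝ) + 1)) • Pi.single i 1) - f x) := fun n => by fun_prop
  refine measurable_of_tendsto_metrizable hm ?_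
  rw [tendsto_pi_nhds]
  intro x
  rw [tendsto_iff_norm_sub_tendsto_zero]
  have hlim : Tendsto (fun n : ℕ => M * (1 / ((n : ℝ) + 1))) atTop (𝓝 0) := by
    simpa using tendsto_one_div_add_atTop_nhds_zero_nat.const_mul M
  refine squeeze_zero (fun _ => norm_nonneg _) (fun n => ?_) hlim
  have h1 := h x ((1 / ((n : ℝ) + 1)) • Pi.single i 1)
  simp only [dotProduct_smul, dotProduct_single, Pi.smul_apply, Pi.single_eq_same, smul_eq_mul,
    mul_one] at h1
  have hn : (0 : ℝ) < (n : ℝ) + 1 := by positivity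
  have e : ((n : ℝ) + 1) * (f (x + (1 / ((n : ℝ) + 1)) • Pi.single i 1) - f x) - ℓ x i =
      ((n : ℝ) + 1) * (f (x + (1 / ((n : ℝ) + 1)) • Pi.single i 1) - f x -
        1 / ((n : ℝ) + 1) * ℓ x i) := by field_simp
  rw [e, norm_mul, Real.norm_of_nonneg hn.le, Real.norm_eq_abs]
  refine (mul_le_mul_of_nonneg_left h1 hn.le).trans (le_of_eq ?_)
  field_simp

/-- The gradient of an exponential mean is the mean of the gradients under the tilted measure, so
its length is still at most `R`. The additional `R² / 2` in the quadratic error is Hoeffding's term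
with `c = R |h|` and `m ≤ 1`. -/
theorem reg_expMean {Ω : Type*} [MeasurableSpace Ω] {μ : Measure Ω} [IsProbabilityMeasure μ]
    {m : ℝ} (hm : 0 ≤ m) (hm1 : m ≤ 1) {R M : ℝ} (hR : 0 ≤ R) (hM : 0 ≤ M)
    {F : (Fin N → ℝ) → Ω → ℝ} {ℓ : (Fin N → ℝ) → Ω → Fin N → ℝ}
    (hF : ∀ x, ExpInt μ (F x)) (hℓ : ∀ x, Measurable (ℓ x))
    (hℓR : ∀ x, ∀ᵐ ω ∂μ, len (ℓ x ω) ≤ R)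
    (hlip : ∀ x h, ∀ᵐ ω ∂μ, |F (x + h) ω - F x ω| ≤ R * len h)
    (hexp : ∀ x h, ∀ᵐ ω ∂μ, |F (x + h) ω - F x ω - ℓ x ω ⬝ᵥ h| ≤ M * (h ⬝ᵥ h)) :
    Reg R (M + R ^ 2 / 2) fun x => expMean μ m (F x) := by
  have hl : Lip R fun x => expMean μ m (F x) := fun x h =>
    abs_expMean_sub_le hm (hF _) (hF _) (hlip x h)
  have hac := fun x => tilted_absolutelyContinuous μ fun ω => m * F x ω
  have hp := fun x => isProbabilityMeasure_tilted (hF x m)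
  have hcoord : ∀ (y : Fin N → ℝ) i, |y i| ≤ len y := fun y i => by
    refine Real.abs_le_sqrt ?_
    rw [sq]
    exact Finset.single_le_sum (f := fun i => y i * y i) (fun j _ => mul_self_nonneg (y j))
      (Finset.mem_univ i)
  have hint : ∀ x i, Integrable (fun ω => ℓ x ω i) (μ.tilted fun ω => m * F x ω) := fun x i => by
    have := hp x
    refine Integrable.of_bound (((measurable_pi_apply i).comp (hℓ x)).aestronglyMeasurable) R ?_
    filter_upwards [(hac x).ae_le (hℓR x)] with ω hω
    exact (hcoord _ i).trans hω
  have hdot : ∀ x h, ∫ ω, ℓ x ω ⬝ᵥ h ∂(μ.tilted fun ω => m * F x ω) =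
      (fun i => ∫ ω, ℓ x ω i ∂(μ.tilted fun ω => m * F x ω)) ⬝ᵥ h := fun x h => by
    unfold dotProduct
    rw [integral_finsetSum _ fun i _ => (hint x i).mul_const _]
    simp_rw [integral_mul_const]
  have hexp' : ∀ x h, |expMean μ m (F (x + h)) - expMean μ m (F x) -
      (fun i => ∫ ω, ℓ x ω i ∂(μ.tilted fun ω => m * F x ω)) ⬝ᵥ h| ≤
      (M + R ^ 2 / 2) * (h ⬝ᵥ h) := fun x h => by
    have hD : AEMeasurable (fun ω => F (x + h) ω - F x ω) μ :=
      (hF _).aemeasurable.sub (hF _).aemeasurable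
    have := hp x
    have e : (fun ω => F x ω + (F (x + h) ω - F x ω)) = F (x + h) := by ext; ring
    have key := abs_expMean_add_sub_le hm (hF x) (D := fun ω => F (x + h) ω - F x ω)
      (Y := fun ω => ℓ x ω ⬝ᵥ h) (c := R * len h) (r := M * (h ⬝ᵥ h)) (by rw [e]; exact hF _)
      (expInt_of_bound hD (hlip x h)) (expInt_of_bound (hD.mono_ac (hac x))
      ((hac x).ae_le (hlip x h))) (measurable_dot (hℓ x) measurable_const) (mul_nonneg hR (len_nonneg h))
      (by
        filter_upwards [hℓR x] with ω hω
        exact (abs_dot_le _ _).trans (mul_le_mul_of_nonneg_right hω (len_nonneg h))) (hexp x h)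
    rw [e, hdot] at key
    refine key.trans ?_
    rw [mul_pow, len_sq]
    have := mul_le_mul_of_nonneg_right hm1 (mul_nonneg (sq_nonneg R) (dot_self_nonneg h))
    linarith
  refine ⟨hl, by positivity, _, measurable_of_expansion hl.continuous.measurable hexp',
    fun x => ?_, hexp'⟩
  set y : Fin N → ℝ := fun i => ∫ ω, ℓ x ω i ∂(μ.tilted fun ω => m * F x ω) with hy
  have := hp x
  -- The mean gradient `y` is paired with itself: `|y|²` is the tilted mean of `ℓ ⬝ y`, which is at
  -- most `R |y|`.
  have h1 : len y ^ 2 ≤ R * len y := by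
    rw [len_sq, ← hdot]
    have hb : ∀ᵐ ω ∂(μ.tilted fun ω => m * F x ω), ‖ℓ x ω ⬝ᵥ y‖ ≤ R * len y := by
      filter_upwards [(hac x).ae_le (hℓR x)] with ω hω
      exact (abs_dot_le _ _).trans (mul_le_mul_of_nonneg_right hω (len_nonneg y))
    have := norm_integral_le_of_norm_le_const hb
    simpa using (le_abs_self _).trans this
  rcases (len_nonneg y).eq_or_lt with h0 | h0
  · rw [← h0]; exact hR
  · rw [sq] at h1
    exact le_of_mul_le_mul_right h1 h0

/-! ### The one-step operator -/

/-- The exponential mean of `f` over a Gaussian increment of variance `2 δ`. -/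
def T (m δ : ℝ) (f : (Fin N → ℝ) → ℝ) (x : Fin N → ℝ) : ℝ :=
  expMean (stdG N) m fun z => f (x + √(2 * δ) • z)

theorem Lip.apply_T {R : ℝ} {f : (Fin N → ℝ) → ℝ} (hf : Lip R f) {m : ℝ} (hm : 0 ≤ m) (δ : ℝ) :
    Lip R (T m δ f) := fun x h => by
  refine abs_expMean_sub_le hm (hf.expInt _ _) (hf.expInt _ _) (ae_of_all _ fun z => ?_)
  have := hf (x + √(2 * δ) • z) h
  rwa [add_right_comm] at this

theorem Reg.apply_T {R M : ℝ} (hR : 0 ≤ R) {f : (Fin N → ℝ) → ℝ} (hf : Reg R M f) {m : ℝ} (hm : 0 ≤ m)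
    (hm1 : m ≤ 1) (δ : ℝ) : Reg R (M + R ^ 2 / 2) (T m δ f) := by
  obtain ⟨ℓ, hℓ, hℓR, hexp⟩ := hf.grad
  refine reg_expMean hm hm1 hR hf.nonneg (ℓ := fun x z => ℓ (x + √(2 * δ) • z))
    (fun x => hf.lip.expInt x _) (fun x => by fun_prop) (fun x => ae_of_all _ fun z => hℓR _)
    (fun x h => ae_of_all _ fun z => ?_) (fun x h => ae_of_all _ fun z => ?_)
  · have := hf.lip (x + √(2 * δ) • z) h
    rwa [add_right_comm] at this
  · have := hexp (x + √(2 * δ) • z) h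
    rwa [add_right_comm] at this

theorem T_zero (m : ℝ) (f : (Fin N → ℝ) → ℝ) : T m 0 f = f := by
  ext x
  simp [T, expMean_const]

theorem abs_T_sub_le {R : ℝ} {f g : (Fin N → ℝ) → ℝ} (hf : Lip R f) (hg : Lip R g) {m : ℝ}
    (hm : 0 ≤ m) (δ : ℝ) {c : ℝ} (h : ∀ x, |f x - g x| ≤ c) (x : Fin N → ℝ) :
    |T m δ f x - T m δ g x| ≤ c :=
  abs_expMean_sub_le hm (hf.expInt _ _) (hg.expInt _ _) (ae_of_all _ fun _ => h _)

theorem LinGrowth.comp_add {V : (Fin N → ℝ) → ℝ} (hV : LinGrowth V) (a b : ℝ) :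
    ∀ t : ℝ, Integrable (fun p : (Fin N → ℝ) × (Fin N → ℝ) => Real.exp (t * V (a • p.1 + b • p.2)))
      ((stdG N).prod (stdG N)) := fun t => by
  have hm := hV.1
  have h := hV
  obtain ⟨_, A, B, hB⟩ := hV
  have h2 : LinGrowth fun z => V (√(a ^ 2 + b ^ 2) • z) := by
    refine ⟨by fun_prop, A, B * √(a ^ 2 + b ^ 2), fun z => (hB _).trans (le_of_eq ?_)⟩
    rw [len_smul, abs_of_nonneg (Real.sqrt_nonneg _), mul_assoc]
  have h3 := h2.expInt t
  have h4 : Integrable (fun x => Real.exp (t * V x))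
      ((stdG N).map fun z => √(a ^ 2 + b ^ 2) • z) := by
    rw [integrable_map_measure (by fun_prop) (by fun_prop)]
    exact h3
  rw [← stdG_prod_map, integrable_map_measure (by fun_prop) (by fun_prop)] at h4
  exact h4

/-- Semigroup property: for fixed `m` the logarithm of the inner operator cancels the outer
exponential, and independent Gaussian increments add their variances. -/
theorem T_T {R : ℝ} {f : (Fin N → ℝ) → ℝ} (hf : Lip R f) {m : ℝ} {δ δ' : ℝ}
    (hδ : 0 ≤ δ) (hδ' : 0 ≤ δ') : T m δ (T m δ' f) = T m (δ + δ') f := by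
  ext x
  have hs : √((√(2 * δ)) ^ 2 + (√(2 * δ')) ^ 2) = √(2 * (δ + δ')) := by
    rw [Real.sq_sqrt (by positivity), Real.sq_sqrt (by positivity)]; ring_nf
  have hV : LinGrowth fun y => f (x + y) := by simpa using hf.linGrowth x 1
  have hfm := hf.continuous.measurable
  have hI := hV.comp_add √(2 * δ) √(2 * δ')
  have key : ∀ G : ℝ → ℝ, Measurable G →
      Integrable (fun p : (Fin N → ℝ) × (Fin N → ℝ) => G (f (x + (√(2 * δ) • p.1 + √(2 * δ') • p.2))))
        ((stdG N).prod (stdG N)) →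
      ∫ z, ∫ z', G (f (x + √(2 * δ) • z + √(2 * δ') • z')) ∂stdG N ∂stdG N =
        ∫ z, G (f (x + √(2 * (δ + δ')) • z)) ∂stdG N := by
    intro G hG hi
    rw [← hs, ← integral_stdG_add (F := fun y => G (f (x + y))) _ _ (by fun_prop),
      integral_prod _ hi]
    simp_rw [add_assoc]
  unfold T expMean
  split_ifs with h0
  · refine key id measurable_id ?_
    exact (ExpInt.integrable (W := fun p : (Fin N → ℝ) × (Fin N → ℝ) =>
      f (x + (√(2 * δ) • p.1 + √(2 * δ') • p.2))) hI)
  · congr 2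
    rw [← key (fun y => Real.exp (m * y)) (by fun_prop) (hI m)]
    refine integral_congr_ae (ae_of_all _ fun z => ?_)
    simp only
    rw [mul_inv_cancel_left₀ h0, Real.exp_log]
    exact integral_exp_pos (hf.expInt _ _ m)

/-- Short-time estimate. The leading term `(m' - m) R² δ` is free of the dimension. The constant `K`
depends on `N`, but only multiplies higher powers of `√δ`, and it is uniform over the class `Reg R
M`. -/
theorem exists_T_bound (N : ℕ) {R M : ℝ} (hR : 0 ≤ R) (hM : 0 ≤ M) : ∃ K : ℝ, 0 ≤ K ∧
    ∀ f : (Fin N → ℝ) → ℝ, Reg R M f → ∀ m m' δ : ℝ, 0 ≤ m → m ≤ m' → m' ≤ 1 → 0 ≤ δ →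
      2 * δ ≤ 1 → ∀ x, |T m' δ f x - T m δ f x| ≤
        (m' - m) / 2 * ((2 * δ * R ^ 2 + √(2 * δ) ^ 3 * K) * Real.exp (√(2 * δ) * K)) := by
  -- `R * K1` bounds the moment generating function from below, and `K3` collects the remainder
  -- terms of the second moment.
  set K1 := ∫ z, len z ∂stdG N
  set K3 := ∫ z, (2 * R * M * len z ^ 3 + M ^ 2 * len z ^ 4 +
    R ^ 3 * (len z ^ 3 * Real.exp (R * len z))) ∂stdG N
  have hK1 : 0 ≤ K1 := integral_nonneg fun z => len_nonneg z
  have hK3 : 0 ≤ K3 := integral_nonneg fun z => by have := len_nonneg z; positivity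
  have hK := le_max_left K3 (R * K1)
  have hK' := le_max_right K3 (R * K1)
  refine ⟨max K3 (R * K1), hK3.trans hK, fun f hf m m' δ hm hmm hm' hδ hδ1 x => ?_⟩
  set K := max K3 (R * K1)
  obtain ⟨ℓ, hℓ, hℓR, hexp⟩ := hf.grad
  set a := √(2 * δ) with ha
  have ha0 : 0 ≤ a := Real.sqrt_nonneg _
  have ha1 : a ≤ 1 := Real.sqrt_le_one.2 hδ1
  have ha2 : a ^ 2 = 2 * δ := Real.sq_sqrt (by positivity)
  -- Subtracting the constant `f x` leaves the difference of exponential means unchanged and makes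
  -- the variable of order `a |z|`.
  set W : (Fin N → ℝ) → ℝ := fun z => f (x + a • z) - f x with hW
  have hWE : ExpInt (stdG N) W := (hf.lip.expInt x a).add_const (-f x)
  have eT : ∀ m, T m δ f x = expMean (stdG N) m W + f x := fun m => by
    rw [← expMean_add_const hWE]
    simp [hW, T, ha]
  rw [eT, eT, add_sub_add_right_eq_sub]
  have hWm : Measurable W := by
    have := hf.lip.continuous.measurable
    fun_prop
  have hWb : ∀ z, |W z| ≤ a * R * len z := fun z => by
    have := hf.lip x (a • z)
    rw [len_smul, abs_of_nonneg ha0] at this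
    linarith
  refine hWE.expMean_sub_le hm hmm hm' fun s hs => ?_
  have hp : ∀ z, s * W z ≤ a * R * len z := fun z => by
    have h1 := mul_le_mul hs.2 (hWb z) (abs_nonneg _) zero_le_one
    have h2 := mul_le_mul_of_nonneg_left (le_abs_self (W z)) hs.1
    linarith
  have hpn : ∀ z, -(a * R * len z) ≤ s * W z := fun z => by
    have h1 := mul_le_mul hs.2 (hWb z) (abs_nonneg _) zero_le_one
    have h2 := mul_le_mul_of_nonneg_left (neg_abs_le (W z)) hs.1
    linarith
  -- Jensen's inequality for the lower bound `-a R |z|`, by the tangent of the exponential at the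
  -- mean of `|z|`.
  have hden : Real.exp (-(a * K)) ≤ mgf W (stdG N) s := by
    have h1 : Real.exp (-(a * R * K1)) ≤ mgf W (stdG N) s := by
      have h2 : ∫ z, Real.exp (-(a * R * K1)) * (1 - a * R * (len z - K1)) ∂stdG N ≤
          mgf W (stdG N) s := by
        have hi : Integrable (fun z : Fin N → ℝ => len z) (stdG N) := by
          simpa using integrable_len_pow (N := N) 1
        refine integral_mono (((integrable_const _).sub
          ((hi.sub (integrable_const _)).const_mul _)).const_mul _) (hWE s) fun z => ?_
        have h3 := Real.add_one_le_exp (-(a * R * (len z - K1)))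
        calc _ ≤ Real.exp (-(a * R * K1)) * Real.exp (-(a * R * (len z - K1))) :=
              mul_le_mul_of_nonneg_left (by linarith) (Real.exp_pos _).le
          _ = Real.exp (-(a * R * len z)) := by rw [← Real.exp_add]; ring_nf
          _ ≤ _ := Real.exp_le_exp.2 (hpn z)
      have hi : Integrable (fun z : Fin N → ℝ => len z) (stdG N) := by
        simpa using integrable_len_pow (N := N) 1
      have hi2 : Integrable (fun z : Fin N → ℝ => a * R * (len z - K1)) (stdG N) :=
        (hi.sub (integrable_const _)).const_mul _
      rw [integral_const_mul, integral_sub (integrable_const _) hi2, integral_const_mul,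
        integral_sub hi (integrable_const _)] at h2
      simpa [K1] using h2
    refine (Real.exp_le_exp.2 ?_).trans h1
    have := mul_le_mul_of_nonneg_left hK' ha0
    linarith
  -- `W` is replaced by its linear part `a (ℓ x ⬝ z)` and the exponential by `1`; both errors are of
  -- order `a³`.
  have hnum : ∫ z, W z ^ 2 * Real.exp (s * W z) ∂stdG N ≤ 2 * δ * R ^ 2 + a ^ 3 * K := by
    have hi1 : Integrable (fun z : Fin N → ℝ => a ^ 2 * (ℓ x ⬝ᵥ z) ^ 2) (stdG N) := by
      refine Integrable.const_mul ?_ _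
      refine Integrable.mono' ((integrable_len_pow (N := N) 2).const_mul (len (ℓ x) ^ 2))
        (by fun_prop) (ae_of_all _ fun z => ?_)
      rw [Real.norm_of_nonneg (sq_nonneg _), ← mul_pow]
      exact sq_le_sq' (by linarith [neg_abs_le (ℓ x ⬝ᵥ z), abs_dot_le (ℓ x) z])
        ((le_abs_self _).trans (abs_dot_le _ _))
    have hi2 : Integrable (fun z : Fin N → ℝ => a ^ 3 * (2 * R * M * len z ^ 3 +
        M ^ 2 * len z ^ 4 + R ^ 3 * (len z ^ 3 * Real.exp (R * len z)))) (stdG N) :=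
      ((((integrable_len_pow 3).const_mul _).add ((integrable_len_pow 4).const_mul _)).add
        ((integrable_len_pow_mul_exp 3 R).const_mul _)).const_mul _
    have h1 : ∫ z, W z ^ 2 * Real.exp (s * W z) ∂stdG N ≤
        ∫ z, (a ^ 2 * (ℓ x ⬝ᵥ z) ^ 2 + a ^ 3 * (2 * R * M * len z ^ 3 +
        M ^ 2 * len z ^ 4 + R ^ 3 * (len z ^ 3 * Real.exp (R * len z)))) ∂stdG N := by
      refine integral_mono_of_nonneg (ae_of_all _ fun z => by positivity) (hi1.add hi2)
        (ae_of_all _ fun z => ?_)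
      have hz := len_nonneg z
      set u := len z with hu
      have e1 := hexp x (a • z)
      simp only [dotProduct_smul, smul_dotProduct, smul_eq_mul, ← len_sq, ← hu] at e1
      set l := ℓ x ⬝ᵥ z with hl
      have hlR : |l| ≤ R * u := (abs_dot_le _ _).trans (mul_le_mul_of_nonneg_right (hℓR x) hz)
      have hr : |W z - a * l| ≤ M * (a * (a * u ^ 2)) := e1
      have hWz := hWb z
      rw [← hu] at hWz
      have hM' := hf.nonneg
      have hsq : W z ^ 2 ≤ a ^ 2 * l ^ 2 + a ^ 3 * (2 * R * M * u ^ 3 + M ^ 2 * u ^ 4) := by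
        set r := W z - a * l with hrdef
        have e2 : W z ^ 2 = a ^ 2 * l ^ 2 + 2 * (a * (l * r)) + r ^ 2 := by rw [hrdef]; ring
        have h3 : l * r ≤ (R * u) * (M * (a * (a * u ^ 2))) :=
          (le_abs_self _).trans (by rw [abs_mul]; exact mul_le_mul hlR hr (abs_nonneg _) (by positivity))
        have h4 : r ^ 2 ≤ (M * (a * (a * u ^ 2))) ^ 2 := by
          rw [← sq_abs r]; exact pow_le_pow_left₀ (abs_nonneg _) hr 2
        have h5 := mul_le_mul_of_nonneg_left h3 ha0
        have h6 : a ^ 4 * (M ^ 2 * u ^ 4) ≤ a ^ 3 * (M ^ 2 * u ^ 4) :=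
          mul_le_mul_of_nonneg_right (pow_le_pow_of_le_one ha0 ha1 (by norm_num)) (by positivity)
        rw [e2]
        nlinarith
      have he : Real.exp (s * W z) ≤ 1 + a * R * u * Real.exp (R * u) := by
        have h3 : Real.exp (a * R * u) ≤ 1 + a * R * u * Real.exp (a * R * u) := by
          have h7 := Real.add_one_le_exp (-(a * R * u))
          have h8 := mul_le_mul_of_nonneg_right h7 (Real.exp_pos (a * R * u)).le
          rw [← Real.exp_add, neg_add_cancel, Real.exp_zero] at h8
          linarith
        have h4 : Real.exp (a * R * u) ≤ Real.exp (R * u) := by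
          refine Real.exp_le_exp.2 ?_
          have := mul_le_mul_of_nonneg_right ha1 (mul_nonneg hR hz)
          linarith
        have h5 := mul_le_mul_of_nonneg_left h4 (mul_nonneg (mul_nonneg ha0 hR) hz)
        exact (Real.exp_le_exp.2 (hp z)).trans (h3.trans (by linarith))
      have hW2 : W z ^ 2 ≤ (a * R * u) ^ 2 := by
        rw [← sq_abs]; exact pow_le_pow_left₀ (abs_nonneg _) hWz 2
      have h9 := mul_le_mul_of_nonneg_left he (sq_nonneg (W z))
      have h10 := mul_le_mul_of_nonneg_right hW2
        (show 0 ≤ a * R * u * Real.exp (R * u) by positivity)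
      calc W z ^ 2 * Real.exp (s * W z) ≤ W z ^ 2 + W z ^ 2 * (a * R * u * Real.exp (R * u)) := by
            linarith
        _ ≤ (a ^ 2 * l ^ 2 + a ^ 3 * (2 * R * M * u ^ 3 + M ^ 2 * u ^ 4)) +
            (a * R * u) ^ 2 * (a * R * u * Real.exp (R * u)) := add_le_add hsq h10
        _ = _ := by ring
    refine h1.trans ?_
    -- The second moment of `ℓ x ⬝ z` is `|ℓ x|² ≤ R²`, with no factor `N`: this is where the
    -- estimate becomes independent of the dimension.
    rw [integral_add hi1 hi2, integral_const_mul, integral_const_mul, integral_dot_sq_stdG, ha2]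
    refine add_le_add ?_ (mul_le_mul_of_nonneg_left hK (by positivity))
    refine mul_le_mul_of_nonneg_left ?_ (by positivity)
    rw [← len_sq]
    exact pow_le_pow_left₀ (len_nonneg _) (hℓR x) 2
  refine hnum.trans ?_
  have h1 : 0 ≤ 2 * δ * R ^ 2 + a ^ 3 * K := by
    have := hK3.trans hK
    positivity
  calc 2 * δ * R ^ 2 + a ^ 3 * K
      = (2 * δ * R ^ 2 + a ^ 3 * K) * Real.exp (a * K) * Real.exp (-(a * K)) := by
        rw [mul_assoc (2 * δ * R ^ 2 + a ^ 3 * K), ← Real.exp_add]; simp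
    _ ≤ _ := mul_le_mul_of_nonneg_left hden (by positivity)

/-- The dimension-free comparison of the one-step operators. -/
theorem Reg.abs_T_sub_T_le {R M : ℝ} (hR : 0 ≤ R) {f : (Fin N → ℝ) → ℝ} (hf : Reg R M f)
    {m m' δ : ℝ} (hm : 0 ≤ m) (hmm : m ≤ m') (hm' : m' ≤ 1) (hδ : 0 ≤ δ) (x : Fin N → ℝ) :
    |T m' δ f x - T m δ f x| ≤ (m' - m) * (R ^ 2 * δ) := by
  have hM2 : 0 ≤ M + R ^ 2 / 2 := by have := hf.nonneg; positivity
  obtain ⟨K, hK, hKb⟩ := exists_T_bound N hR hM2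
  -- The interval is cut into `n` equal pieces by the semigroup property and the short-time errors
  -- are added; as `n → ∞` the terms with `K` disappear.
  have step : ∀ n : ℕ, 0 < n → 2 * (δ / n) ≤ 1 → |T m' δ f x - T m δ f x| ≤
      n * ((m' - m) / 2 * ((2 * (δ / n) * R ^ 2 + √(2 * (δ / n)) ^ 3 * K) *
        Real.exp (√(2 * (δ / n)) * K))) := by
    intro n hn h1
    set η := δ / n with hη
    have hn' : (0 : ℝ) < n := Nat.cast_pos.2 hn
    have hη0 : 0 ≤ η := by positivity
    set c := (m' - m) / 2 * ((2 * η * R ^ 2 + √(2 * η) ^ 3 * K) * Real.exp (√(2 * η) * K))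
    have ind : ∀ j : ℕ, ∀ y, |T m' (j * η) f y - T m (j * η) f y| ≤ j * c := by
      intro j
      induction j with
      | zero => intro y; simp [T_zero]
      | succ j ih =>
        intro y
        have e : ∀ m, T m ((j + 1 : ℕ) * η) f = T m η (T m (j * η) f) := fun m => by
          rw [T_T hf.lip hη0 (by positivity)]; push_cast; ring_nf
        rw [e, e]
        have l1 := hf.lip.apply_T (hm.trans hmm) (j * η)
        have l2 := hf.lip.apply_T hm (j * η)
        have h2 := abs_T_sub_le l1 l2 (hm.trans hmm) η ih y
        -- `T m (j * η) f` counts as one application of the operator, so its regularity constant `M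
        -- + R² / 2`, and with it `K`, does not depend on `j`.
        have h3 := hKb _ (hf.apply_T hR hm (hmm.trans hm') (j * η)) m m' η hm hmm hm' hη0 h1 y
        have h4 := abs_sub_le (T m' η (T m' (j * η) f) y) (T m' η (T m (j * η) f) y)
          (T m η (T m (j * η) f) y)
        have h5 : ((j + 1 : ℕ) : ℝ) * c = j * c + c := by push_cast; ring
        rw [h5]
        exact h4.trans (add_le_add h2 h3)
    have := ind n x
    rwa [hη, mul_div_cancel₀ _ hn'.ne'] at this
  have hlim : Tendsto (fun n : ℕ => (m' - m) * (δ * (R ^ 2 + √(2 * (δ / n)) * K) *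
      Real.exp (√(2 * (δ / n)) * K))) atTop (𝓝 ((m' - m) * (R ^ 2 * δ))) := by
    have h1 : Tendsto (fun n : ℕ => √(2 * (δ / n))) atTop (𝓝 0) := by
      have h2 : Tendsto (fun n : ℕ => δ / (n : ℝ)) atTop (𝓝 0) :=
        tendsto_const_div_atTop_nhds_zero_nat δ
      have h3 := (h2.const_mul 2).sqrt
      simpa using h3
    have h2 : Continuous fun s : ℝ => (m' - m) * (δ * (R ^ 2 + s * K) * Real.exp (s * K)) := by
      fun_prop
    have h3 := (h2.tendsto 0).comp h1
    have e : (m' - m) * (δ * (R ^ 2 + 0 * K) * Real.exp (0 * K)) = (m' - m) * (R ^ 2 * δ) := by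
      rw [zero_mul, Real.exp_zero]; ring
    rw [e] at h3
    exact h3
  refine ge_of_tendsto hlim ?_
  obtain ⟨n0, hn0⟩ := exists_nat_gt (2 * δ)
  filter_upwards [eventually_ge_atTop (max n0 1)] with n hn
  have hn1 : 0 < n := lt_of_lt_of_le one_pos ((le_max_right _ _).trans hn)
  have hn' : (0 : ℝ) < n := Nat.cast_pos.2 hn1
  have hn2 : (n0 : ℝ) ≤ n := Nat.cast_le.2 ((le_max_left _ _).trans hn)
  refine (step n hn1 ?_).trans (le_of_eq ?_)
  · rw [← mul_div_assoc, div_le_one hn']; linarith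
  · have e : √(2 * (δ / n)) ^ 3 = 2 * (δ / n) * √(2 * (δ / n)) := by
      rw [pow_succ, Real.sq_sqrt (by positivity)]
    rw [e]
    field_simp


/-! ### Iterated operators along a step function -/

variable {N : ℕ}

/-- The operators `T m δ` of a list of pairs `(m, δ)`, applied successively, the last one first. -/
def val (f : (Fin N → ℝ) → ℝ) : List (ℝ × ℝ) → (Fin N → ℝ) → ℝ
  | [] => f
  | p :: L => T p.1 p.2 (val f L)

/-- The step function that takes the value `m` on successive intervals of length `δ`, and the
value `1` after the last one. -/
def stepFun : List (ℝ × ℝ) → ℝ → ℝ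
  | [], _ => 1
  | p :: L, r => if r < p.2 then p.1 else stepFun L (r - p.2)

/-- The sum of the lengths of the intervals. -/
def total (L : List (ℝ × ℝ)) : ℝ := (L.map Prod.snd).sum

/-- The values lie in `[0, 1]` and the lengths are nonnegative. -/
def Valid (L : List (ℝ × ℝ)) : Prop := ∀ p ∈ L, 0 ≤ p.1 ∧ p.1 ≤ 1 ∧ 0 ≤ p.2

theorem Valid.tail {p : ℝ × ℝ} {L : List (ℝ × ℝ)} (h : Valid (p :: L)) : Valid L :=
  fun q hq => h q (List.mem_cons_of_mem _ hq)

theorem Valid.head {p : ℝ × ℝ} {L : List (ℝ × ℝ)} (h : Valid (p :: L)) :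
    0 ≤ p.1 ∧ p.1 ≤ 1 ∧ 0 ≤ p.2 := h p List.mem_cons_self

theorem Valid.cons {p : ℝ × ℝ} {L : List (ℝ × ℝ)} (hp : 0 ≤ p.1 ∧ p.1 ≤ 1 ∧ 0 ≤ p.2)
    (h : Valid L) : Valid (p :: L) := by
  intro q hq
  rcases List.mem_cons.1 hq with rfl | hq
  · exact hp
  · exact h q hq

theorem total_cons (p : ℝ × ℝ) (L : List (ℝ × ℝ)) : total (p :: L) = p.2 + total L := by
  simp [total]

theorem Valid.total_nonneg {L : List (ℝ × ℝ)} (h : Valid L) : 0 ≤ total L := by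
  induction L with
  | nil => simp [total]
  | cons p L ih => rw [total_cons]; exact add_nonneg h.head.2.2 (ih h.tail)

theorem measurable_stepFun (L : List (ℝ × ℝ)) : Measurable (stepFun L) := by
  induction L with
  | nil => exact measurable_const
  | cons p L ih =>
    exact Measurable.ite measurableSet_Iio measurable_const (ih.comp (measurable_id.sub_const _))

theorem Valid.stepFun_mem {L : List (ℝ × ℝ)} (h : Valid L) (r : ℝ) : stepFun L r ∈ Icc (0 : ℝ) 1 := by
  induction L generalizing r with
  | nil => exact ⟨zero_le_one, le_rfl⟩
  | cons p L ih =>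
    unfold stepFun
    split_ifs
    · exact ⟨h.head.1, h.head.2.1⟩
    · exact ih h.tail _

theorem val_append (f : (Fin N → ℝ) → ℝ) (L L' : List (ℝ × ℝ)) :
    val f (L ++ L') = val (val f L') L := by
  induction L with
  | nil => rfl
  | cons p L ih => simp only [List.cons_append, val, ih]

theorem stepFun_append_one (L : List (ℝ × ℝ)) (δ : ℝ) : stepFun (L ++ [(1, δ)]) = stepFun L := by
  induction L with
  | nil => ext r; simp [stepFun]
  | cons p L ih => ext r; simp only [List.cons_append, stepFun, ih]

theorem stepFun_split (m δ δ' : ℝ) (hδ : 0 ≤ δ') (L : List (ℝ × ℝ)) :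
    stepFun ((m, δ) :: (m, δ') :: L) = stepFun ((m, δ + δ') :: L) := by
  ext r
  simp only [stepFun]
  split_ifs with h1 h2 h3 h4 h5
  · rfl
  · linarith
  · rfl
  · linarith
  · linarith
  · congr 1; ring

/-- Each operator may enlarge the quadratic constant. Some finite value suffices, because
`Reg.abs_T_sub_T_le` involves only `R`. -/
theorem Reg.val {R M : ℝ} (hR : 0 ≤ R) {f : (Fin N → ℝ) → ℝ} (hf : Reg R M f)
    {L : List (ℝ × ℝ)} (h : Valid L) : ∃ M', Reg R M' (val f L) := by
  induction L with
  | nil => exact ⟨M, hf⟩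
  | cons p L ih =>
    obtain ⟨M', hM⟩ := ih h.tail
    exact ⟨_, hM.apply_T hR h.head.1 h.head.2.1 p.2⟩

theorem Lip.val {R : ℝ} {f : (Fin N → ℝ) → ℝ} (hf : Lip R f)
    {L : List (ℝ × ℝ)} (h : ∀ p ∈ L, 0 ≤ p.1) : Lip R (val f L) := by
  induction L with
  | nil => exact hf
  | cons p L ih =>
    exact (ih fun q hq => h q (List.mem_cons_of_mem _ hq)).apply_T (h p List.mem_cons_self) p.2

theorem Valid.intervalIntegrable {L L' : List (ℝ × ℝ)} (h : Valid L) (h' : Valid L') (a b : ℝ) :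
    IntervalIntegrable (fun r => |stepFun L r - stepFun L' r|) volume a b := by
  have hm := measurable_stepFun L
  have hm' := measurable_stepFun L'
  refine (intervalIntegrable_const (c := (1 : ℝ))).mono_fun (by fun_prop)
    (ae_of_all _ fun r => ?_)
  have h1 := h.stepFun_mem r
  have h2 := h'.stepFun_mem r
  simp only [Real.norm_eq_abs, abs_abs, abs_one]
  rw [abs_le]
  exact ⟨by linarith [h1.1, h2.2], by linarith [h1.2, h2.1]⟩

theorem integral_stepFun_cons {m m' δ : ℝ} {L L' : List (ℝ × ℝ)} (h : Valid ((m, δ) :: L))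
    (h' : Valid ((m', δ) :: L')) :
    ∫ r in (0 : ℝ)..(δ + total L), |stepFun ((m, δ) :: L) r - stepFun ((m', δ) :: L') r| =
      |m - m'| * δ + ∫ r in (0 : ℝ)..total L, |stepFun L r - stepFun L' r| := by
  have hδ : 0 ≤ δ := h.head.2.2
  rw [← intervalIntegral.integral_add_adjacent_intervals (h.intervalIntegrable h' 0 δ)
    (h.intervalIntegrable h' δ _)]
  congr 1
  · rw [intervalIntegral.integral_of_le hδ, ← integral_Ico_eq_integral_Ioc,
      setIntegral_congr_fun (g := fun _ => |m - m'|) measurableSet_Ico]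
    · simp [hδ, mul_comm]
    · intro r hr
      simp only [stepFun, if_pos hr.2]
  · have := intervalIntegral.integral_comp_add_right
      (fun r => |stepFun ((m, δ) :: L) r - stepFun ((m', δ) :: L') r|) δ (a := 0) (b := total L)
    rw [zero_add, add_comm (total L)] at this
    rw [← this]
    refine intervalIntegral.integral_congr fun r hr => ?_
    rw [uIcc_of_le h.tail.total_nonneg] at hr
    have : ¬ (r + δ < δ) := by linarith [hr.1]
    simp only [stepFun, if_neg this, add_sub_cancel_right]

/-- After the first intervals are cut to a common length `δ`, changing `m` into `m'` costs `R² |m -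
m'| δ`, while the discrepancy of the tails passes through `T`, which is nonexpansive for the uniform
norm. Induction is on the total number of intervals. -/
theorem Reg.abs_val_sub_le {R M : ℝ} (hR : 0 ≤ R) {f : (Fin N → ℝ) → ℝ} (hf : Reg R M f)
    {L L' : List (ℝ × ℝ)} (h : Valid L) (h' : Valid L') (ht : total L = total L')
    (x : Fin N → ℝ) :
    |SpinGlass.val f L x - SpinGlass.val f L' x| ≤
      R ^ 2 * ∫ r in (0 : ℝ)..total L, |stepFun L r - stepFun L' r| := by
  have main : ∀ n : ℕ, ∀ L L' : List (ℝ × ℝ), Valid L → Valid L' → total L = total L' →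
      L.length + L'.length ≤ n → ∀ x, |SpinGlass.val f L x - SpinGlass.val f L' x| ≤
      R ^ 2 * ∫ r in (0 : ℝ)..total L, |stepFun L r - stepFun L' r| := by
    intro n
    induction n with
    | zero =>
      intro L L' _ _ _ hn x
      have h1 : L = [] := List.length_eq_zero_iff.1 (by omega)
      have h2 : L' = [] := List.length_eq_zero_iff.1 (by omega)
      subst h1 h2
      simp [total]
    | succ n ih =>
      -- A list of total length zero may be nonempty, but all its lengths vanish and `T m 0` is the
      -- identity.
      have nilcase : ∀ L' : List (ℝ × ℝ), Valid L' → total L' = 0 → ∀ x,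
          SpinGlass.val f L' x = f x := by
        intro L'
        induction L' with
        | nil => intro _ _ x; rfl
        | cons p L' ihL =>
          intro hv h0 x
          rw [total_cons] at h0
          have h1 := hv.head.2.2
          have h2 := hv.tail.total_nonneg
          have h3 : p.2 = 0 := by linarith
          simp only [SpinGlass.val, h3, T_zero]
          exact ihL hv.tail (by linarith) x
      -- If the first interval of the second list is the longer one, it is split into `δ` and `δ' -
      -- δ`; its remainder stays in the tail, so the number of intervals still drops by one.
      have ordered : ∀ (m m' δ δ' : ℝ) (L L' : List (ℝ × ℝ)), Valid ((m, δ) :: L) →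
          Valid ((m', δ') :: L') → total ((m, δ) :: L) = total ((m', δ') :: L') →
          L.length + L'.length + 1 ≤ n → δ ≤ δ' → ∀ x,
          |SpinGlass.val f ((m, δ) :: L) x - SpinGlass.val f ((m', δ') :: L') x| ≤
          R ^ 2 * ∫ r in (0 : ℝ)..total ((m, δ) :: L),
            |stepFun ((m, δ) :: L) r - stepFun ((m', δ') :: L') r| := by
        intro m m' δ δ' L L' hv hv' ht hn hδ x
        have hd : 0 ≤ δ' - δ := sub_nonneg.2 hδ
        have hδ0 : 0 ≤ δ := hv.head.2.2
        have hv2 : Valid ((m', δ' - δ) :: L') := Valid.cons ⟨hv'.head.1, hv'.head.2.1, hd⟩ hv'.tail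
        have hv3 : Valid ((m', δ) :: (m', δ' - δ) :: L') :=
          Valid.cons ⟨hv'.head.1, hv'.head.2.1, hδ0⟩ hv2
        have e1 : stepFun ((m', δ') :: L') = stepFun ((m', δ) :: (m', δ' - δ) :: L') := by
          rw [stepFun_split _ _ _ hd]; congr 3; ring
        obtain ⟨M1, hM1⟩ := hf.val hR hv.tail
        obtain ⟨M2, hM2⟩ := hf.val hR hv2
        have e2 : SpinGlass.val f ((m', δ') :: L') =
            T m' δ (SpinGlass.val f ((m', δ' - δ) :: L')) := by
          simp only [SpinGlass.val]
          obtain ⟨M3, hM3⟩ := hf.val hR hv'.tail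
          rw [T_T hM3.lip hδ0 hd]; congr 1; ring
        have ht2 : total L = total ((m', δ' - δ) :: L') := by
          rw [total_cons, total_cons] at ht
          rw [total_cons]
          simp only at ht ⊢
          linarith
        have ih1 := ih L _ hv.tail hv2 ht2 (by simp; omega)
        rw [e1, e2, total_cons, integral_stepFun_cons hv hv3, mul_add]
        have h1 : |T m δ (SpinGlass.val f L) x - T m' δ (SpinGlass.val f L) x| ≤
            R ^ 2 * (|m - m'| * δ) := by
          rcases le_total m m' with hmm | hmm
          · have := hM1.abs_T_sub_T_le hR hv.head.1 hmm hv'.head.2.1 hδ0 x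
            rw [abs_sub_comm, abs_sub_comm m m', abs_of_nonneg (sub_nonneg.2 hmm)]
            linarith
          · have := hM1.abs_T_sub_T_le hR hv'.head.1 hmm hv.head.2.1 hδ0 x
            rw [abs_of_nonneg (sub_nonneg.2 hmm)]
            linarith
        have h2 := abs_T_sub_le hM1.lip hM2.lip hv'.head.1 δ ih1 x
        exact (abs_sub_le _ _ _).trans (add_le_add h1 h2)
      intro L L' hL hL' ht hn x
      rcases L with _ | ⟨⟨m, δ⟩, L⟩
      · rw [nilcase L' hL' (by rw [← ht]; simp [total])]
        simp [SpinGlass.val, total]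
      rcases L' with _ | ⟨⟨m', δ'⟩, L'⟩
      · rw [nilcase _ hL (by rw [ht]; simp [total]), ht]
        simp [SpinGlass.val, total]
      simp only [List.length_cons] at hn
      rcases le_total δ δ' with hd | hd
      · exact ordered m m' δ δ' L L' hL hL' ht (by omega) hd x
      · have := ordered m' m δ' δ L' L hL' hL ht.symm (by omega) hd x
        rw [abs_sub_comm, ht]
        simp_rw [abs_sub_comm (stepFun ((m, δ) :: L) _)]
        exact this
  exact main _ L L' h h' ht le_rfl x

/-! ### The terminal function -/

/-- The function `x ↦ log ∫ exp (x ⬝ σ - Q |σ|²) dP(σ)`. -/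
def base (P : Measure (Fin N → ℝ)) (Q : ℝ) (x : Fin N → ℝ) : ℝ :=
  expMean P 1 fun σ => x ⬝ᵥ σ - Q * (σ ⬝ᵥ σ)

section Base

variable {P : Measure (Fin N → ℝ)} [IsProbabilityMeasure P] {R : ℝ}

theorem expInt_base (hP : ∀ᵐ σ ∂P, len σ ≤ R) (Q : ℝ) (x : Fin N → ℝ) :
    ExpInt P fun σ => x ⬝ᵥ σ - Q * (σ ⬝ᵥ σ) := by
  refine expInt_of_bound (c := len x * R + |Q| * R ^ 2) (by fun_prop) ?_
  filter_upwards [hP] with σ hσ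
  refine (abs_sub _ _).trans (add_le_add ?_ ?_)
  · exact (abs_dot_le _ _).trans (mul_le_mul_of_nonneg_left hσ (len_nonneg x))
  · rw [abs_mul, abs_of_nonneg (dot_self_nonneg σ), ← len_sq]
    exact mul_le_mul_of_nonneg_left (pow_le_pow_left₀ (len_nonneg σ) hσ 2) (abs_nonneg Q)

omit [IsProbabilityMeasure P] in
theorem base_eq_log (Q : ℝ) (x : Fin N → ℝ) :
    base P Q x = Real.log (∫ σ, Real.exp (x ⬝ᵥ σ - Q * (σ ⬝ᵥ σ)) ∂P) := by
  simp [base, expMean]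

theorem exp_base (hP : ∀ᵐ σ ∂P, len σ ≤ R) (Q : ℝ) (x : Fin N → ℝ) :
    Real.exp (base P Q x) = ∫ σ, Real.exp (x ⬝ᵥ σ - Q * (σ ⬝ᵥ σ)) ∂P := by
  rw [base_eq_log, Real.exp_log]
  simpa using integral_exp_pos (expInt_base hP Q x 1)

/-- The exponent is affine in `x` with gradient `σ`, so its expansion has no error; the constant `R²
/ 2` comes from the exponential mean alone. -/
theorem reg_base (hR : 0 ≤ R) (hP : ∀ᵐ σ ∂P, len σ ≤ R) (Q : ℝ) :
    Reg R (0 + R ^ 2 / 2) (base P Q) := by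
  refine reg_expMean zero_le_one le_rfl hR le_rfl (ℓ := fun _ σ => σ) (expInt_base hP Q)
    (fun _ => measurable_id) (fun _ => hP) (fun x h => ?_) (fun x h => ae_of_all _ fun σ => ?_)
  · filter_upwards [hP] with σ hσ
    rw [sub_sub_sub_cancel_right, add_dotProduct, add_sub_cancel_left, mul_comm]
    exact (abs_dot_le _ _).trans (mul_le_mul_of_nonneg_left hσ (len_nonneg h))
  · rw [sub_sub_sub_cancel_right, add_dotProduct, add_sub_cancel_left, dotProduct_comm, sub_self]
    simp

/-- For `m = 1` the Gaussian mean can be taken inside the integral over `σ`, and `E exp (√(2δ) z ⬝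
σ) = exp (δ |σ|²)` compensates the increase of `Q`. Hence `Q` may exceed the largest atom, and two
measures can be given a common `Q`. -/
theorem T_one_base (hP : ∀ᵐ σ ∂P, len σ ≤ R) (Q : ℝ) {δ : ℝ} (hδ : 0 ≤ δ) :
    T 1 δ (base P (Q + δ)) = base P Q := by
  ext x
  rw [base_eq_log]
  simp only [T, expMean, one_ne_zero, if_false, inv_one, one_mul]
  congr 1
  simp_rw [exp_base hP]
  set a := √(2 * δ) with ha
  have ha2 : a ^ 2 = 2 * δ := Real.sq_sqrt (by positivity)
  rw [integral_integral_swap]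
  · refine integral_congr_ae (ae_of_all _ fun σ => ?_)
    have e : ∀ z : Fin N → ℝ, Real.exp ((x + a • z) ⬝ᵥ σ - (Q + δ) * (σ ⬝ᵥ σ)) =
        Real.exp (x ⬝ᵥ σ - (Q + δ) * (σ ⬝ᵥ σ)) * Real.exp ((a • σ) ⬝ᵥ z) := fun z => by
      rw [← Real.exp_add, add_dotProduct, smul_dotProduct, smul_dotProduct, dotProduct_comm z]
      ring_nf
    simp only
    simp_rw [e]
    rw [integral_const_mul, integral_exp_dot_stdG, ← Real.exp_add, smul_dotProduct,
      dotProduct_smul, smul_eq_mul, smul_eq_mul, ← mul_assoc, ← sq, ha2]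
    ring_nf
  · have hb : ∀ᵐ p : (Fin N → ℝ) × (Fin N → ℝ) ∂(stdG N).prod P, len p.2 ≤ R :=
      Measure.quasiMeasurePreserving_snd.ae hP
    have hi : Integrable (fun z : Fin N → ℝ => Real.exp (len x * R + |Q + δ| * R ^ 2) *
        Real.exp (|a| * R * len z)) (stdG N) := (integrable_exp_len _).const_mul _
    refine (hi.comp_fst P).mono' (by unfold Function.uncurry; fun_prop) ?_
    filter_upwards [hb] with p hp
    dsimp [Function.uncurry]
    rw [abs_of_pos (Real.exp_pos _), ← Real.exp_add]
    refine Real.exp_le_exp.2 ((le_abs_self _).trans ((abs_sub _ _).trans ?_))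
    rw [add_dotProduct, smul_dotProduct, abs_mul (Q + δ), abs_of_nonneg (dot_self_nonneg p.2),
      ← len_sq, smul_eq_mul]
    have h1 := abs_add_le (x ⬝ᵥ p.2) (a * (p.1 ⬝ᵥ p.2))
    rw [abs_mul] at h1
    have h2 := (abs_dot_le x p.2).trans (mul_le_mul_of_nonneg_left hp (len_nonneg x))
    have h3 := mul_le_mul_of_nonneg_left ((abs_dot_le p.1 p.2).trans
      (mul_le_mul_of_nonneg_left hp (len_nonneg p.1))) (abs_nonneg a)
    have h4 := mul_le_mul_of_nonneg_left (pow_le_pow_left₀ (len_nonneg p.2) hp 2)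
      (abs_nonneg (Q + δ))
    linarith

end Base


/-! ### The Laplace functional of a Poisson process -/

/-- The law of a sequence of independent standard exponential variables. -/
def expSeq : Measure (ℕ → ℝ) := Measure.infinitePi fun _ : ℕ => expMeasure 1

instance : IsProbabilityMeasure expSeq := by unfold expSeq; infer_instance

theorem expMeasure_one_eq : expMeasure 1 =
    (volume.restrict (Ioi (0 : ℝ))).withDensity fun s => ENNReal.ofReal (Real.exp (-s)) := by
  rw [← withDensity_indicator measurableSet_Ioi]
  change volume.withDensity (exponentialPDF 1) = _
  refine withDensity_congr_ae ?_
  -- The two densities differ only at `0`.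
  have h0 : ∀ᵐ s : ℝ, s ≠ 0 := by simp [ae_iff]
  filter_upwards [h0] with s hs
  rw [exponentialPDF_eq]
  rcases lt_or_gt_of_ne hs with h | h
  · rw [if_neg (by linarith), indicator_of_notMem (by simpa using h.le)]; simp
  · rw [if_pos h.le, indicator_of_mem (by simpa using h)]; simp

theorem integral_expMeasure (f : ℝ → ℝ) :
    ∫ s, f s ∂expMeasure 1 = ∫ s in Ioi (0 : ℝ), Real.exp (-s) * f s := by
  rw [expMeasure_one_eq, integral_withDensity_eq_integral_toReal_smul (by fun_prop)
    (ae_of_all _ fun _ => ENNReal.ofReal_lt_top)]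
  refine integral_congr_ae (ae_of_all _ fun s => ?_)
  simp only
  rw [ENNReal.toReal_ofReal (Real.exp_pos _).le, smul_eq_mul]

theorem ae_expMeasure_pos : ∀ᵐ s ∂expMeasure 1, 0 < s := by
  rw [expMeasure_one_eq]
  exact (withDensity_absolutelyContinuous _ _).ae_le (ae_restrict_mem measurableSet_Ioi)

theorem ae_expSeq_pos : ∀ᵐ e ∂expSeq, ∀ n, 0 < e n := by
  rw [ae_all_iff]
  intro n
  exact (measurePreserving_eval_infinitePi (fun _ : ℕ => expMeasure 1) n).quasiMeasurePreserving.ae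
    ae_expMeasure_pos

/-- The partial sum of the first `n` terms. -/
def psum (e : ℕ → ℝ) (n : ℕ) : ℝ := ∑ j ∈ Finset.range n, e j

@[fun_prop]
theorem measurable_psum (n : ℕ) : Measurable fun e : ℕ → ℝ => psum e n := by
  unfold psum; fun_prop

/-- Integrating out one coordinate of an independent sequence. -/
theorem integral_expSeq_coord {m : ℕ} {A : (ℕ → ℝ) → ℝ × ℝ} (hA : Measurable A)
    (hdep : ∀ e e' : ℕ → ℝ, (∀ j < m, e j = e' j) → A e = A e') {F : (ℝ × ℝ) × ℝ → ℝ}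
    (hF : Measurable F) {c : ℝ} (hb : ∀ p, |F p| ≤ c) :
    ∫ e, F (A e, e m) ∂expSeq = ∫ e, ∫ s, F (A e, s) ∂expMeasure 1 ∂expSeq := by
  have hind : iIndepFun (fun (j : ℕ) (e : ℕ → ℝ) => e j) expSeq :=
    iIndepFun_infinitePi (X := fun _ x => x) fun _ => measurable_id
  have h1 := hind.indepFun_finset (Finset.range m) {m} (by simp) fun j => measurable_pi_apply j
  -- Extension by zero: by `hdep`, `A` factors through the first `m` coordinates, and is therefore
  -- independent of the coordinate `m`.
  set ext : (Finset.range m → ℝ) → ℕ → ℝ := fun x j =>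
    if h : j ∈ Finset.range m then x ⟨j, h⟩ else 0 with hext
  have hextm : Measurable ext := by
    rw [measurable_pi_iff]
    intro j
    by_cases h : j ∈ Finset.range m
    · simp only [hext, dif_pos h]; exact measurable_pi_apply _
    · simp only [hext, dif_neg h]; exact measurable_const
  have hev : Measurable fun y : ({m} : Finset ℕ) → ℝ => y ⟨m, Finset.mem_singleton_self m⟩ :=
    measurable_pi_apply _
  have h2 := h1.comp (φ := fun x => A (ext x)) (ψ := fun y => y ⟨m, Finset.mem_singleton_self m⟩)
    (hA.comp hextm) hev
  have e1 : ((fun x => A (ext x)) ∘ fun (e : ℕ → ℝ) (i : Finset.range m) => e i) = A := by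
    ext1 e
    refine hdep _ _ fun j hj => ?_
    simp [hext, hj]
  rw [e1] at h2
  have h3 : IndepFun A (fun e : ℕ → ℝ => e m) expSeq := h2
  rw [indepFun_iff_map_prod_eq_prod_map_map hA.aemeasurable
    (measurable_pi_apply m).aemeasurable] at h3
  have h4 : expSeq.map (fun e : ℕ → ℝ => e m) = expMeasure 1 :=
    Measure.infinitePi_map_eval (fun _ : ℕ => expMeasure 1) m
  have h5 : Measurable fun e : ℕ → ℝ => (A e, e m) := hA.prodMk (measurable_pi_apply m)
  have hp : IsProbabilityMeasure (expSeq.map A) := Measure.isProbabilityMeasure_map hA.aemeasurable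
  rw [← integral_map (f := F) h5.aemeasurable hF.aestronglyMeasurable, h3, h4,
    integral_prod _ (Integrable.of_bound hF.aestronglyMeasurable c (ae_of_all _ hb)),
    integral_map hA.aemeasurable]
  exact (hF.stronglyMeasurable.integral_prod_right').aestronglyMeasurable

section Functional

variable {k : ℝ → ℝ} (hk : Integrable k) (hk0 : ∀ y, 0 ≤ k y) (hk1 : ∀ y, k y ≤ 1)
  (hkc : ContinuousOn k (Ioi 0))

/-- `exp (-∫_y^∞ k)` for `y ≥ 0`. -/
def tailExp (k : ℝ → ℝ) (y : ℝ) : ℝ :=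
  Real.exp (-((∫ s in Ioi (0 : ℝ), k s) - ∫ s in (0 : ℝ)..y, k s))

include hk in
theorem continuous_tailExp : Continuous (tailExp k) := by
  have := intervalIntegral.continuous_primitive (fun a b => hk.intervalIntegrable (a := a) (b := b)) 0
  unfold tailExp
  fun_prop

include hk hk0 in
theorem tailExp_le_one (y : ℝ) (hy : 0 ≤ y) : tailExp k y ≤ 1 := by
  unfold tailExp
  rw [Real.exp_le_one_iff, neg_nonpos, sub_nonneg, intervalIntegral.integral_of_le hy]
  exact setIntegral_mono_set hk.integrableOn (ae_of_all _ hk0) Ioc_subset_Ioi_self.eventuallyLE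

include hk in
theorem tendsto_tailExp : Tendsto (tailExp k) atTop (𝓝 1) := by
  have h := intervalIntegral_tendsto_integral_Ioi 0 hk.integrableOn tendsto_id
  have h2 := ((h.const_sub (∫ s in Ioi (0 : ℝ), k s)).neg).rexp
  rw [sub_self, neg_zero, Real.exp_zero] at h2
  exact h2

include hk hk0 hk1 hkc in
-- With `y` the current arrival time and `s` the next waiting time, this is the martingale identity
-- behind the Laplace functional. It is the fundamental theorem of calculus for `s ↦ -e^{-s} tailExp
-- k (y + s)`.
theorem tailExp_fixed (y : ℝ) (hy : 0 ≤ y) :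
    ∫ s, (1 - k (y + s)) * tailExp k (y + s) ∂expMeasure 1 = tailExp k y := by
  rw [integral_expMeasure]
  have hc := continuous_tailExp hk
  have hlim : Tendsto (fun s => -(Real.exp (-s) * tailExp k (y + s))) atTop (𝓝 0) := by
    have h1 : Tendsto (fun s : ℝ => Real.exp (-s)) atTop (𝓝 0) := Real.tendsto_exp_neg_atTop_nhds_zero
    have h2 := (tendsto_tailExp hk).comp (tendsto_atTop_add_const_left atTop y tendsto_id)
    simpa using (h1.mul h2).neg
  have hint : IntegrableOn (fun s => Real.exp (-s) * ((1 - k (y + s)) * tailExp k (y + s)))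
      (Ioi 0) := by
    have h1 : IntegrableOn (fun s : ℝ => Real.exp (-s)) (Ioi 0) := by
      simpa using exp_neg_integrableOn_Ioi 0 one_pos
    have hkm : AEStronglyMeasurable (fun s => k (y + s)) volume :=
      (hk.comp_add_left y).aestronglyMeasurable
    refine h1.mono' ?_ ?_
    · have h2 : Continuous fun s : ℝ => Real.exp (-s) := by fun_prop
      have h3 : Continuous fun s : ℝ => tailExp k (y + s) := by fun_prop
      exact (h2.aestronglyMeasurable.mul ((aestronglyMeasurable_const.sub hkm).mul
        h3.aestronglyMeasurable)).restrict
    · filter_upwards [ae_restrict_mem measurableSet_Ioi] with s hs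
      have h2 := tailExp_le_one hk hk0 (y + s) (add_nonneg hy (le_of_lt hs))
      have h3 : 0 < tailExp k (y + s) := Real.exp_pos _
      have h4 := hk0 (y + s)
      have h5 := hk1 (y + s)
      rw [Real.norm_of_nonneg (mul_nonneg (Real.exp_pos _).le (mul_nonneg (by linarith) h3.le))]
      exact mul_le_of_le_one_right (Real.exp_pos _).le (mul_le_one₀ (by linarith) h3.le h2)
  have := integral_Ioi_of_hasDerivAt_of_tendsto (a := 0)
    (f := fun s => -(Real.exp (-s) * tailExp k (y + s)))
    (f' := fun s => Real.exp (-s) * ((1 - k (y + s)) * tailExp k (y + s)))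
    (Continuous.continuousWithinAt (by fun_prop)) (fun s hs => ?_) hint hlim
  · rw [this]; simp
  · have hs' : 0 < y + s := add_pos_of_nonneg_of_pos hy hs
    have h1 : HasDerivAt (fun u => ∫ t in (0 : ℝ)..u, k t) (k (y + s)) (y + s) :=
      intervalIntegral.integral_hasDerivAt_right hk.intervalIntegrable
        (hk.aestronglyMeasurable.stronglyMeasurableAtFilter)
        (hkc.continuousAt (Ioi_mem_nhds hs'))
    have h2 : HasDerivAt (tailExp k) (tailExp k (y + s) * k (y + s)) (y + s) := by
      have := ((h1.const_sub (∫ s in Ioi (0 : ℝ), k s)).neg).exp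
      rw [neg_neg] at this
      exact this
    have h3 := (h2.comp_const_add y s)
    have h4 : HasDerivAt (fun s : ℝ => Real.exp (-s)) (-Real.exp (-s)) s := by
      simpa using (hasDerivAt_neg s).exp
    have h5 := (h4.mul h3).neg
    have e5 : Real.exp (-s) * ((1 - k (y + s)) * tailExp k (y + s)) =
        -(-Real.exp (-s) * tailExp k (y + s) + Real.exp (-s) * (tailExp k (y + s) * k (y + s))) := by
      ring
    rw [e5]
    exact h5

include hk hk0 hk1 hkc in
/-- The Laplace functional of a Poisson process of unit rate. -/
theorem tendsto_integral_prod_poisson (hkm : Measurable k) :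
    Tendsto (fun m : ℕ => ∫ e, ∏ n ∈ Finset.range m, (1 - k (psum e (n + 1))) ∂expSeq) atTop
      (𝓝 (Real.exp (-∫ s in Ioi (0 : ℝ), k s))) := by
  have hc := continuous_tailExp hk
  have hcm := hc.measurable
  -- The bound by `1` holds only for nonnegative arguments, and arrival times are nonnegative only
  -- almost surely; the truncation makes the bound global.
  set G : ℝ → ℝ := fun y => tailExp k (max y 0) with hG
  have hGm : Measurable G := by fun_prop
  have hG0 : ∀ y, 0 < G y := fun y => Real.exp_pos _
  have hG1 : ∀ y, G y ≤ 1 := fun y => tailExp_le_one hk hk0 _ (le_max_right _ _)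
  set Pm : ℕ → (ℕ → ℝ) → ℝ := fun m e => ∏ n ∈ Finset.range m, (1 - k (psum e (n + 1))) with hPm
  have hPmm : ∀ m, Measurable (Pm m) := fun m => by
    refine Finset.measurable_prod _ fun n _ => ?_
    exact measurable_const.sub (hkm.comp (measurable_psum _))
  have hP0 : ∀ m e, 0 ≤ Pm m e := fun m e =>
    Finset.prod_nonneg fun n _ => by linarith [hk1 (psum e (n + 1))]
  have hP1 : ∀ m e, Pm m e ≤ 1 := fun m e =>
    Finset.prod_le_one (fun n _ => by linarith [hk1 (psum e (n + 1))])
      fun n _ => by linarith [hk0 (psum e (n + 1))]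
  have hdep : ∀ m, ∀ e e' : ℕ → ℝ, (∀ j < m, e j = e' j) → ∀ n ≤ m, psum e n = psum e' n := by
    intro m e e' h n hn
    exact Finset.sum_congr rfl fun j hj => h j (lt_of_lt_of_le (Finset.mem_range.1 hj) hn)
  -- `Pm m * G (psum m)` is a martingale with initial value `G 0`, the expected limit. It remains to
  -- see that the factor `G (psum m)` tends to `1` in mean.
  have hmart : ∀ m, ∫ e, Pm m e * G (psum e m) ∂expSeq = G 0 := by
    intro m
    induction m with
    | zero => simp [hPm, psum]
    | succ m ih =>
      rw [← ih]
      -- The truncation to `[-1, 1]` gives the bound on all of the space that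
      -- `integral_expSeq_coord` requires; it has no effect when the first argument lies in `[0,
      -- 1]`.
      set F : (ℝ × ℝ) × ℝ → ℝ := fun p => max (-1) (min 1 (p.1.1 *
        ((1 - k (p.1.2 + p.2)) * G (p.1.2 + p.2)))) with hF
      have hFm : Measurable F := by
        have h1 : Measurable fun p : (ℝ × ℝ) × ℝ => p.1.2 + p.2 := by fun_prop
        have h2 := hkm.comp h1
        have h3 := hGm.comp h1
        exact measurable_const.max (measurable_const.min (Measurable.mul (by fun_prop)
          ((measurable_const.sub h2).mul h3)))
      have hFb : ∀ p, |F p| ≤ 1 := fun p => abs_le.2 ⟨le_max_left _ _,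
        max_le (by norm_num) (min_le_left _ _)⟩
      have hFeq : ∀ a b s : ℝ, 0 ≤ a → a ≤ 1 → F ((a, b), s) =
          a * ((1 - k (b + s)) * G (b + s)) := by
        intro a b s h0 h1
        have h2 : 0 ≤ 1 - k (b + s) := by linarith [hk1 (b + s)]
        have h3 : 1 - k (b + s) ≤ 1 := by linarith [hk0 (b + s)]
        have h4 : a * ((1 - k (b + s)) * G (b + s)) ≤ 1 :=
          mul_le_one₀ h1 (mul_nonneg h2 (hG0 _).le) (mul_le_one₀ h3 (hG0 _).le (hG1 _))
        have h5 : 0 ≤ a * ((1 - k (b + s)) * G (b + s)) :=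
          mul_nonneg h0 (mul_nonneg h2 (hG0 _).le)
        simp only [hF]
        rw [min_eq_right h4, max_eq_right (by linarith)]
      have key := integral_expSeq_coord (m := m) (A := fun e => (Pm m e, psum e m))
        ((hPmm m).prodMk (measurable_psum m)) (fun e e' h => by
          refine Prod.ext ?_ (hdep m e e' h m le_rfl)
          change ∏ n ∈ Finset.range m, (1 - k (psum e (n + 1))) =
            ∏ n ∈ Finset.range m, (1 - k (psum e' (n + 1)))
          refine Finset.prod_congr rfl fun n hn => ?_
          rw [hdep m e e' h (n + 1) (Finset.mem_range.1 hn)]) hFm hFb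
      have l1 : ∀ e : ℕ → ℝ, Pm (m + 1) e * G (psum e (m + 1)) = F ((Pm m e, psum e m), e m) := by
        intro e
        rw [hFeq _ _ _ (hP0 m e) (hP1 m e)]
        simp only [hPm]
        rw [Finset.prod_range_succ]
        have : psum e (m + 1) = psum e m + e m := Finset.sum_range_succ _ _
        rw [this, mul_assoc]
      simp_rw [l1]
      rw [key]
      refine integral_congr_ae ?_
      filter_upwards [ae_expSeq_pos] with e he
      simp_rw [hFeq _ _ _ (hP0 m e) (hP1 m e)]
      rw [integral_const_mul]
      congr 1
      have hps : 0 ≤ psum e m := Finset.sum_nonneg fun j _ => (he j).le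
      have h1 := tailExp_fixed hk hk0 hk1 hkc (psum e m) hps
      have h2 : G (psum e m) = tailExp k (psum e m) := by simp only [hG]; rw [max_eq_left hps]
      rw [h2, ← h1]
      refine integral_congr_ae ?_
      filter_upwards [ae_expMeasure_pos] with s hs
      simp only [hG]
      rw [max_eq_left (add_nonneg hps hs.le)]
  have hG00 : G 0 = Real.exp (-∫ s in Ioi (0 : ℝ), k s) := by simp [hG, tailExp]
  -- Quantitative form of the divergence of the arrival times, used through Markov's inequality in
  -- `hbd`.
  have hexp : ∀ m : ℕ, ∫ e, Real.exp (-psum e m) ∂expSeq = (1 / 2) ^ m := by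
    intro m
    have hind : iIndepFun (fun (j : ℕ) (e : ℕ → ℝ) => e j) expSeq :=
      iIndepFun_infinitePi (X := fun _ x => x) fun _ => measurable_id
    have h1 := hind.mgf_sum (t := -1) (fun j => measurable_pi_apply j) (Finset.range m)
    have h2 : ∀ j : ℕ, mgf (fun e : ℕ → ℝ => e j) expSeq (-1) = 1 / 2 := fun j => by
      have h3 : mgf (fun e : ℕ → ℝ => e j) expSeq (-1) = ∫ s, Real.exp (-s) ∂expMeasure 1 := by
        have h4 : expSeq.map (fun e : ℕ → ℝ => e j) = expMeasure 1 :=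
          Measure.infinitePi_map_eval (fun _ : ℕ => expMeasure 1) j
        rw [← h4, integral_map (measurable_pi_apply j).aemeasurable (by fun_prop)]
        simp [mgf]
      rw [h3, integral_expMeasure]
      have h5 := integral_exp_mul_Ioi (a := -2) (by norm_num) 0
      have h6 : (1 : ℝ) / 2 = -Real.exp (-2 * 0) / -2 := by norm_num
      rw [h6, ← h5]
      refine integral_congr_ae (ae_of_all _ fun s => ?_)
      simp only
      rw [← Real.exp_add]; ring_nf
    simp only [h2, Finset.prod_const, Finset.card_range] at h1
    rw [← h1]
    simp [mgf, psum]
  rw [← hG00]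
  have hPi : ∀ m, Integrable (Pm m) expSeq := fun m =>
    Integrable.of_bound (hPmm m).aestronglyMeasurable 1 (ae_of_all _ fun e => by
      rw [Real.norm_of_nonneg (hP0 m e)]; exact hP1 m e)
  have hPG : ∀ m, Integrable (fun e => Pm m e * G (psum e m)) expSeq := fun m =>
    Integrable.of_bound ((hPmm m).mul (hGm.comp (measurable_psum m))).aestronglyMeasurable 1
      (ae_of_all _ fun e => by
        rw [Real.norm_of_nonneg (mul_nonneg (hP0 m e) (hG0 _).le)]
        exact mul_le_one₀ (hP1 m e) (hG0 _).le (hG1 _))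
  have hdiff : ∀ m, (∫ e, Pm m e ∂expSeq) - G 0 = ∫ e, Pm m e * (1 - G (psum e m)) ∂expSeq := by
    intro m
    rw [← hmart m, ← integral_sub (hPi m) (hPG m)]
    refine integral_congr_ae (ae_of_all _ fun e => ?_)
    simp only; ring
  rw [tendsto_iff_norm_sub_tendsto_zero, Metric.tendsto_atTop]
  intro ε hε
  obtain ⟨c, hc'⟩ := ((tendsto_order.1 (tendsto_tailExp hk)).1 (1 - ε / 2) (by linarith)).exists_forall_of_atTop
  have hpow : Tendsto (fun m : ℕ => Real.exp (max c 0) * (1 / 2 : ℝ) ^ m) atTop (𝓝 0) := by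
    simpa using (tendsto_pow_atTop_nhds_zero_of_lt_one (by norm_num : (0 : ℝ) ≤ 1 / 2)
      (by norm_num)).const_mul (Real.exp (max c 0))
  obtain ⟨m0, hm0⟩ := eventually_atTop.1 ((tendsto_order.1 hpow).2 (ε / 2) (by linarith))
  refine ⟨m0, fun m hm => ?_⟩
  have hbd : ∀ y, 1 - G y ≤ ε / 2 + Real.exp (max c 0) * Real.exp (-y) := by
    intro y
    by_cases hy : c ≤ max y 0
    · have := hc' _ hy
      have h2 := mul_pos (Real.exp_pos (max c 0)) (Real.exp_pos (-y))
      have h3 : tailExp k (max y 0) = G y := rfl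
      linarith
    · have h1 : y ≤ max c 0 := (le_max_left y 0).trans ((not_le.1 hy).le.trans (le_max_left _ _))
      rw [← Real.exp_add]
      have := Real.one_le_exp (x := max c 0 + -y) (by linarith)
      linarith [hG0 y]
  -- A function that is not integrable has integral `0` by convention, but this integral is
  -- `(1/2)^m`.
  have hei : Integrable (fun e => Real.exp (-psum e m)) expSeq := by
    by_contra h
    have := hexp m
    rw [integral_undef h] at this
    have h2 : (0 : ℝ) < (1 / 2) ^ m := by positivity
    linarith
  have h1 : (∫ e, Pm m e ∂expSeq) - G 0 ≤ ε / 2 + Real.exp (max c 0) * (1 / 2) ^ m := by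
    rw [hdiff]
    have h2 : ∫ e, Pm m e * (1 - G (psum e m)) ∂expSeq ≤
        ∫ e, (ε / 2 + Real.exp (max c 0) * Real.exp (-psum e m)) ∂expSeq := by
      refine integral_mono_of_nonneg (ae_of_all _ fun e => mul_nonneg (hP0 m e)
        (by linarith [hG1 (psum e m)])) ((integrable_const _).add (hei.const_mul _))
        (ae_of_all _ fun e => ?_)
      exact (mul_le_of_le_one_left (by linarith [hG1 (psum e m)]) (hP1 m e)).trans (hbd _)
    rw [integral_add (integrable_const _) (hei.const_mul _), integral_const_mul, hexp] at h2
    simpa using h2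
  have h2 : 0 ≤ (∫ e, Pm m e ∂expSeq) - G 0 := by
    rw [hdiff]
    exact integral_nonneg fun e => mul_nonneg (hP0 m e) (by linarith [hG1 (psum e m)])
  rw [dist_zero_right, norm_norm, Real.norm_of_nonneg h2]
  have := hm0 m hm
  linarith

end Functional


/-! ### Self-similarity of the noise on the tree -/

/-- Indices of the elementary variables: a vertex, together with an index of an exponential or of a
Gaussian variable. -/
abbrev Idx (N : ℕ) : Type := List ℕ × (ℕ ⊕ Fin N)

/-- The laws of the elementary variables at one vertex. -/
def coordLaw (N : ℕ) : ℕ ⊕ Fin N → Measure ℝ :=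
  Sum.elim (fun _ => expMeasure 1) fun _ => gaussianReal 0 1

instance (N : ℕ) (j : ℕ ⊕ Fin N) : IsProbabilityMeasure (coordLaw N j) := by
  cases j <;> (simp only [coordLaw, Sum.elim_inl, Sum.elim_inr]; infer_instance)

/-- The joint law of all the elementary variables. -/
def flatLaw (N : ℕ) : Measure (Idx N → ℝ) := Measure.infinitePi fun p => coordLaw N p.2

instance (N : ℕ) : IsProbabilityMeasure (flatLaw N) := by unfold flatLaw; infer_instance

theorem infinitePi_sum_map {α β : Type*} (κ : α ⊕ β → Measure ℝ) [∀ j, IsProbabilityMeasure (κ j)] :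
    (Measure.infinitePi κ).map (fun w => (fun a => w (Sum.inl a), fun b => w (Sum.inr b))) =
      (Measure.infinitePi fun a => κ (Sum.inl a)).prod (Measure.infinitePi fun b => κ (Sum.inr b)) := by
  have hm : Measurable fun p : (α → ℝ) × (β → ℝ) => (Sum.elim p.1 p.2 : α ⊕ β → ℝ) := by
    rw [measurable_pi_iff]
    rintro (a | b)
    · exact (measurable_pi_apply a).comp measurable_fst
    · exact (measurable_pi_apply b).comp measurable_snd
  have h : ((Measure.infinitePi fun a => κ (Sum.inl a)).prod
      (Measure.infinitePi fun b => κ (Sum.inr b))).map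
        (fun p => (Sum.elim p.1 p.2 : α ⊕ β → ℝ)) = Measure.infinitePi κ := by
    refine Measure.eq_infinitePi _ fun s t ht => ?_
    rw [Measure.map_apply hm (MeasurableSet.pi s.countable_toSet fun i _ => ht i)]
    have e : (fun p : (α → ℝ) × (β → ℝ) => (Sum.elim p.1 p.2 : α ⊕ β → ℝ)) ⁻¹' (Set.pi s t) =
        (Set.pi (s.toLeft : Set α) fun a => t (Sum.inl a)) ×ˢ
          (Set.pi (s.toRight : Set β) fun b => t (Sum.inr b)) := by
      ext p
      simp [Set.mem_pi]
    rw [e, Measure.prod_prod, Measure.infinitePi_pi _ fun _ _ => ht _,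
      Measure.infinitePi_pi _ fun _ _ => ht _]
    conv_rhs => rw [← Finset.toLeft_disjSum_toRight (u := s)]
    rw [Finset.prod_disjSum]
  rw [← h, Measure.map_map (by fun_prop) hm]
  have e2 : ((fun w : α ⊕ β → ℝ => (fun a => w (Sum.inl a), fun b => w (Sum.inr b))) ∘
      fun p : (α → ℝ) × (β → ℝ) => (Sum.elim p.1 p.2 : α ⊕ β → ℝ)) = id := rfl
  rw [e2, Measure.map_id]

/-- The variables at the root. -/
def rootVar {N : ℕ} (w : Idx N → ℝ) : (ℕ → ℝ) × (Fin N → ℝ) :=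
  (fun n => w ([], Sum.inl n), fun i => w ([], Sum.inr i))

/-- The variables on the subtree above the `n`-th child of the root. -/
def subVar {N : ℕ} (n : ℕ) (w : Idx N → ℝ) : Idx N → ℝ := fun p => w (n :: p.1, p.2)

@[fun_prop]
theorem measurable_rootVar {N : ℕ} : Measurable (rootVar (N := N)) := by
  unfold rootVar; fun_prop

@[fun_prop]
theorem measurable_subVar {N : ℕ} (n : ℕ) : Measurable (subVar (N := N) n) := by
  unfold subVar; fun_prop

theorem coordLaw_map_root (N : ℕ) :
    (Measure.infinitePi (coordLaw N)).map
      (fun w => (fun a => w (Sum.inl a), fun b => w (Sum.inr b))) = expSeq.prod (stdG N) := by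
  rw [infinitePi_sum_map]
  unfold expSeq stdG
  rw [← Measure.infinitePi_eq_pi]
  rfl

/-- Self-similarity: a vertex is either the root or lies in the subtree of exactly one child of the
root. The subtrees are independent of each other and of the root variables, and each carries a copy
of the whole noise. -/
theorem flatLaw_map (N : ℕ) :
    (flatLaw N).map (fun w => (rootVar w, fun n => subVar n w)) =
      (expSeq.prod (stdG N)).prod (Measure.infinitePi fun _ : ℕ => flatLaw N) := by
  set g : (ℕ ⊕ Fin N) ⊕ (ℕ × Idx N) → Idx N :=
    Sum.elim (fun j => ([], j)) fun p => (p.1 :: p.2.1, p.2.2) with hg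
  have hinj : Function.Injective g := by
    rintro (a | ⟨n, l, a⟩) (b | ⟨n', l', b⟩) hab <;> simp [hg] at hab
    · rw [hab]
    · obtain ⟨⟨rfl, rfl⟩, rfl⟩ := hab; rfl
  have h1 := Measure.map_infinitePi_infinitePi_of_inj (P := fun p : Idx N => coordLaw N p.2) hinj
  have h2 := infinitePi_sum_map fun i => coordLaw N (g i).2
  have h3 := Measure.infinitePi_map_curry (ι := ℕ) (κ := Idx N) fun _ p => coordLaw N p.2
  have hc : Measurable (MeasurableEquiv.curry ℕ (Idx N) ℝ) := MeasurableEquiv.measurable _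
  have h4 : ((Measure.infinitePi fun a : ℕ ⊕ Fin N => coordLaw N (g (Sum.inl a)).2).prod
      (Measure.infinitePi fun b : ℕ × Idx N => coordLaw N (g (Sum.inr b)).2)).map
        (Prod.map (fun w => (fun a => w (Sum.inl a), fun b => w (Sum.inr b)))
          (MeasurableEquiv.curry ℕ (Idx N) ℝ)) =
      (expSeq.prod (stdG N)).prod (Measure.infinitePi fun _ : ℕ => flatLaw N) := by
    rw [← Measure.map_prod_map _ _ (by fun_prop) hc]
    congr 1
    · exact coordLaw_map_root N
  have hm : Measurable (Prod.map (fun w : ℕ ⊕ Fin N → ℝ =>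
      (fun a => w (Sum.inl a), fun b => w (Sum.inr b))) (MeasurableEquiv.curry ℕ (Idx N) ℝ)) :=
    Measurable.prodMap (by fun_prop) hc
  rw [← h4, ← h2, Measure.map_map hm (by fun_prop), ← h1,
    Measure.map_map (hm.comp (by fun_prop)) (by fun_prop)]
  rfl

/-- The splitting of the elementary variables into exponential and Gaussian variables. -/
def toNoise {N : ℕ} (w : Idx N → ℝ) : Noise N :=
  (fun p => w (p.1, Sum.inl p.2), fun p => w (p.1, Sum.inr p.2))

@[fun_prop]
theorem measurable_toNoise {N : ℕ} : Measurable (toNoise (N := N)) := by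
  unfold toNoise; fun_prop

theorem flatLaw_map_toNoise (N : ℕ) : (flatLaw N).map toNoise = noiseLaw N := by
  set g : (List ℕ × ℕ) ⊕ (List ℕ × Fin N) → Idx N :=
    Sum.elim (fun p => (p.1, Sum.inl p.2)) fun p => (p.1, Sum.inr p.2) with hg
  have hinj : Function.Injective g := by
    rintro (⟨l, a⟩ | ⟨l, a⟩) (⟨l', b⟩ | ⟨l', b⟩) hab <;> simp [hg] at hab
    · obtain ⟨rfl, rfl⟩ := hab; rfl
    · obtain ⟨rfl, rfl⟩ := hab; rfl
  have h1 := Measure.map_infinitePi_infinitePi_of_inj (P := fun p : Idx N => coordLaw N p.2) hinj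
  have h2 := infinitePi_sum_map fun i => coordLaw N (g i).2
  have h3 : noiseLaw N = (Measure.infinitePi fun a : List ℕ × ℕ => coordLaw N (g (Sum.inl a)).2).prod
      (Measure.infinitePi fun b : List ℕ × Fin N => coordLaw N (g (Sum.inr b)).2) := rfl
  rw [h3, ← h2, ← h1, Measure.map_map (by fun_prop) (by fun_prop)]
  rfl

/-- Given the root variables, the subtrees are independent copies of the tree, so the mean of the
product factorizes. -/
theorem integral_flatLaw_prod {N : ℕ} (m : ℕ)
    {F : ℕ → ((ℕ → ℝ) × (Fin N → ℝ)) × (Idx N → ℝ) → ℝ} (hF : ∀ n, Measurable (F n))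
    (h0 : ∀ n p, 0 ≤ F n p) (h1 : ∀ n p, F n p ≤ 1) :
    ∫ w, ∏ n ∈ Finset.range m, F n (rootVar w, subVar n w) ∂flatLaw N =
      ∫ r, ∏ n ∈ Finset.range m, ∫ w, F n (r, w) ∂flatLaw N ∂(expSeq.prod (stdG N)) := by
  have hm1 : Measurable fun w : Idx N → ℝ => (rootVar w, fun n : ℕ => subVar n w) := by fun_prop
  set H : ((ℕ → ℝ) × (Fin N → ℝ)) × (ℕ → Idx N → ℝ) → ℝ :=
    fun p => ∏ n ∈ Finset.range m, F n (p.1, p.2 n) with hH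
  have hHm : Measurable H := Finset.measurable_prod _ fun n _ => (hF n).comp (by fun_prop)
  have hHb : ∀ p, ‖H p‖ ≤ 1 := fun p => by
    rw [Real.norm_of_nonneg (Finset.prod_nonneg fun n _ => h0 _ _)]
    exact Finset.prod_le_one (fun n _ => h0 _ _) fun n _ => h1 _ _
  have e1 : ∫ w, ∏ n ∈ Finset.range m, F n (rootVar w, subVar n w) ∂flatLaw N =
      ∫ p, H p ∂((flatLaw N).map fun w => (rootVar w, fun n : ℕ => subVar n w)) := by
    rw [integral_map hm1.aemeasurable hHm.aestronglyMeasurable]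
  rw [e1, flatLaw_map, integral_prod _ (Integrable.of_bound hHm.aestronglyMeasurable 1
    (ae_of_all _ hHb))]
  refine integral_congr_ae (ae_of_all _ fun r => ?_)
  have hind : iIndepFun (fun (n : ℕ) (v : ℕ → Idx N → ℝ) => v n)
      (Measure.infinitePi fun _ : ℕ => flatLaw N) :=
    iIndepFun_infinitePi (X := fun _ x => x) fun _ => measurable_id
  have h5 := (hind.precomp (g := ((↑) : Finset.range m → ℕ))
    Subtype.val_injective).integral_fun_prod_comp
    (X := fun (n : Finset.range m) (v : ℕ → Idx N → ℝ) => v n)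
    (f := fun n w => F n (r, w)) (fun n => (measurable_pi_apply _).aemeasurable)
    (fun n => ((hF n).comp (by fun_prop)).aestronglyMeasurable)
  simp only [hH]
  rw [← Finset.prod_coe_sort (Finset.range m) fun n => ∫ w, F n (r, w) ∂flatLaw N]
  simp_rw [← Finset.prod_coe_sort (Finset.range m)]
  refine h5.trans (Finset.prod_congr rfl fun n _ => ?_)
  have h6 : (Measure.infinitePi fun _ : ℕ => flatLaw N).map (fun v => v n) = flatLaw N :=
    Measure.infinitePi_map_eval (fun _ : ℕ => flatLaw N) n
  conv_rhs => rw [← h6]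
  rw [integral_map (measurable_pi_apply _).aemeasurable]
  exact ((hF n).comp (by fun_prop)).aestronglyMeasurable


/-! ### The function `x ↦ exp (-x)` on `[0, ∞]` -/

/-- `exp (-x)` for `x ∈ [0, ∞]`. -/
def lap (x : ℝ≥0∞) : ℝ := (EReal.exp (-(x : EReal))).toReal

@[simp] theorem lap_top : lap ∞ = 0 := by simp [lap]

theorem lap_ofReal {x : ℝ} (hx : 0 ≤ x) : lap (ENNReal.ofReal x) = Real.exp (-x) := by
  rw [lap, EReal.coe_ennreal_ofReal, max_eq_left hx, ← EReal.coe_neg, EReal.exp_coe,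
    ENNReal.toReal_ofReal (Real.exp_pos _).le]

theorem lap_of_ne_top {x : ℝ≥0∞} (hx : x ≠ ∞) : lap x = Real.exp (-x.toReal) := by
  conv_lhs => rw [← ENNReal.ofReal_toReal hx]
  exact lap_ofReal ENNReal.toReal_nonneg

@[simp] theorem lap_zero : lap 0 = 1 := by simp [lap_of_ne_top]

theorem lap_nonneg (x : ℝ≥0∞) : 0 ≤ lap x := ENNReal.toReal_nonneg

theorem lap_le_one (x : ℝ≥0∞) : lap x ≤ 1 := by
  by_cases hx : x = ∞
  · simp [hx]
  · rw [lap_of_ne_top hx, Real.exp_le_one_iff]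
    linarith [ENNReal.toReal_nonneg (a := x)]

theorem continuous_lap : Continuous lap := by
  have h : ∀ x : ℝ≥0∞, EReal.exp (-(x : EReal)) ≠ ∞ := fun x => by
    by_cases hx : x = ∞
    · simp [hx]
    · lift x to ℝ≥0 using hx
      have : ((x : ℝ≥0∞) : EReal) = ((x : ℝ) : EReal) := rfl
      rw [this, ← EReal.coe_neg, EReal.exp_coe]
      exact ENNReal.ofReal_ne_top
  rw [continuous_iff_continuousAt]
  intro x
  have h2 : Continuous fun x : ℝ≥0∞ => EReal.exp (-(x : EReal)) :=
    EReal.expHomeomorph.continuous.comp (continuous_neg.comp continuous_coe_ennreal_ereal)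
  exact (ENNReal.continuousAt_toReal (h x)).comp (f := fun x : ℝ≥0∞ => EReal.exp (-(x : EReal)))
    h2.continuousAt

@[fun_prop]
theorem measurable_lap : Measurable lap := continuous_lap.measurable

theorem lap_add (x y : ℝ≥0∞) : lap (x + y) = lap x * lap y := by
  by_cases hx : x = ∞
  · simp [hx]
  by_cases hy : y = ∞
  · simp [hy]
  rw [lap_of_ne_top hx, lap_of_ne_top hy, lap_of_ne_top (ENNReal.add_ne_top.2 ⟨hx, hy⟩),
    ENNReal.toReal_add hx hy, ← Real.exp_add]
  congr 1; ring

/-- `lap` is continuous at `∞` as well, so no summability is needed; finiteness of the tree sums can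
be derived afterwards. -/
theorem tendsto_prod_lap (a : ℕ → ℝ≥0∞) :
    Tendsto (fun m => ∏ n ∈ Finset.range m, lap (a n)) atTop (𝓝 (lap (∑' n, a n))) := by
  have h : ∀ m, ∏ n ∈ Finset.range m, lap (a n) = lap (∑ n ∈ Finset.range m, a n) := fun m => by
    induction m with
    | zero => simp
    | succ m ih => rw [Finset.prod_range_succ, ih, Finset.sum_range_succ, lap_add]
  simp_rw [h]
  exact (continuous_lap.tendsto _).comp (ENNReal.tendsto_nat_tsum a)

/-! ### Weighted sums over the tree -/

variable {N : ℕ}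

/-- The sum over the leaves of the tree of `exp (f (x + a z + ∑ √(2δ) z))`, weighted by the products
of the decorations. -/
def treeSum (f : (Fin N → ℝ) → ℝ) : ℝ → List (ℝ × ℝ) → (Fin N → ℝ) → (Idx N → ℝ) → ℝ≥0∞
  | a, [], x, w => ENNReal.ofReal (Real.exp (f (x + a • (rootVar w).2)))
  | a, (ζ, δ) :: L, x, w => ∑' n : ℕ, ENNReal.ofReal (psum (rootVar w).1 (n + 1) ^ (-1 / ζ)) *
      treeSum f √(2 * δ) L (x + a • (rootVar w).2) (subVar n w)

theorem measurable_treeSum {f : (Fin N → ℝ) → ℝ} (hf : Measurable f) (L : List (ℝ × ℝ)) (a : ℝ) :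
    Measurable fun p : (Fin N → ℝ) × (Idx N → ℝ) => treeSum f a L p.1 p.2 := by
  induction L generalizing a with
  | nil =>
    simp only [treeSum]
    have : Measurable fun p : (Fin N → ℝ) × (Idx N → ℝ) => p.1 + a • (rootVar p.2).2 := by fun_prop
    exact (Real.measurable_exp.comp (hf.comp this)).ennreal_ofReal
  | cons p L ih =>
    obtain ⟨ζ, δ⟩ := p
    simp only [treeSum]
    refine Measurable.tsum fun n => Measurable.mul ?_ ?_
    · have h1 : Measurable fun p : (Fin N → ℝ) × (Idx N → ℝ) => psum (rootVar p.2).1 (n + 1) :=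
        (measurable_psum (n + 1)).comp (by fun_prop)
      exact (h1.pow_const _).ennreal_ofReal
    · have h2 : Measurable fun p : (Fin N → ℝ) × (Idx N → ℝ) =>
        (p.1 + a • (rootVar p.2).2, subVar n p.2) := by fun_prop
      exact (ih √(2 * δ)).comp h2

/-- The exponent of the decorations of the children of the root. -/
def headExp : List (ℝ × ℝ) → ℝ
  | [] => 1
  | p :: _ => p.1

/-- The parameters of the successive Poisson processes increase in `(0, 1)`. -/
def Increasing : List (ℝ × ℝ) → Prop
  | [] => True
  | p :: L => 0 < p.1 ∧ p.1 < headExp L ∧ 0 ≤ p.2 ∧ Increasing L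

/-- The constant in the Laplace transform of the sum of the weights. -/
def laplaceConst : List (ℝ × ℝ) → ℝ
  | [] => 1
  | p :: L => ∫ r in Ioi (0 : ℝ), (1 - Real.exp (-(laplaceConst L * r ^ (-(headExp L / p.1)))))

theorem Increasing.headExp_pos {L : List (ℝ × ℝ)} (h : Increasing L) : 0 < headExp L := by
  cases L with
  | nil => exact one_pos
  | cons p L => exact h.1

theorem one_sub_exp_neg_mem {x : ℝ} (hx : 0 ≤ x) :
    1 - Real.exp (-x) ∈ Icc (0 : ℝ) 1 ∧ 1 - Real.exp (-x) ≤ x := by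
  have h1 := Real.add_one_le_exp (-x)
  have h2 := Real.exp_pos (-x)
  have h3 : Real.exp (-x) ≤ 1 := Real.exp_le_one_iff.2 (by linarith)
  exact ⟨⟨by linarith, by linarith⟩, by linarith⟩

/-- The integrand is at most `1` near the origin and at most `C r^(-ρ)` at infinity. In the cascade
`ρ` is a quotient of consecutive parameters, so `ρ > 1` is their strict increase. -/
theorem integrableOn_one_sub_exp {C ρ : ℝ} (hC : 0 ≤ C) (hρ : 1 < ρ) :
    IntegrableOn (fun r : ℝ => 1 - Real.exp (-(C * r ^ (-ρ)))) (Ioi 0) := by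
  have hm : Measurable fun r : ℝ => 1 - Real.exp (-(C * r ^ (-ρ))) := by fun_prop
  rw [← Ioc_union_Ioi_eq_Ioi (zero_le_one' ℝ)]
  refine IntegrableOn.union ?_ ?_
  · refine Integrable.mono' (g := fun _ => (1 : ℝ)) (by simp)
      hm.aestronglyMeasurable ?_
    filter_upwards [ae_restrict_mem measurableSet_Ioc] with r hr
    have := (one_sub_exp_neg_mem (x := C * r ^ (-ρ))
      (mul_nonneg hC (Real.rpow_nonneg hr.1.le _))).1
    rw [Real.norm_of_nonneg this.1]; exact this.2
  · refine Integrable.mono' (g := fun r => C * r ^ (-ρ))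
      ((integrableOn_Ioi_rpow_of_lt (by linarith) one_pos).const_mul C)
      hm.aestronglyMeasurable ?_
    filter_upwards [ae_restrict_mem measurableSet_Ioi] with r hr
    have hr' : (0 : ℝ) < r := one_pos.trans hr
    have := one_sub_exp_neg_mem (x := C * r ^ (-ρ))
      (mul_nonneg hC (Real.rpow_nonneg hr'.le _))
    rw [Real.norm_of_nonneg this.1.1]; exact this.2

theorem laplaceConst_pos {L : List (ℝ × ℝ)} (h : Increasing L) : 0 < laplaceConst L := by
  induction L with
  | nil => exact one_pos
  | cons p L ih =>
    obtain ⟨h1, h2, h3, h4⟩ := h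
    have hC := ih h4
    rw [laplaceConst]
    have hpos : ∀ r ∈ Ioi (0 : ℝ), 0 < 1 - Real.exp (-(laplaceConst L * r ^ (-(headExp L / p.1)))) :=
      fun r hr => by
        rw [sub_pos, Real.exp_lt_one_iff]
        have := mul_pos hC (Real.rpow_pos_of_pos hr (-(headExp L / p.1)))
        linarith
    rw [setIntegral_pos_iff_support_of_nonneg_ae]
    · have : (Function.support fun r : ℝ =>
          1 - Real.exp (-(laplaceConst L * r ^ (-(headExp L / p.1))))) ∩ Ioi 0 = Ioi 0 :=
        inter_eq_right.2 fun r hr => (hpos r hr).ne'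
      rw [this]; simp
    · filter_upwards [ae_restrict_mem measurableSet_Ioi] with r hr
      exact (hpos r hr).le
    · exact integrableOn_one_sub_exp hC.le ((one_lt_div h1).2 h2)

/-- Rescaling Lebesgue measure by independent random factors `s` only multiplies it by the mean of
`s`. This invariance of marked Poisson processes makes the recursion close. -/
theorem integral_scale_mix {Ω : Type*} [MeasurableSpace Ω] {μ : Measure Ω} [SFinite μ]
    {s : Ω → ℝ} (hs : Integrable s μ) (hsm : Measurable s) (hs0 : ∀ ω, 0 < s ω) {G : ℝ → ℝ}
    (hG : IntegrableOn G (Ioi 0)) (hGm : Measurable G) :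
    IntegrableOn (fun r => ∫ ω, G (r / s ω) ∂μ) (Ioi 0) ∧
      ∫ r in Ioi (0 : ℝ), ∫ ω, G (r / s ω) ∂μ = (∫ ω, s ω ∂μ) * ∫ r in Ioi (0 : ℝ), G r := by
  have hsc : ∀ (H : ℝ → ℝ) (ω : Ω), ∫ r in Ioi (0 : ℝ), H (r / s ω) =
      s ω * ∫ r in Ioi (0 : ℝ), H r := fun H ω => by
    have := integral_comp_mul_right_Ioi H 0 (inv_pos.2 (hs0 ω))
    simpa [div_eq_mul_inv] using this
  have hint : Integrable (fun p : Ω × ℝ => G (p.2 / s p.1)) (μ.prod (volume.restrict (Ioi 0))) := by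
    rw [integrable_prod_iff (by
      exact (hGm.comp (by fun_prop : Measurable fun p : Ω × ℝ => p.2 / s p.1)).aestronglyMeasurable)]
    constructor
    · refine ae_of_all _ fun ω => ?_
      have := (integrableOn_Ioi_comp_mul_right_iff G 0 (inv_pos.2 (hs0 ω))).2 (by simpa using hG)
      simpa [div_eq_mul_inv, IntegrableOn] using this
    · have : (fun ω => ∫ r in Ioi (0 : ℝ), ‖G (r / s ω)‖) =
          fun ω => s ω * ∫ r in Ioi (0 : ℝ), ‖G r‖ := funext fun ω => hsc (fun r => ‖G r‖) ω
      rw [this]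
      exact hs.mul_const _
  refine ⟨hint.integral_prod_right, ?_⟩
  rw [← integral_integral_swap hint, ← integral_mul_const]
  exact integral_congr_ae (ae_of_all _ fun ω => hsc G ω)


/-! ### The Laplace transform of the sum over the tree -/

variable {N : ℕ}

theorem Increasing.nonneg {L : List (ℝ × ℝ)} (h : Increasing L) : ∀ p ∈ L, 0 ≤ p.1 := by
  induction L with
  | nil => simp
  | cons p L ih =>
    intro p' hp'
    rcases List.mem_cons.1 hp' with rfl | hp'
    · exact h.1.le
    · exact ih h.2.2.2 p' hp'

theorem exp_mul_T {m δ R : ℝ} {f : (Fin N → ℝ) → ℝ} (hf : Lip R f) (hm : m ≠ 0) (x : Fin N → ℝ) :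
    Real.exp (m * T m δ f x) = ∫ z, Real.exp (m * f (x + √(2 * δ) • z)) ∂stdG N := by
  have h : 0 < ∫ z, Real.exp (m * f (x + √(2 * δ) • z)) ∂stdG N :=
    integral_exp_pos (hf.expInt x _ m)
  rw [T, expMean, if_neg hm, mul_inv_cancel_left₀ hm, Real.exp_log h]

/-- The Laplace transform of the sum over the tree above a vertex, as a function of the decoration
`r ^ (-1/ζ)` of this vertex. -/
theorem rpow_scale {t r ζ ζ' X C : ℝ} (ht : 0 < t) (hr : 0 < r) (hζ : 0 < ζ) :
    C * (t * r ^ (-1 / ζ) * Real.exp X) ^ ζ' =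
      C * (r / (t ^ ζ * Real.exp (ζ * X))) ^ (-(ζ' / ζ)) := by
  have hrp := Real.rpow_pos_of_pos hr (-1 / ζ)
  have htp := Real.rpow_pos_of_pos ht ζ
  congr 1
  refine Real.log_injOn_pos (mem_Ioi.2 (by positivity)) (mem_Ioi.2 (by positivity)) ?_
  rw [Real.log_rpow (by positivity), Real.log_rpow (by positivity),
    Real.log_mul (by positivity) (by positivity), Real.log_mul (by positivity) (by positivity),
    Real.log_div (by positivity) (by positivity), Real.log_mul (by positivity) (by positivity),
    Real.log_rpow hr, Real.log_rpow ht, Real.log_exp, Real.log_exp]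
  field_simp
  ring

/-- Given the root, the sum runs over Poisson points with independent subtree sums. The induction
hypothesis turns the child with arrival time `r` into a factor `1 - k r`, and the Poisson functional
gives `exp (-∫ k)`. By scaling, `f` enters `∫ k` only through the mean of `exp (ζ val f L)`, which
is what one more operator `T ζ δ` produces. -/
theorem integral_lap_treeSum {R : ℝ} {f : (Fin N → ℝ) → ℝ} (hf : Lip R f) (L : List (ℝ × ℝ))
    (hL : Increasing L) (a : ℝ) (x : Fin N → ℝ) {t : ℝ} (ht : 0 < t) :
    ∫ w, lap (ENNReal.ofReal t * treeSum f a L x w) ∂flatLaw N =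
      ∫ z, Real.exp (-(laplaceConst L * (t * Real.exp (val f L (x + a • z))) ^ headExp L))
        ∂stdG N := by
  induction L generalizing a x t with
  | nil =>
    have h2 : (stdG N) = (flatLaw N).map fun w => (rootVar w).2 := by
      have := congrArg (Measure.map fun p => p.1.2) (flatLaw_map N)
      rw [Measure.map_map (by fun_prop) (by fun_prop)] at this
      refine Eq.trans ?_ this.symm
      have e : (fun p : ((ℕ → ℝ) × (Fin N → ℝ)) × (ℕ → Idx N → ℝ) => p.1.2) =
        Prod.snd ∘ Prod.fst := rfl
      rw [e, ← Measure.map_map measurable_snd measurable_fst, ← Measure.fst, Measure.fst_prod,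
        ← Measure.snd, Measure.snd_prod]
    have hfm := hf.continuous.measurable
    have hrm : Measurable fun w : Idx N → ℝ => (rootVar w).2 := measurable_snd.comp measurable_rootVar
    simp only [treeSum, laplaceConst, headExp, val, Real.rpow_one, one_mul]
    rw [h2, integral_map hrm.aemeasurable (by
      exact (by fun_prop : Measurable fun z : Fin N → ℝ =>
        Real.exp (-(t * Real.exp (f (x + a • z))))).aestronglyMeasurable)]
    refine integral_congr_ae (ae_of_all _ fun w => ?_)
    beta_reduce
    rw [← ENNReal.ofReal_mul ht.le, lap_ofReal (by positivity)]
  | cons p L ih =>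
    obtain ⟨ζ, δ⟩ := p
    obtain ⟨hζ, hζ', hδ, hL'⟩ := hL
    simp only at hζ hζ' hδ
    set b := √(2 * δ) with hb
    set C := laplaceConst L with hC
    set ζ' := headExp L with hζ'd
    have hC0 : 0 < C := laplaceConst_pos hL'
    have hv : Lip R (val f L) := hf.val hL'.nonneg
    have hvc := hv.continuous
    have hvm := hvc.measurable
    have htm := measurable_treeSum hf.continuous.measurable L b
    -- the intensity of the Poisson process seen through the Laplace transform
    set G : ℝ → ℝ := fun r => 1 - Real.exp (-(C * r ^ (-(ζ' / ζ)))) with hG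
    have hGm : Measurable G := by fun_prop
    have hGi : IntegrableOn G (Ioi 0) := integrableOn_one_sub_exp hC0.le ((one_lt_div hζ).2 hζ')
    have hG01 : ∀ r, 0 < r → G r ∈ Icc (0 : ℝ) 1 := fun r hr =>
      (one_sub_exp_neg_mem (mul_nonneg hC0.le (Real.rpow_nonneg hr.le _))).1
    -- By `rpow_scale`, `t` and the value of the subtree act on the arrival time `r` as the
    -- rescaling `r / s`.
    set s : (Fin N → ℝ) → (Fin N → ℝ) → ℝ := fun y z => t ^ ζ * Real.exp (ζ * val f L (y + b • z))
      with hs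
    have hsm : ∀ y, Measurable (s y) := fun y => by simp only [hs]; fun_prop
    have hs0 : ∀ y z, 0 < s y z := fun y z =>
      mul_pos (Real.rpow_pos_of_pos ht ζ) (Real.exp_pos _)
    have hsi : ∀ y, Integrable (s y) (stdG N) := fun y => (hv.expInt y b ζ).const_mul _
    -- `1 - k y r` is the Laplace transform of the contribution of a child with arrival time `r`;
    -- see `hone`.
    set k : (Fin N → ℝ) → ℝ → ℝ := fun y r => (Ioi (0 : ℝ)).indicator
      (fun r => ∫ z, G (r / s y z) ∂stdG N) r with hk
    have hmix := fun y => integral_scale_mix (hsi y) (hsm y) (hs0 y) hGi hGm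
    have hki : ∀ y, Integrable (k y) := fun y => by
      have := (hmix y).1
      rwa [← integrable_indicator_iff measurableSet_Ioi] at this
    have hks : ∀ y, ∫ r in Ioi (0 : ℝ), k y r =
        laplaceConst ((ζ, δ) :: L) * (t * Real.exp (val f ((ζ, δ) :: L) y)) ^ ζ := fun y => by
      have h1 : ∫ r in Ioi (0 : ℝ), k y r = ∫ r in Ioi (0 : ℝ), ∫ z, G (r / s y z) ∂stdG N :=
        setIntegral_congr_fun measurableSet_Ioi fun r hr => indicator_of_mem hr _
      -- The mean of the scale is the exponential moment in the definition of `T ζ δ`.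
      have h2 : ∫ z, s y z ∂stdG N = (t * Real.exp (val f ((ζ, δ) :: L) y)) ^ ζ := by
        rw [Real.mul_rpow ht.le (Real.exp_pos _).le, ← Real.exp_mul,
          mul_comm (val _ _ _) ζ, val, exp_mul_T hv hζ.ne']
        exact integral_const_mul _ _
      rw [h1, (hmix y).2, h2, mul_comm]
      rfl
    have hk0 : ∀ y r, 0 ≤ k y r := fun y r => by
      refine indicator_nonneg (fun r hr => integral_nonneg fun z => ?_) r
      exact (hG01 _ (div_pos hr (hs0 y z))).1
    have hk1 : ∀ y r, k y r ≤ 1 := fun y r => by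
      refine indicator_le' (fun r hr => ?_) (fun _ _ => zero_le_one) r
      refine (integral_mono_of_nonneg (ae_of_all _ fun z => (hG01 _ (div_pos hr (hs0 y z))).1)
        (integrable_const (1 : ℝ)) (ae_of_all _ fun z => (hG01 _ (div_pos hr (hs0 y z))).2)).trans ?_
      simp
    have hkm2 : Measurable fun p : (Fin N → ℝ) × ℝ => k p.1 p.2 := by
      have h1 : Measurable fun q : ((Fin N → ℝ) × ℝ) × (Fin N → ℝ) => G (q.1.2 / s q.1.1 q.2) := by
        simp only [hs]; fun_prop
      have h2 : Measurable fun p : (Fin N → ℝ) × ℝ => ∫ z, G (p.2 / s p.1 z) ∂stdG N :=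
        (h1.stronglyMeasurable.integral_prod_right).measurable
      have : (fun p : (Fin N → ℝ) × ℝ => k p.1 p.2) = (Prod.snd ⁻¹' Ioi (0 : ℝ)).indicator
          fun p : (Fin N → ℝ) × ℝ => ∫ z, G (p.2 / s p.1 z) ∂stdG N := by
        ext p; simp [hk, indicator]
      rw [this]
      exact h2.indicator (measurable_snd measurableSet_Ioi)
    have hkm : ∀ y, Measurable (k y) := fun y => hkm2.comp (measurable_const.prodMk measurable_id)
    have hkc : ∀ y, ContinuousOn (k y) (Ioi 0) := fun y => by
      have : ContinuousOn (fun r => ∫ z, G (r / s y z) ∂stdG N) (Ioi 0) := by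
        refine continuousOn_of_dominated (bound := fun _ => (1 : ℝ)) (fun r hr => ?_) (fun r hr => ?_)
          (integrable_const _) (ae_of_all _ fun z => ?_)
        · have := hsm y
          exact (hGm.comp (by fun_prop : Measurable fun z => r / s y z)).aestronglyMeasurable
        · refine ae_of_all _ fun z => ?_
          have := hG01 _ (div_pos hr (hs0 y z))
          rw [Real.norm_of_nonneg this.1]; exact this.2
        · have h1 : ContinuousOn (fun r => (r / s y z) ^ (-(ζ' / ζ))) (Ioi 0) :=
            (continuousOn_id.div_const _).rpow_const fun r hr =>
              Or.inl (div_pos hr (hs0 y z)).ne'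
          exact continuousOn_const.sub (Real.continuous_exp.comp_continuousOn
            (continuousOn_const.mul h1).neg)
      exact this.congr fun r hr => indicator_of_mem hr _
    -- the Laplace transform of one summand
    set Fn : ℕ → ((ℕ → ℝ) × (Fin N → ℝ)) × (Idx N → ℝ) → ℝ := fun n p =>
      lap (ENNReal.ofReal t * (ENNReal.ofReal (psum p.1.1 (n + 1) ^ (-1 / ζ)) *
        treeSum f b L (x + a • p.1.2) p.2)) with hFn
    have hFm : ∀ n, Measurable (Fn n) := fun n => by
      refine measurable_lap.comp (measurable_const.mul (Measurable.mul ?_ ?_))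
      · have : Measurable fun p : ((ℕ → ℝ) × (Fin N → ℝ)) × (Idx N → ℝ) => psum p.1.1 (n + 1) :=
          (measurable_psum (n + 1)).comp (by fun_prop)
        exact (this.pow_const _).ennreal_ofReal
      · exact htm.comp (by fun_prop : Measurable fun p : ((ℕ → ℝ) × (Fin N → ℝ)) × (Idx N → ℝ) =>
          (x + a • p.1.2, p.2))
    have hone : ∀ (e : ℕ → ℝ) (z : Fin N → ℝ) (n : ℕ), 0 < psum e (n + 1) →
        ∫ w, Fn n ((e, z), w) ∂flatLaw N = 1 - k (x + a • z) (psum e (n + 1)) := fun e z n hp => by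
      have hup := Real.rpow_pos_of_pos hp (-1 / ζ)
      have h1 := ih hL' b (x + a • z) (mul_pos ht hup)
      simp_rw [ENNReal.ofReal_mul ht.le, mul_assoc (ENNReal.ofReal t)] at h1
      simp only [hFn]
      rw [h1]
      simp only [hk]
      rw [indicator_of_mem (mem_Ioi.2 hp)]
      have h2 : ∀ z', Real.exp (-(C * (t * psum e (n + 1) ^ (-1 / ζ) *
          Real.exp (val f L (x + a • z + b • z'))) ^ ζ')) =
          1 - G (psum e (n + 1) / s (x + a • z) z') := fun z' => by
        simp only [hG, hs]
        rw [rpow_scale ht hp hζ]; ring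
      simp_rw [h2]
      rw [integral_sub (integrable_const _)]
      · simp
      · refine Integrable.of_bound (C := 1) ?_ (ae_of_all _ fun z' => ?_)
        · have := hsm (x + a • z)
          exact (hGm.comp (by fun_prop : Measurable fun z' =>
            psum e (n + 1) / s (x + a • z) z')).aestronglyMeasurable
        · have := hG01 _ (div_pos hp (hs0 (x + a • z) z'))
          rw [Real.norm_of_nonneg this.1]; exact this.2
    have hpos : ∀ᵐ e ∂expSeq, ∀ n, 0 < psum e (n + 1) := by
      filter_upwards [ae_expSeq_pos] with e he n
      exact Finset.sum_pos (fun j _ => he j) ⟨0, by simp⟩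
    -- both sides as limits
    have hlim1 : Tendsto (fun m => ∫ w, ∏ n ∈ Finset.range m, Fn n (rootVar w, subVar n w)
        ∂flatLaw N) atTop
        (𝓝 (∫ w, lap (ENNReal.ofReal t * treeSum f a ((ζ, δ) :: L) x w) ∂flatLaw N)) := by
      refine tendsto_integral_of_dominated_convergence (fun _ => (1 : ℝ)) (fun m => ?_)
        (integrable_const _) (fun m => ae_of_all _ fun w => ?_) (ae_of_all _ fun w => ?_)
      · exact (Finset.measurable_prod _ fun n _ => (hFm n).comp
          (by fun_prop)).aestronglyMeasurable
      · rw [Real.norm_of_nonneg (Finset.prod_nonneg fun n _ => lap_nonneg _)]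
        exact Finset.prod_le_one (fun n _ => lap_nonneg _) fun n _ => lap_le_one _
      · simp only [treeSum]
        rw [← ENNReal.tsum_mul_left]
        exact tendsto_prod_lap _
    have heq : ∀ m, ∫ w, ∏ n ∈ Finset.range m, Fn n (rootVar w, subVar n w) ∂flatLaw N =
        ∫ z, ∫ e, ∏ n ∈ Finset.range m, (1 - k (x + a • z) (psum e (n + 1))) ∂expSeq ∂stdG N :=
      fun m => by
      rw [integral_flatLaw_prod m hFm (fun n p => lap_nonneg _) fun n p => lap_le_one _]
      have h1 : Measurable fun r : (ℕ → ℝ) × (Fin N → ℝ) =>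
          ∏ n ∈ Finset.range m, (1 - k (x + a • r.2) (psum r.1 (n + 1))) := by
        refine Finset.measurable_prod _ fun n _ => measurable_const.sub ?_
        have h3 : Measurable fun r : (ℕ → ℝ) × (Fin N → ℝ) => psum r.1 (n + 1) :=
          (measurable_psum (n + 1)).comp measurable_fst
        exact hkm2.comp (by fun_prop : Measurable fun r : (ℕ → ℝ) × (Fin N → ℝ) =>
          (x + a • r.2, psum r.1 (n + 1)))
      have h2 : ∫ r, ∏ n ∈ Finset.range m, ∫ w, Fn n (r, w) ∂flatLaw N ∂(expSeq.prod (stdG N)) =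
          ∫ r, ∏ n ∈ Finset.range m, (1 - k (x + a • r.2) (psum r.1 (n + 1)))
            ∂(expSeq.prod (stdG N)) := by
        refine integral_congr_ae ?_
        filter_upwards [Measure.quasiMeasurePreserving_fst.ae hpos] with r hr
        exact Finset.prod_congr rfl fun n _ => hone r.1 r.2 n (hr n)
      rw [h2, integral_prod_symm]
      refine Integrable.of_bound (C := 1) h1.aestronglyMeasurable (ae_of_all _ fun r => ?_)
      rw [Real.norm_of_nonneg (Finset.prod_nonneg fun n _ => sub_nonneg.2 (hk1 _ _))]
      exact Finset.prod_le_one (fun n _ => sub_nonneg.2 (hk1 _ _)) fun n _ =>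
        sub_le_self _ (hk0 _ _)
    simp_rw [heq] at hlim1
    refine tendsto_nhds_unique hlim1 ?_
    refine tendsto_integral_of_dominated_convergence (fun _ => (1 : ℝ)) (fun m => ?_)
      (integrable_const _) (fun m => ae_of_all _ fun z => ?_) (ae_of_all _ fun z => ?_)
    · refine (StronglyMeasurable.integral_prod_right (f := fun (z : Fin N → ℝ) (e : ℕ → ℝ) =>
        ∏ n ∈ Finset.range m, (1 - k (x + a • z) (psum e (n + 1)))) ?_).aestronglyMeasurable
      refine (Finset.measurable_prod _ fun n _ => measurable_const.sub ?_).stronglyMeasurable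
      have h3 : Measurable fun r : (Fin N → ℝ) × (ℕ → ℝ) => psum r.2 (n + 1) :=
        (measurable_psum (n + 1)).comp measurable_snd
      exact hkm2.comp (by fun_prop : Measurable fun r : (Fin N → ℝ) × (ℕ → ℝ) =>
        (x + a • r.1, psum r.2 (n + 1)))
    · refine (norm_integral_le_of_norm_le_const (C := 1) (ae_of_all _ fun e => ?_)).trans (by simp)
      rw [Real.norm_of_nonneg (Finset.prod_nonneg fun n _ => sub_nonneg.2 (hk1 _ _))]
      exact Finset.prod_le_one (fun n _ => sub_nonneg.2 (hk1 _ _)) fun n _ =>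
        sub_le_self _ (hk0 _ _)
    · have := tendsto_integral_prod_poisson (hki (x + a • z)) (hk0 _) (hk1 _) (hkc _) (hkm _)
      rwa [hks] at this


/-! ### The mean of the logarithm in terms of the Laplace transform -/

/-- The integrand of Frullani's integral for the logarithm. -/
def frullani (s t : ℝ) : ℝ := (Real.exp (-t) - Real.exp (-(t * s))) / t

theorem measurable_frullani : Measurable fun p : ℝ × ℝ => frullani p.1 p.2 := by
  unfold frullani; fun_prop

theorem frullani_of_one_le {s t : ℝ} (hs : 1 ≤ s) (ht : 0 < t) :
    frullani s t ∈ Icc 0 ((s - 1) * Real.exp (-t)) := by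
  have h1 : Real.exp (-(t * s)) ≤ Real.exp (-t) := Real.exp_le_exp.2 (by nlinarith)
  refine ⟨div_nonneg (by linarith) ht.le, ?_⟩
  rw [frullani, div_le_iff₀ ht]
  have h2 : Real.exp (-(t * s)) = Real.exp (-t) * Real.exp (-(t * (s - 1))) := by
    rw [← Real.exp_add]; ring_nf
  have h3 := Real.add_one_le_exp (-(t * (s - 1)))
  rw [h2]
  nlinarith [Real.exp_pos (-t)]

theorem frullani_of_le_one {s t : ℝ} (hs : s ≤ 1) (ht : 0 < t) :
    -frullani s t ∈ Icc 0 ((1 - s) * Real.exp (-(s * t))) := by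
  have h1 : Real.exp (-t) ≤ Real.exp (-(t * s)) := Real.exp_le_exp.2 (by nlinarith)
  rw [frullani, ← neg_div]
  refine ⟨div_nonneg (by linarith) ht.le, ?_⟩
  rw [div_le_iff₀ ht]
  have h2 : Real.exp (-t) = Real.exp (-(t * s)) * Real.exp (-(t * (1 - s))) := by
    rw [← Real.exp_add]; ring_nf
  have h3 := Real.add_one_le_exp (-(t * (1 - s)))
  rw [h2, mul_comm s t]
  nlinarith [Real.exp_pos (-(t * s))]

theorem integrableOn_frullani {s : ℝ} (hs : 0 < s) : IntegrableOn (frullani s) (Ioi 0) := by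
  have hm : Measurable (frullani s) := measurable_frullani.comp measurable_prodMk_left
  rcases le_total 1 s with h | h
  · refine Integrable.mono' (((exp_neg_integrableOn_Ioi 0 one_pos)).const_mul (s - 1))
      hm.aestronglyMeasurable ?_
    filter_upwards [ae_restrict_mem measurableSet_Ioi] with t ht
    have := frullani_of_one_le h ht
    rw [Real.norm_of_nonneg this.1]
    simpa using this.2
  · refine Integrable.mono' (((exp_neg_integrableOn_Ioi 0 hs)).const_mul (1 - s))
      hm.aestronglyMeasurable ?_
    filter_upwards [ae_restrict_mem measurableSet_Ioi] with t ht
    have := frullani_of_le_one h ht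
    rw [← norm_neg, Real.norm_of_nonneg this.1]
    simpa using this.2

theorem integral_frullani {s : ℝ} (hs : 0 < s) :
    ∫ t in Ioi (0 : ℝ), frullani s t = Real.log s := by
  have e : (fun t : ℝ => t⁻¹ • (Real.exp (-(1 * t)) - Real.exp (-(s * t)))) = frullani s := by
    ext t
    rw [frullani, one_mul, mul_comm s t, smul_eq_mul, div_eq_inv_mul]
  have h := Frullani.integral_Ioi_eq (f := fun t : ℝ => Real.exp (-t)) (a := 1) (b := s)
    (L := (1 : ℝ)) (R := (0 : ℝ))
    ((by fun_prop : Continuous fun t : ℝ => Real.exp (-t)).locallyIntegrable.locallyIntegrableOn _)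
    one_pos hs
    (by
      have : Tendsto (fun t : ℝ => Real.exp (-t)) (𝓝 0) (𝓝 (Real.exp (-0))) :=
        (by fun_prop : Continuous fun t : ℝ => Real.exp (-t)).tendsto 0
      rw [neg_zero, Real.exp_zero] at this
      exact this.mono_left nhdsWithin_le_nhds)
    (Real.tendsto_exp_neg_atTop_nhds_zero) (by rw [e]; exact integrableOn_frullani hs)
  rw [e] at h
  simpa using h

/-- `log S` is the integral of `(e^{-t} - e^{-tS}) / t` over `t > 0`, and Fubini exchanges it with
the mean. The power bounds on the Laplace transform at `0` and at `∞` give `S < ∞`, `S > 0` and the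
integrability for Fubini. The mean of `log S` thus depends only on the Laplace transform. -/
theorem integral_log_of_laplace {Ω : Type*} [MeasurableSpace Ω] {μ : Measure Ω}
    [IsProbabilityMeasure μ] {S : Ω → ℝ≥0∞} (hS : Measurable S) {ζ K : ℝ} (hζ : 0 < ζ)
    (h1 : ∀ t, 0 < t → 1 - ∫ ω, lap (ENNReal.ofReal t * S ω) ∂μ ≤ K * t ^ ζ)
    (h2 : ∀ t, 0 < t → ∫ ω, lap (ENNReal.ofReal t * S ω) ∂μ ≤ K * t ^ (-ζ)) :
    (∀ᵐ ω ∂μ, S ω ≠ 0 ∧ S ω ≠ ∞) ∧ Integrable (fun ω => Real.log (S ω).toReal) μ ∧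
      ∫ ω, Real.log (S ω).toReal ∂μ =
        ∫ t in Ioi (0 : ℝ), (Real.exp (-t) - ∫ ω, lap (ENNReal.ofReal t * S ω) ∂μ) / t := by
  have hlm : ∀ t : ℝ, Measurable fun ω => lap (ENNReal.ofReal t * S ω) := fun t => by fun_prop
  have hli : ∀ t : ℝ, Integrable (fun ω => lap (ENNReal.ofReal t * S ω)) μ := fun t =>
    Integrable.of_bound (hlm t).aestronglyMeasurable 1 (ae_of_all _ fun ω => by
      rw [Real.norm_of_nonneg (lap_nonneg _)]; exact lap_le_one _)
  have hS0 : MeasurableSet {ω | S ω = 0} := hS (measurableSet_singleton 0)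
  have hSt : MeasurableSet {ω | S ω = ∞} := hS (measurableSet_singleton ∞)
  -- Where `S = 0` the integrand `lap` is `1` for every `t`; the bound `h2` is used as `t → ∞`.
  have hzero : μ.real {ω | S ω = 0} = 0 := by
    have hle : ∀ t : ℝ, 0 < t → μ.real {ω | S ω = 0} ≤ K * t ^ (-ζ) := fun t ht => by
      refine le_trans ?_ (h2 t ht)
      rw [← integral_indicator_one hS0]
      refine integral_mono ((integrable_const 1).indicator hS0)
        (hli t) fun ω => ?_
      by_cases hω : S ω = 0
      · simp [indicator, hω]
      · simpa [indicator, hω] using lap_nonneg _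
    have hlim : Tendsto (fun t : ℝ => K * t ^ (-ζ)) atTop (𝓝 (K * 0)) :=
      (tendsto_rpow_neg_atTop hζ).const_mul K
    rw [mul_zero] at hlim
    refine le_antisymm (ge_of_tendsto hlim ?_) measureReal_nonneg
    filter_upwards [eventually_gt_atTop 0] with t ht using hle t ht
  -- Where `S = ∞` the integrand `lap` is `0` for every `t > 0`; the bound `h1` is used as `t → 0`.
  have htop : μ.real {ω | S ω = ∞} = 0 := by
    have hle : ∀ t : ℝ, 0 < t → μ.real {ω | S ω = ∞} ≤ K * t ^ ζ := fun t ht => by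
      refine le_trans ?_ (h1 t ht)
      have h3 : 1 - ∫ ω, lap (ENNReal.ofReal t * S ω) ∂μ =
          ∫ ω, (1 - lap (ENNReal.ofReal t * S ω)) ∂μ := by
        rw [integral_sub (integrable_const _) (hli t)]; simp
      rw [h3, ← integral_indicator_one hSt]
      refine integral_mono ((integrable_const 1).indicator hSt)
        ((integrable_const _).sub (hli t)) fun ω => ?_
      by_cases hω : S ω = ∞
      · simp [indicator, hω, ht]
      · simpa [indicator, hω] using lap_le_one _
    have hlim : Tendsto (fun t : ℝ => K * t ^ ζ) (𝓝[>] 0) (𝓝 (K * 0)) := by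
      refine Tendsto.const_mul K ?_
      have := (Real.continuousAt_rpow_const 0 ζ (Or.inr hζ.le)).tendsto
      rw [Real.zero_rpow hζ.ne'] at this
      exact this.mono_left nhdsWithin_le_nhds
    rw [mul_zero] at hlim
    refine le_antisymm (ge_of_tendsto hlim ?_) measureReal_nonneg
    filter_upwards [self_mem_nhdsWithin] with t ht using hle t ht
  have hae : ∀ᵐ ω ∂μ, S ω ≠ 0 ∧ S ω ≠ ∞ := by
    have h3 : ∀ᵐ ω ∂μ, S ω ≠ 0 := by
      rw [ae_iff]; simpa [measureReal_eq_zero_iff] using hzero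
    have h4 : ∀ᵐ ω ∂μ, S ω ≠ ∞ := by
      rw [ae_iff]; simpa [measureReal_eq_zero_iff] using htop
    exact h3.and h4
  refine ⟨hae, ?_⟩
  set s : Ω → ℝ := fun ω => (S ω).toReal with hs
  have hsm : Measurable s := hS.ennreal_toReal
  have hs0 : ∀ᵐ ω ∂μ, 0 < s ω := hae.mono fun ω hω => ENNReal.toReal_pos hω.1 hω.2
  have hlap : ∀ t : ℝ, 0 < t → ∀ᵐ ω ∂μ,
      lap (ENNReal.ofReal t * S ω) = Real.exp (-(t * s ω)) := fun t ht => by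
    filter_upwards [hae] with ω hω
    rw [lap_of_ne_top (ENNReal.mul_ne_top ENNReal.ofReal_ne_top hω.2), ENNReal.toReal_mul,
      ENNReal.toReal_ofReal ht.le]
  have hexp : ∀ t : ℝ, 0 < t → Integrable (fun ω => Real.exp (-(t * s ω))) μ := fun t ht =>
    (hli t).congr (hlap t ht)
  have hΦ : ∀ t : ℝ, 0 < t → ∫ ω, lap (ENNReal.ofReal t * S ω) ∂μ = ∫ ω, Real.exp (-(t * s ω)) ∂μ :=
    fun t ht => integral_congr_ae (hlap t ht)
  have hJm : Measurable fun p : Ω × ℝ => frullani (s p.1) p.2 :=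
    measurable_frullani.comp (by fun_prop : Measurable fun p : Ω × ℝ => (s p.1, p.2))
  have hJi : ∀ t : ℝ, 0 < t → Integrable (fun ω => frullani (s ω) t) μ := fun t ht =>
    ((integrable_const _).sub (hexp t ht)).div_const t
  have hint : Integrable (fun p : Ω × ℝ => frullani (s p.1) p.2)
      (μ.prod (volume.restrict (Ioi 0))) := by
    rw [integrable_prod_iff' hJm.aestronglyMeasurable]
    refine ⟨(ae_restrict_mem measurableSet_Ioi).mono fun t ht => hJi t ht, ?_⟩
    have hnm : Measurable fun t : ℝ => ∫ ω, ‖frullani (s ω) t‖ ∂μ :=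
      (hJm.norm.stronglyMeasurable.integral_prod_left (μ := μ)).measurable
    change IntegrableOn (fun t : ℝ => ∫ ω, ‖frullani (s ω) t‖ ∂μ) (Ioi 0)
    -- The mean of the modulus is at most `1 + K t^(ζ-1)` on `(0, 1]` and at most `e^{-t} + K
    -- t^(-ζ-1)` beyond.
    rw [← Ioc_union_Ioi_eq_Ioi (zero_le_one' ℝ)]
    refine IntegrableOn.union ?_ ?_
    · have hg : IntegrableOn (fun t : ℝ => 1 + K * t ^ (ζ - 1)) (Ioc 0 1) := by
        refine Integrable.add (by simp) (Integrable.const_mul ?_ K)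
        rw [← IntegrableOn, ← intervalIntegrable_iff_integrableOn_Ioc_of_le zero_le_one]
        exact intervalIntegral.intervalIntegrable_rpow' (by linarith)
      refine Integrable.mono' hg hnm.aestronglyMeasurable ?_
      filter_upwards [ae_restrict_mem measurableSet_Ioc] with t ht
      have ht0 : 0 < t := ht.1
      rw [Real.norm_of_nonneg (integral_nonneg fun _ => norm_nonneg _)]
      have hb : ∀ᵐ ω ∂μ, ‖frullani (s ω) t‖ ≤
          ((1 - Real.exp (-t)) + (1 - Real.exp (-(t * s ω)))) / t := by
        filter_upwards [hs0] with ω hω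
        rw [frullani, Real.norm_eq_abs, abs_div, abs_of_pos ht0]
        have e1 : Real.exp (-t) ≤ 1 := Real.exp_le_one_iff.2 (by linarith)
        have e2 : Real.exp (-(t * s ω)) ≤ 1 :=
          Real.exp_le_one_iff.2 (by have := mul_pos ht0 hω; linarith)
        gcongr
        rw [abs_le]; constructor <;> linarith
      refine (integral_mono_ae (hJi t ht0).norm (((integrable_const _).add
        ((integrable_const _).sub (hexp t ht0))).div_const t) hb).trans ?_
      simp only [Pi.add_apply, Pi.sub_apply]
      have hi := (integrable_const (μ := μ) (1 : ℝ)).sub (hexp t ht0)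
      simp only [Pi.sub_def] at hi
      rw [integral_div, integral_add (integrable_const _) hi,
        integral_sub (integrable_const _) (hexp t ht0), ← hΦ t ht0]
      simp only [integral_const, probReal_univ, one_smul]
      rw [div_le_iff₀ ht0, add_mul, mul_assoc, ← Real.rpow_add_one ht0.ne', sub_add_cancel]
      have := h1 t ht0
      have := (Real.add_one_le_exp (-t))
      linarith
    · have hg : IntegrableOn (fun t : ℝ => Real.exp (-t) + K * t ^ (-ζ - 1)) (Ioi 1) := by
        refine Integrable.add ?_ (Integrable.const_mul ?_ K)
        · simpa [IntegrableOn] using exp_neg_integrableOn_Ioi 1 one_pos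
        · exact integrableOn_Ioi_rpow_of_lt (by linarith) one_pos
      refine Integrable.mono' hg hnm.aestronglyMeasurable ?_
      filter_upwards [ae_restrict_mem measurableSet_Ioi] with t ht
      have ht1 : 1 < t := ht
      have ht0 : 0 < t := one_pos.trans ht
      rw [Real.norm_of_nonneg (integral_nonneg fun _ => norm_nonneg _)]
      have hb : ∀ ω, ‖frullani (s ω) t‖ ≤ (Real.exp (-t) + Real.exp (-(t * s ω))) / t := fun ω => by
        rw [frullani, Real.norm_eq_abs, abs_div, abs_of_pos ht0]
        have e1 := Real.exp_pos (-t)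
        have e2 := Real.exp_pos (-(t * s ω))
        gcongr
        rw [abs_le]; constructor <;> linarith
      refine (integral_mono (hJi t ht0).norm (((integrable_const _).add
        (hexp t ht0)).div_const t) hb).trans ?_
      simp only [Pi.add_apply]
      rw [integral_div, integral_add (integrable_const _) (hexp t ht0), ← hΦ t ht0]
      simp only [integral_const, probReal_univ, one_smul]
      rw [div_le_iff₀ ht0, add_mul, mul_assoc, ← Real.rpow_add_one ht0.ne', sub_add_cancel]
      have := h2 t ht0
      have := mul_le_mul_of_nonneg_left ht1.le (Real.exp_pos (-t)).le
      linarith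
  have hlog : ∀ᵐ ω ∂μ, ∫ t in Ioi (0 : ℝ), frullani (s ω) t = Real.log (s ω) :=
    hs0.mono fun ω hω => integral_frullani hω
  refine ⟨hint.integral_prod_left.congr hlog, ?_⟩
  rw [← integral_congr_ae hlog, integral_integral_swap hint]
  refine setIntegral_congr_fun measurableSet_Ioi fun t ht => ?_
  simp only [frullani]
  rw [integral_div, integral_sub (integrable_const _) (hexp t ht), hΦ t ht]
  simp


/-! ### The mean logarithm of the sum over the tree -/

variable {N : ℕ}

theorem val_zero_fun (L : List (ℝ × ℝ)) : val (fun _ : Fin N → ℝ => (0 : ℝ)) L = fun _ => 0 := by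
  induction L with
  | nil => rfl
  | cons p L ih =>
    ext x
    rw [val, ih, T, expMean_const]

theorem lip_zero {R : ℝ} (hR : 0 ≤ R) : Lip R fun _ : Fin N → ℝ => (0 : ℝ) := fun x h => by
  simpa using mul_nonneg hR (len_nonneg h)

theorem exp_neg_le_inv {x : ℝ} (hx : 0 < x) : Real.exp (-x) ≤ x⁻¹ := by
  rw [Real.exp_neg]
  exact inv_anti₀ hx (by linarith [Real.add_one_le_exp x])

/-- The logarithm of the sum over the tree is integrable, and its mean is given by the recursion,
up to a constant that does not depend on the function. -/
theorem integral_log_treeSum {R : ℝ} (hR : 0 ≤ R) {f : (Fin N → ℝ) → ℝ} (hf : Lip R f)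
    {L : List (ℝ × ℝ)} (hL : Increasing L) (a : ℝ) :
    (∀ᵐ w ∂flatLaw N, treeSum f a L 0 w ≠ 0 ∧ treeSum f a L 0 w ≠ ∞) ∧
      Integrable (fun w => Real.log (treeSum f a L 0 w).toReal) (flatLaw N) ∧
      ∫ w, Real.log (treeSum f a L 0 w).toReal ∂flatLaw N =
        ∫ w, Real.log (treeSum (fun _ => 0) a L 0 w).toReal ∂flatLaw N +
          ∫ z, val f L (a • z) ∂stdG N := by
  set ζ := headExp L with hζd
  set C := laplaceConst L with hCd
  have hζ : 0 < ζ := hL.headExp_pos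
  have hC : 0 < C := laplaceConst_pos hL
  -- the Laplace transform and its bounds
  have hpow : ∀ {t : ℝ} (X : ℝ), 0 < t → (t * Real.exp X) ^ ζ = t ^ ζ * Real.exp (ζ * X) :=
    fun X ht => by rw [Real.mul_rpow ht.le (Real.exp_pos _).le, ← Real.exp_mul, mul_comm X]
  -- From `1 - e^{-x} ≤ x` and `e^{-x} ≤ 1/x`, together with the finite exponential moments of `val
  -- f L`.
  have hbound : ∀ {f : (Fin N → ℝ) → ℝ}, Lip R f → ∃ K, ∀ t, 0 < t →
      1 - ∫ z, Real.exp (-(C * (t * Real.exp (val f L (a • z))) ^ ζ)) ∂stdG N ≤ K * t ^ ζ ∧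
      ∫ z, Real.exp (-(C * (t * Real.exp (val f L (a • z))) ^ ζ)) ∂stdG N ≤ K * t ^ (-ζ) := by
    intro f hf
    have hv : ExpInt (stdG N) fun z => val f L (a • z) := by
      simpa using (hf.val hL.nonneg).expInt 0 a
    have hvm : Measurable (val f L) := (hf.val hL.nonneg).continuous.measurable
    set A := ∫ z, Real.exp (ζ * val f L (a • z)) ∂stdG N with hA
    set B := ∫ z, Real.exp (-ζ * val f L (a • z)) ∂stdG N with hB
    have hA0 : 0 ≤ A := integral_nonneg fun _ => (Real.exp_pos _).le
    have hB0 : 0 ≤ B := integral_nonneg fun _ => (Real.exp_pos _).le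
    refine ⟨C * A + C⁻¹ * B, fun t ht => ?_⟩
    have htp := Real.rpow_pos_of_pos ht ζ
    have htn := Real.rpow_pos_of_pos ht (-ζ)
    have hpos : ∀ z, 0 < C * (t * Real.exp (val f L (a • z))) ^ ζ := fun z => by positivity
    have hi : Integrable (fun z => Real.exp (-(C * (t * Real.exp (val f L (a • z))) ^ ζ)))
        (stdG N) := by
      refine Integrable.of_bound (C := 1) ?_ (ae_of_all _ fun z => ?_)
      · exact (by fun_prop : Measurable fun z : Fin N → ℝ =>
          Real.exp (-(C * (t * Real.exp (val f L (a • z))) ^ ζ))).aestronglyMeasurable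
      · rw [Real.norm_of_nonneg (Real.exp_pos _).le, Real.exp_le_one_iff]
        linarith [hpos z]
    constructor
    · have e : 1 - ∫ z, Real.exp (-(C * (t * Real.exp (val f L (a • z))) ^ ζ)) ∂stdG N =
          ∫ z, (1 - Real.exp (-(C * (t * Real.exp (val f L (a • z))) ^ ζ))) ∂stdG N := by
        rw [integral_sub (integrable_const _) hi]; simp
      rw [e]
      calc _ ≤ ∫ z, (C * t ^ ζ) * Real.exp (ζ * val f L (a • z)) ∂stdG N := by
            refine integral_mono ((integrable_const _).sub hi) ((hv ζ).const_mul _) fun z => ?_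
            refine (one_sub_exp_neg_mem (hpos z).le).2.trans ?_
            rw [hpow _ ht, mul_assoc]
        _ = C * A * t ^ ζ := by rw [integral_const_mul]; ring
        _ ≤ _ := by gcongr; linarith [mul_nonneg (inv_pos.2 hC).le hB0]
    · calc _ ≤ ∫ z, (C⁻¹ * t ^ (-ζ)) * Real.exp (-ζ * val f L (a • z)) ∂stdG N := by
            refine integral_mono hi ((hv (-ζ)).const_mul _) fun z => ?_
            refine (exp_neg_le_inv (hpos z)).trans (le_of_eq ?_)
            rw [hpow _ ht, mul_inv, mul_inv, Real.rpow_neg ht.le, ← Real.exp_neg, neg_mul, mul_assoc]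
        _ = C⁻¹ * B * t ^ (-ζ) := by rw [integral_const_mul]; ring
        _ ≤ _ := by gcongr; linarith [mul_nonneg hC.le hA0]
  have hlap : ∀ {f : (Fin N → ℝ) → ℝ}, Lip R f → ∀ {t : ℝ}, 0 < t →
      ∫ w, lap (ENNReal.ofReal t * treeSum f a L 0 w) ∂flatLaw N =
        ∫ z, Real.exp (-(C * (t * Real.exp (val f L (a • z))) ^ ζ)) ∂stdG N := fun hf t ht => by
    simpa using integral_lap_treeSum hf L hL a 0 ht
  have hSm : ∀ {f : (Fin N → ℝ) → ℝ}, Lip R f → Measurable fun w => treeSum f a L 0 w :=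
    fun hf => (measurable_treeSum hf.continuous.measurable L a).comp measurable_prodMk_left
  have main : ∀ {f : (Fin N → ℝ) → ℝ}, Lip R f →
      (∀ᵐ w ∂flatLaw N, treeSum f a L 0 w ≠ 0 ∧ treeSum f a L 0 w ≠ ∞) ∧
      Integrable (fun w => Real.log (treeSum f a L 0 w).toReal) (flatLaw N) ∧
      ∫ w, Real.log (treeSum f a L 0 w).toReal ∂flatLaw N =
        ∫ t in Ioi (0 : ℝ), (Real.exp (-t) -
          ∫ z, Real.exp (-(C * (t * Real.exp (val f L (a • z))) ^ ζ)) ∂stdG N) / t := fun hf => by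
    obtain ⟨K, hK⟩ := hbound hf
    obtain ⟨h1, h2, h3⟩ := integral_log_of_laplace (hSm hf) (K := K) hζ
      (fun t ht => by rw [hlap hf ht]; exact (hK t ht).1)
      (fun t ht => by rw [hlap hf ht]; exact (hK t ht).2)
    refine ⟨h1, h2, h3.trans (setIntegral_congr_fun measurableSet_Ioi fun t ht => ?_)⟩
    rw [hlap hf ht]
  obtain ⟨h1, h2, h3⟩ := main hf
  obtain ⟨h1', h2', h3'⟩ := main (lip_zero hR)
  refine ⟨h1, h2, ?_⟩
  -- the sum has the law of the sum of the weights times an independent factor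
  set S : (Idx N → ℝ) × (Fin N → ℝ) → ℝ≥0∞ := fun p =>
    treeSum (fun _ => 0) a L 0 p.1 * ENNReal.ofReal (Real.exp (val f L (a • p.2))) with hS
  have hvm : Measurable (val f L) := (hf.val hL.nonneg).continuous.measurable
  have hSm' : Measurable S := ((hSm (lip_zero hR)).comp measurable_fst).mul (by fun_prop)
  have hSl : ∀ t : ℝ, 0 < t → ∫ p, lap (ENNReal.ofReal t * S p) ∂((flatLaw N).prod (stdG N)) =
      ∫ z, Real.exp (-(C * (t * Real.exp (val f L (a • z))) ^ ζ)) ∂stdG N := fun t ht => by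
    rw [integral_prod_symm]
    · refine integral_congr_ae (ae_of_all _ fun z => ?_)
      have := hlap (lip_zero (N := N) hR) (mul_pos ht (Real.exp_pos (val f L (a • z))))
      rw [val_zero_fun] at this
      simp only [Real.exp_zero, mul_one, integral_const, probReal_univ, one_smul,
        ENNReal.ofReal_mul ht.le] at this
      simp only [hS]
      rw [← this]
      refine integral_congr_ae (ae_of_all _ fun w => ?_)
      simp only
      congr 1
      ring
    · refine Integrable.of_bound (C := 1) ?_ (ae_of_all _ fun p => ?_)
      · exact (measurable_lap.comp (measurable_const.mul hSm')).aestronglyMeasurable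
      · rw [Real.norm_of_nonneg (lap_nonneg _)]; exact lap_le_one _
  obtain ⟨K, hK⟩ := hbound hf
  obtain ⟨-, -, h4⟩ := integral_log_of_laplace hSm' (K := K) hζ
    (fun t ht => by rw [hSl t ht]; exact (hK t ht).1)
    (fun t ht => by rw [hSl t ht]; exact (hK t ht).2)
  -- The two sums have the same Laplace transform by `hSl`, so Frullani's formula gives them the
  -- same mean logarithm.
  have h5 : ∫ p, Real.log (S p).toReal ∂((flatLaw N).prod (stdG N)) =
      ∫ w, Real.log (treeSum f a L 0 w).toReal ∂flatLaw N := by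
    rw [h4, h3]
    refine setIntegral_congr_fun measurableSet_Ioi fun t ht => ?_
    rw [hSl t ht]
  have hvi : Integrable (fun z => val f L (a • z)) (stdG N) := by
    have : ExpInt (stdG N) fun z => val f L (a • z) := by
      simpa using (hf.val hL.nonneg).expInt 0 a
    exact this.integrable
  have h6 : ∫ p, Real.log (S p).toReal ∂((flatLaw N).prod (stdG N)) =
      ∫ p, (Real.log (treeSum (fun _ => 0) a L 0 p.1).toReal + val f L (a • p.2))
        ∂((flatLaw N).prod (stdG N)) := by
    refine integral_congr_ae ?_
    filter_upwards [Measure.quasiMeasurePreserving_fst.ae h1'] with p hp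
    simp only [hS]
    rw [ENNReal.toReal_mul, ENNReal.toReal_ofReal (Real.exp_pos _).le,
      Real.log_mul (ENNReal.toReal_pos hp.1 hp.2).ne' (Real.exp_pos _).ne', Real.log_exp]
  rw [← h5, h6, integral_add (h2'.comp_fst _) (hvi.comp_snd _),
    integral_fun_fst (fun w => Real.log (treeSum (fun _ => 0) a L 0 w).toReal),
    integral_fun_snd (fun z => val f L (a • z))]
  simp

/-! ### The free energy of a measure of finite support -/

/-- The sum over the leaves, with the leaves indexed by functions. -/
theorem tsum_leaves_eq_treeSum (f : (Fin N → ℝ) → ℝ) (k : ℕ) (c δ : Fin k → ℝ) (a : ℝ)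
    (x : Fin N → ℝ) (w : Idx N → ℝ) :
    ∑' α : Fin k → ℕ, (∏ ℓ : Fin k, ENNReal.ofReal
        (poissonPoint (c ℓ) (toNoise w).1 (ancestor α ℓ) (α ℓ))) *
      ENNReal.ofReal (Real.exp (f (x + ∑ ℓ : Fin (k + 1),
        (Fin.cases (motive := fun _ => ℝ) a (fun j => √(2 * δ j)) ℓ) •
          fun i => (toNoise w).2 (ancestor α ℓ, i)))) =
      treeSum f a (List.ofFn fun ℓ => (c ℓ, δ ℓ)) x w := by
  induction k generalizing a x w with
  | zero =>
    rw [tsum_fintype]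
    simp [treeSum, ancestor, toNoise, rootVar, List.ofFn_zero]
  | succ k ih =>
    rw [List.ofFn_succ, treeSum]
    -- A leaf is a child of the root followed by a leaf of the subtree above that child.
    rw [← (Fin.consEquiv fun _ : Fin (k + 1) => ℕ).tsum_eq, ENNReal.tsum_prod']
    refine tsum_congr fun n => ?_
    rw [← ih, ← ENNReal.tsum_mul_left]
    refine tsum_congr fun α => ?_
    have hanc : ∀ ℓ : ℕ, ancestor (Fin.cons n α : Fin (k + 1) → ℕ) (ℓ + 1) = n :: ancestor α ℓ :=
      fun ℓ => by simp [ancestor, List.ofFn_succ]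
    have h0 : ancestor (Fin.cons n α : Fin (k + 1) → ℕ) 0 = [] := by simp [ancestor]
    have hcons : (Fin.consEquiv fun _ : Fin (k + 1) => ℕ) (n, α) = (Fin.cons n α : Fin (k + 1) → ℕ) :=
      rfl
    rw [hcons]
    rw [Fin.prod_univ_succ, mul_assoc]
    refine congrArg₂ (· * ·) ?_ (congrArg₂ (· * ·) ?_ ?_)
    · simp only [Fin.val_zero, h0, Fin.cons_zero]
      rfl
    · refine Finset.prod_congr rfl fun ℓ _ => ?_
      simp only [Fin.val_succ, hanc, Fin.cons_succ]
      rfl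
    · congr 3
      rw [Fin.sum_univ_succ]
      simp only [Fin.val_zero, h0, Fin.val_succ, hanc, Fin.cases_zero, Fin.cases_succ]
      rw [← add_assoc]
      congr 1
      rw [Fin.sum_univ_succ, Fin.sum_univ_succ]
      simp only [Fin.val_zero, Fin.val_succ, Fin.cases_zero, Fin.cases_succ]
      rfl

/-- The increments of the inverse temperature, with the parameters of the Poisson processes. -/
def Ladder.list (d : Ladder) : List (ℝ × ℝ) :=
  List.ofFn fun ℓ : Fin d.k => (d.ζ ℓ.castSucc.succ, d.incr ℓ.succ)

theorem Ladder.incr_nonneg (d : Ladder) (ℓ : Fin (d.k + 1)) : 0 ≤ d.incr ℓ := by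
  unfold Ladder.incr
  refine Fin.cases ?_ (fun j => ?_) ℓ
  · simp
  · simp only [Fin.cases_succ, sub_nonneg, NNReal.coe_le_coe]
    exact d.q_strictMono.monotone (Fin.castSucc_lt_succ (i := j)).le

theorem increasing_ofFn {k : ℕ} (c δ : Fin k → ℝ) (hc : StrictMono c) (h0 : ∀ ℓ, 0 < c ℓ)
    (h1 : ∀ ℓ, c ℓ < 1) (hδ : ∀ ℓ, 0 ≤ δ ℓ) : Increasing (List.ofFn fun ℓ => (c ℓ, δ ℓ)) := by
  induction k with
  | zero => rw [List.ofFn_zero]; trivial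
  | succ k ih =>
    rw [List.ofFn_succ]
    refine ⟨h0 0, ?_, hδ 0, ih _ _ (fun i j h => hc (Fin.succ_lt_succ_iff.2 h)) (fun _ => h0 _)
      (fun _ => h1 _) fun _ => hδ _⟩
    cases k with
    | zero => simpa [headExp] using h1 0
    | succ k => simpa [headExp, List.ofFn_succ] using hc (Fin.succ_pos 0)

theorem Ladder.increasing_list (d : Ladder) : Increasing d.list := by
  refine increasing_ofFn _ _ (fun i j h => d.ζ_strictMono ?_) (fun ℓ => ?_) (fun ℓ => ?_)
    fun ℓ => d.incr_nonneg _
  · simpa using h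
  · rw [← d.ζ_zero]; exact d.ζ_strictMono (Fin.succ_pos _)
  · rw [← d.ζ_last]
    refine d.ζ_strictMono ?_
    rw [Fin.lt_def]
    have := ℓ.2
    simp

theorem exp_field_eq (P : Measure (Fin N → ℝ)) [IsProbabilityMeasure P] {R : ℝ}
    (hP : ∀ᵐ σ ∂P, len σ ≤ R) (d : Ladder) (z : List ℕ × Fin N → ℝ) (α : Fin d.k → ℕ) :
    ∫⁻ σ, ENNReal.ofReal (Real.exp (field d z σ α -
        (d.q (Fin.last d.k) : ℝ) * ∑ i, σ i ^ 2)) ∂P =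
      ENNReal.ofReal (Real.exp (base P (d.q (Fin.last d.k)) (∑ ℓ : Fin (d.k + 1),
        √(2 * d.incr ℓ) • fun i => z (ancestor α ℓ, i)))) := by
  have e : ∀ σ : Fin N → ℝ, field d z σ α - (d.q (Fin.last d.k) : ℝ) * ∑ i, σ i ^ 2 =
      (∑ ℓ : Fin (d.k + 1), √(2 * d.incr ℓ) • fun i => z (ancestor α ℓ, i)) ⬝ᵥ σ -
        (d.q (Fin.last d.k) : ℝ) * (σ ⬝ᵥ σ) := fun σ => by
    rw [sum_dotProduct]
    simp_rw [smul_dotProduct]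
    simp only [field, smul_eq_mul, dotProduct, sq]
  simp_rw [e]
  rw [exp_base hP, ofReal_integral_eq_lintegral_ofReal]
  · simpa using expInt_base hP (d.q (Fin.last d.k)) (∑ ℓ : Fin (d.k + 1),
      √(2 * d.incr ℓ) • fun i => z (ancestor α ℓ, i)) 1
  · exact ae_of_all _ fun _ => (Real.exp_pos _).le

/-- The free energy as a logarithm of a ratio of sums over the tree. -/
theorem freeEnergy_eq (P : Measure (Fin N → ℝ)) [IsProbabilityMeasure P] {R : ℝ}
    (hP : ∀ᵐ σ ∂P, len σ ≤ R) (d : Ladder) (w : Idx N → ℝ) :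
    freeEnergy N P d (toNoise w) = -(1 / (N : ℝ)) * Real.log
      (treeSum (base P (d.q (Fin.last d.k))) √(2 * d.incr 0) d.list 0 w /
        treeSum (fun _ => 0) √(2 * d.incr 0) d.list 0 w).toReal := by
  have hcoef : ∀ ℓ : Fin (d.k + 1), Fin.cases (motive := fun _ => ℝ) √(2 * d.incr 0)
      (fun j => √(2 * d.incr j.succ)) ℓ = √(2 * d.incr ℓ) := fun ℓ => by
    refine Fin.cases ?_ (fun j => ?_) ℓ <;> simp
  rw [freeEnergy, Ladder.list, ← tsum_leaves_eq_treeSum, ← tsum_leaves_eq_treeSum]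
  simp only [hcoef, zero_add, Real.exp_zero, ENNReal.ofReal_one, mul_one]
  congr 3
  rw [lintegral_tsum]
  · have h : ∀ α : Fin d.k → ℕ, ∫⁻ σ, ENNReal.ofReal (Real.exp (field d (toNoise w).2 σ α -
        (d.q (Fin.last d.k) : ℝ) * ∑ i, σ i ^ 2)) * cascade d (toNoise w).1 α ∂P =
        ENNReal.ofReal (Real.exp (base P (d.q (Fin.last d.k)) (∑ ℓ : Fin (d.k + 1),
          √(2 * d.incr ℓ) • fun i => (toNoise w).2 (ancestor α ℓ, i)))) *
          cascade d (toNoise w).1 α := fun α => by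
      rw [lintegral_mul_const, exp_field_eq P hP]
      unfold field
      fun_prop
    simp_rw [h, cascade, leafWeight, div_eq_mul_inv, ← mul_assoc]
    rw [ENNReal.tsum_mul_right]
    congr 1
    exact tsum_congr fun α => mul_comm _ _
  · intro α
    unfold field
    exact (by fun_prop : Measurable _).aemeasurable

theorem measurable_freeEnergy (P : Measure (Fin N → ℝ)) [SFinite P] (d : Ladder) :
    Measurable (freeEnergy N P d) := by
  have h1 : ∀ α : Fin d.k → ℕ, Measurable fun e : List ℕ × ℕ → ℝ => leafWeight d e α := fun α => by
    unfold leafWeight poissonPoint arrival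
    fun_prop
  have h2 : ∀ α : Fin d.k → ℕ, Measurable fun e : List ℕ × ℕ → ℝ => cascade d e α := fun α =>
    (h1 α).div (Measurable.tsum h1)
  unfold freeEnergy
  refine measurable_const.mul (Real.measurable_log.comp (Measurable.ennreal_toReal ?_))
  refine Measurable.lintegral_prod_right' (f := fun p : Noise N × (Fin N → ℝ) =>
    ∑' α : Fin d.k → ℕ, ENNReal.ofReal (Real.exp (field d p.1.2 p.2 α -
      (d.q (Fin.last d.k) : ℝ) * ∑ i, p.2 i ^ 2)) * cascade d p.1.1 α) ?_
  refine Measurable.tsum fun α => Measurable.mul ?_ ((h2 α).comp (by fun_prop))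
  unfold field
  fun_prop

/-- The levels of a measure of finite support: the values of its distribution function, with the
lengths of the intervals on which they are taken. -/
def Ladder.levels (d : Ladder) : List (ℝ × ℝ) := (0, d.incr 0) :: d.list

/-- The free energy is a difference of logarithms of two tree sums over the same weights, so the
mean logarithm of the total weight cancels. The mean over the root Gaussian vector that remains is
the operator `T` with `m = 0`, the first of `d.levels`. -/
theorem integrable_freeEnergy_and_mean (P : Measure (Fin N → ℝ)) [IsProbabilityMeasure P] {R : ℝ}
    (hR : 0 ≤ R) (hP : ∀ᵐ σ ∂P, len σ ≤ R) (d : Ladder) :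
    Integrable (freeEnergy N P d) (noiseLaw N) ∧ meanFreeEnergy N P d =
      -(1 / (N : ℝ)) * val (base P (d.q (Fin.last d.k))) d.levels 0 := by
  have hf := (reg_base hR hP (d.q (Fin.last d.k))).lip
  obtain ⟨h1, h2, h3⟩ := integral_log_treeSum hR hf d.increasing_list √(2 * d.incr 0)
  obtain ⟨h1', h2', -⟩ := integral_log_treeSum hR (lip_zero (N := N) hR) d.increasing_list
    √(2 * d.incr 0)
  have hfm := (measurable_freeEnergy P d).aestronglyMeasurable (μ := noiseLaw N)
  have hae : (fun w => freeEnergy N P d (toNoise w)) =ᵐ[flatLaw N] fun w => -(1 / (N : ℝ)) *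
      (Real.log (treeSum (base P (d.q (Fin.last d.k))) √(2 * d.incr 0) d.list 0 w).toReal -
        Real.log (treeSum (fun _ => 0) √(2 * d.incr 0) d.list 0 w).toReal) := by
    filter_upwards [h1, h1'] with w hw hw'
    rw [freeEnergy_eq P hP, ENNReal.toReal_div, Real.log_div (ENNReal.toReal_pos hw.1 hw.2).ne'
      (ENNReal.toReal_pos hw'.1 hw'.2).ne']
  rw [meanFreeEnergy]
  rw [← flatLaw_map_toNoise] at hfm ⊢
  rw [integrable_map_measure hfm measurable_toNoise.aemeasurable,
    integral_map measurable_toNoise.aemeasurable hfm, integral_congr_ae hae]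
  refine ⟨((h2.sub h2').const_mul _).congr hae.symm, ?_⟩
  rw [integral_const_mul, integral_sub h2 h2', h3, Ladder.levels, val, T, expMean, if_pos rfl]
  simp

theorem Ladder.q_eq_sum (d : Ladder) (ℓ : Fin (d.k + 1)) :
    (d.q ℓ : ℝ) = ∑ j, if j ≤ ℓ then d.incr j else 0 := by
  induction ℓ using Fin.induction with
  | zero =>
    have : ∀ j : Fin (d.k + 1), (if j ≤ 0 then d.incr j else 0) = if j = 0 then d.incr j else 0 :=
      fun j => by simp
    simp_rw [this]
    simp [Ladder.incr]
  | succ i ih =>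
    have : ∀ j : Fin (d.k + 1), (if j ≤ i.succ then d.incr j else 0) =
        (if j ≤ i.castSucc then d.incr j else 0) + if j = i.succ then d.incr j else 0 := fun j => by
      by_cases h : j = i.succ
      · subst h
        simp
      · have : j ≤ i.succ ↔ j ≤ i.castSucc := by
          rw [Fin.le_castSucc_iff, lt_iff_le_and_ne]
          exact ⟨fun h' => ⟨h', h⟩, fun h' => h'.1⟩
        simp [h, this]
    simp_rw [this, Finset.sum_add_distrib]
    rw [← ih]
    simp [Ladder.incr]

theorem stepFun_ofFn {m : ℕ} (ζ : Fin (m + 1) → ℝ) (δ : Fin m → ℝ) (hδ : ∀ ℓ, 0 ≤ δ ℓ)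
    (h1 : ζ (Fin.last m) = 1) (r : ℝ) :
    stepFun (List.ofFn fun ℓ => (ζ ℓ.castSucc, δ ℓ)) r = ζ 0 + ∑ ℓ : Fin m,
      if (∑ j, if j ≤ ℓ then δ j else 0) ≤ r then ζ ℓ.succ - ζ ℓ.castSucc else 0 := by
  induction m generalizing r with
  | zero => simpa [stepFun] using h1.symm
  | succ m ih =>
    have hcs : ∀ ℓ : Fin m, (∑ j : Fin (m + 1), if j ≤ ℓ.succ then δ j else 0) =
        δ 0 + ∑ j : Fin m, if j ≤ ℓ then δ j.succ else 0 := fun ℓ => by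
      rw [Fin.sum_univ_succ]; simp
    have hc0 : (∑ j : Fin (m + 1), if j ≤ 0 then δ j else 0) = δ 0 := by
      rw [Fin.sum_univ_succ]; simp
    rw [List.ofFn_succ, stepFun, Fin.sum_univ_succ]
    simp only [hcs, hc0]
    have hs := ih (fun ℓ => ζ ℓ.succ) (fun ℓ => δ ℓ.succ) (fun _ => hδ _) (by simpa using h1)
      (r - δ 0)
    split_ifs with h h' h'
    · exact absurd h (not_lt.2 h')
    · rw [zero_add, Finset.sum_eq_zero, add_zero]
      · rfl
      · intro ℓ _
        rw [if_neg]
        rw [not_le]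
        have : 0 ≤ ∑ j : Fin m, if j ≤ ℓ then δ j.succ else 0 :=
          Finset.sum_nonneg fun j _ => by split_ifs <;> simp [hδ]
        linarith
    · simp only [Fin.castSucc_zero, Fin.succ_zero_eq_one, ← Fin.succ_castSucc] at hs ⊢
      rw [hs]
      simp only [le_sub_iff_add_le']
      ring
    · exact absurd (not_lt.1 h) h'

theorem Ladder.levels_eq (d : Ladder) :
    d.levels = List.ofFn fun ℓ => (d.ζ ℓ.castSucc, d.incr ℓ) := by
  rw [List.ofFn_succ, Ladder.levels, Ladder.list, Fin.castSucc_zero, d.ζ_zero]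
  rfl

theorem Ladder.total_levels (d : Ladder) : total d.levels = d.q (Fin.last d.k) := by
  rw [d.q_eq_sum, d.levels_eq, total, List.map_ofFn, List.sum_ofFn]
  exact Finset.sum_congr rfl fun j _ => by simp [Fin.le_last]

theorem Ladder.valid_levels (d : Ladder) : Valid d.levels := by
  intro p hp
  rw [d.levels_eq, List.mem_ofFn] at hp
  obtain ⟨ℓ, rfl⟩ := hp
  refine ⟨?_, ?_, d.incr_nonneg ℓ⟩
  · rw [← d.ζ_zero]; exact d.ζ_strictMono.monotone (Fin.zero_le _)
  · rw [← d.ζ_last]; exact d.ζ_strictMono.monotone (Fin.le_last _)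

/-- The step function of the levels is the distribution function. -/
theorem Ladder.stepFun_levels (d : Ladder) {r : ℝ} (hr : 0 ≤ r) :
    stepFun d.levels r = d.measure.real (Iic r.toNNReal) := by
  rw [d.levels_eq, stepFun_ofFn _ _ d.incr_nonneg d.ζ_last, d.ζ_zero, zero_add, measureReal_def,
    Ladder.measure, Measure.finsetSum_apply, ENNReal.toReal_sum]
  · refine Finset.sum_congr rfl fun ℓ _ => ?_
    rw [← d.q_eq_sum, Measure.smul_apply, Measure.dirac_apply' _ measurableSet_Iic, smul_eq_mul]
    have : (d.q ℓ : ℝ) ≤ r ↔ d.q ℓ ∈ Iic r.toNNReal := by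
      rw [mem_Iic, Real.le_toNNReal_iff_coe_le hr]
    have hz : 0 ≤ d.ζ ℓ.succ - d.ζ ℓ.castSucc :=
      sub_nonneg.2 (d.ζ_strictMono (Fin.castSucc_lt_succ (i := ℓ))).le
    by_cases h : d.q ℓ ∈ Iic r.toNNReal
    · rw [if_pos (this.2 h), indicator_of_mem h]
      simp [ENNReal.toReal_ofReal hz]
    · rw [if_neg fun h' => h (this.1 h'), indicator_of_notMem h]
      simp
  · intro ℓ _
    rw [Measure.smul_apply, smul_eq_mul]
    exact ENNReal.mul_ne_top ENNReal.ofReal_ne_top (measure_ne_top _ _)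


/-! ### The distance in terms of distribution functions -/

instance (μ : P1) : IsProbabilityMeasure μ.meas := μ.isProb

/-- The distribution function. -/
def dist1 (μ : Measure ℝ≥0) (r : ℝ) : ℝ := μ.real (Iic r.toNNReal)

section Cdf

variable (μ : Measure ℝ≥0) [IsProbabilityMeasure μ]

theorem dist1_mono : Monotone (dist1 μ) := fun _ _ h =>
  measureReal_mono (Iic_subset_Iic.2 (Real.toNNReal_mono h))

@[fun_prop]
theorem measurable_dist1 : Measurable (dist1 μ) := (dist1_mono μ).measurable

omit [IsProbabilityMeasure μ] in
theorem dist1_nonneg (r : ℝ) : 0 ≤ dist1 μ r := measureReal_nonneg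

theorem dist1_le_one (r : ℝ) : dist1 μ r ≤ 1 := measureReal_le_one

theorem lt_meas_iff {u : ℝ} (hu : 0 < u) (s : ℝ≥0) :
    ENNReal.ofReal u < μ (Iic s) ↔ u < dist1 μ s := by
  rw [dist1, Real.toNNReal_coe, measureReal_def, ENNReal.ofReal_lt_iff_lt_toReal hu.le
    (measure_ne_top _ _)]

theorem quantile_le {u r : ℝ} (hu : 0 < u) (hr : 0 ≤ r) (h : u < dist1 μ r) :
    (quantile μ u : ℝ) ≤ r := by
  have : quantile μ u ≤ r.toNNReal :=
    csInf_le (OrderBot.bddBelow _) ((lt_meas_iff μ hu _).2 (by rwa [Real.coe_toNNReal _ hr]))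
  exact (NNReal.coe_le_coe.2 this).trans_eq (Real.coe_toNNReal _ hr)

theorem exists_dist1_gt {u : ℝ} (hu : u < 1) : ∃ s : ℝ≥0, u < dist1 μ s := by
  have h1 : Tendsto (fun s : ℝ≥0 => μ (Iic s)) atTop (𝓝 (μ univ)) := tendsto_measure_Iic_atTop μ
  have h2 := (ENNReal.tendsto_toReal (measure_ne_top μ univ)).comp h1
  rw [measure_univ, ENNReal.toReal_one] at h2
  obtain ⟨s, hs⟩ := (h2.eventually (lt_mem_nhds hu)).exists
  exact ⟨s, by simpa [dist1, measureReal_def] using hs⟩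

theorem lt_dist1_of_quantile_lt {u r : ℝ} (hu : u ∈ Ioo (0 : ℝ) 1) (h : (quantile μ u : ℝ) < r) :
    u < dist1 μ r := by
  obtain ⟨s₀, hs₀⟩ := exists_dist1_gt μ hu.2
  have hne : {s : ℝ≥0 | ENNReal.ofReal u < μ (Iic s)}.Nonempty :=
    ⟨s₀, (lt_meas_iff μ hu.1 s₀).2 hs₀⟩
  have hr : 0 ≤ r := (NNReal.coe_nonneg _).trans h.le
  have h' : quantile μ u < r.toNNReal := by
    rwa [← NNReal.coe_lt_coe, Real.coe_toNNReal _ hr]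
  obtain ⟨s, hs, hsr⟩ := exists_lt_of_csInf_lt hne h'
  have := (lt_meas_iff μ hu.1 s).1 hs
  refine this.trans_le (dist1_mono μ ?_)
  rw [← Real.coe_toNNReal r hr]
  exact NNReal.coe_le_coe.2 hsr.le

end Cdf

theorem measurableSet_between {α : Type*} [MeasurableSpace α] {f g h : α → ℝ} (hf : Measurable f)
    (hg : Measurable g) (hh : Measurable h) :
    MeasurableSet {a | min (f a) (g a) ≤ h a ∧ h a < max (f a) (g a)} :=
  (measurableSet_le (hf.min hg) hh).inter (measurableSet_lt hh (hf.max hg))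

/-- A level `r` lies between the two quantiles of order `u`, up to the endpoints, when exactly one
of the two distribution functions exceeds `u` at `r`. -/
theorem edist_quantile (μ ν : Measure ℝ≥0) [IsProbabilityMeasure μ] [IsProbabilityMeasure ν] {u : ℝ}
    (hu : u ∈ Ioo (0 : ℝ) 1) :
    edist (quantile μ u) (quantile ν u) = ∫⁻ r in Ioi (0 : ℝ),
      {r | min (dist1 μ r) (dist1 ν r) ≤ u ∧ u < max (dist1 μ r) (dist1 ν r)}.indicator 1 r := by
  wlog h : quantile μ u ≤ quantile ν u generalizing μ ν
  · rw [edist_comm, this ν μ (le_of_not_ge h)]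
    simp_rw [min_comm, max_comm]
  have hm : MeasurableSet {r | min (dist1 μ r) (dist1 ν r) ≤ u ∧
      u < max (dist1 μ r) (dist1 ν r)} :=
    measurableSet_between (by fun_prop) (by fun_prop) (by fun_prop)
  have he : edist (quantile μ u) (quantile ν u) =
      ENNReal.ofReal ((quantile ν u : ℝ) - quantile μ u) := by
    rw [edist_comm, edist_dist, NNReal.dist_eq, abs_of_nonneg (sub_nonneg.2 (NNReal.coe_le_coe.2 h))]
  rw [lintegral_indicator_one hm, he, Measure.restrict_apply hm]
  -- The set of levels is squeezed between the open and the closed interval, which have the same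
  -- length; this avoids discussing the endpoints.
  have key1 : Ioo (quantile μ u : ℝ) (quantile ν u) ⊆ {r | min (dist1 μ r) (dist1 ν r) ≤ u ∧
      u < max (dist1 μ r) (dist1 ν r)} ∩ Ioi 0 := fun r hr => by
    have hr0 : 0 < r := (NNReal.coe_nonneg _).trans_lt hr.1
    refine ⟨⟨?_, ?_⟩, hr0⟩
    · refine (min_le_right _ _).trans (not_lt.1 fun h' => ?_)
      exact absurd (quantile_le ν hu.1 hr0.le h') (not_le.2 hr.2)
    · exact (lt_dist1_of_quantile_lt μ hu hr.1).trans_le (le_max_left _ _)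
  have key2 : {r | min (dist1 μ r) (dist1 ν r) ≤ u ∧ u < max (dist1 μ r) (dist1 ν r)} ∩ Ioi 0 ⊆
      Icc (quantile μ u : ℝ) (quantile ν u) := by
    rintro r ⟨⟨h1, h2⟩, hr⟩
    have hr0 : (0 : ℝ) < r := hr
    have h' : (quantile μ u : ℝ) ≤ quantile ν u := NNReal.coe_le_coe.2 h
    rcases min_le_iff.1 h1 with h1 | h1 <;> rcases lt_max_iff.1 h2 with h2 | h2
    · exact absurd h1 (not_le.2 h2)
    · have a1 := quantile_le ν hu.1 hr0.le h2
      have a2 : r ≤ quantile μ u := not_lt.1 fun h3 =>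
        absurd (lt_dist1_of_quantile_lt μ hu h3) (not_lt.2 h1)
      exact ⟨h'.trans a1, a2.trans h'⟩
    · have a1 := quantile_le μ hu.1 hr0.le h2
      have a2 : r ≤ quantile ν u := not_lt.1 fun h3 =>
        absurd (lt_dist1_of_quantile_lt ν hu h3) (not_lt.2 h1)
      exact ⟨a1, a2⟩
    · exact absurd h1 (not_le.2 h2)
  refine le_antisymm ?_ ?_
  · rw [← Real.volume_Ioo]; exact measure_mono key1
  · rw [← Real.volume_Icc]; exact measure_mono key2

theorem lintegral_indicator_between {a b : ℝ} (ha : a ∈ Icc (0 : ℝ) 1) (hb : b ∈ Icc (0 : ℝ) 1) :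
    ∫⁻ u in Ioo (0 : ℝ) 1, {u | min a b ≤ u ∧ u < max a b}.indicator 1 u =
      ENNReal.ofReal |a - b| := by
  have hs : {u | min a b ≤ u ∧ u < max a b} = Ico (min a b) (max a b) := rfl
  rw [hs, lintegral_indicator_one measurableSet_Ico, Measure.restrict_apply measurableSet_Ico,
    ← max_sub_min_eq_abs']
  refine le_antisymm ?_ ?_
  · rw [← Real.volume_Ico]; exact measure_mono inter_subset_left
  · rw [← Real.volume_Ioo]
    refine measure_mono fun u hu => ⟨⟨hu.1.le, hu.2⟩, ?_, ?_⟩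
    · exact (le_min ha.1 hb.1).trans_lt hu.1
    · exact hu.2.trans_le (max_le ha.2 hb.2)

/-- The area between the graphs of two monotone functions is the same measured horizontally or
vertically: Fubini applied to `edist_quantile`. -/
theorem edist_eq (μ ν : P1) :
    edist μ ν = ∫⁻ r in Ioi (0 : ℝ), ENNReal.ofReal |dist1 μ.meas r - dist1 ν.meas r| := by
  have h1 : edist μ ν = ∫⁻ u in Ioo (0 : ℝ) 1, edist (quantile μ.meas u) (quantile ν.meas u) := rfl
  rw [h1, setLIntegral_congr_fun measurableSet_Ioo fun u hu => edist_quantile μ.meas ν.meas hu,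
    lintegral_lintegral_swap]
  · refine lintegral_congr fun r => ?_
    exact lintegral_indicator_between ⟨dist1_nonneg _ r, dist1_le_one _ r⟩
      ⟨dist1_nonneg _ r, dist1_le_one _ r⟩
  · have hm : MeasurableSet {p : ℝ × ℝ | min (dist1 μ.meas p.2) (dist1 ν.meas p.2) ≤ p.1 ∧
        p.1 < max (dist1 μ.meas p.2) (dist1 ν.meas p.2)} :=
      measurableSet_between (by fun_prop) (by fun_prop) (by fun_prop)
    exact ((measurable_const (a := (1 : ℝ≥0∞))).indicator hm).aemeasurable

theorem lintegral_one_sub_dist1 (μ : P1) :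
    ∫⁻ r in Ioi (0 : ℝ), ENNReal.ofReal (1 - dist1 μ.meas r) = ∫⁻ s, (s : ℝ≥0∞) ∂μ.meas := by
  have h := lintegral_eq_lintegral_meas_lt μ.meas (f := fun s : ℝ≥0 => (s : ℝ))
    (ae_of_all _ fun s => s.2) (by fun_prop)
  simp only [ENNReal.ofReal_coe_nnreal] at h
  rw [h]
  refine setLIntegral_congr_fun measurableSet_Ioi fun r hr => ?_
  have hr0 : (0 : ℝ) < r := hr
  have e : {a : ℝ≥0 | r < (a : ℝ)} = (Iic r.toNNReal)ᶜ := by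
    ext a
    simp [Real.toNNReal_lt_iff_lt_coe hr0.le]
  rw [e, dist1, ← probReal_compl_eq_one_sub measurableSet_Iic, ofReal_measureReal]

theorem edist_ne_top' (μ ν : P1) : edist μ ν ≠ ∞ := by
  rw [edist_eq]
  have hb : ∀ r, ENNReal.ofReal |dist1 μ.meas r - dist1 ν.meas r| ≤
      ENNReal.ofReal (1 - dist1 μ.meas r) + ENNReal.ofReal (1 - dist1 ν.meas r) := fun r => by
    have h1 := dist1_le_one μ.meas r
    have h2 := dist1_le_one ν.meas r
    rw [← ENNReal.ofReal_add (by linarith) (by linarith)]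
    refine ENNReal.ofReal_le_ofReal ?_
    rw [abs_le]; constructor <;> linarith
  refine ne_top_of_le_ne_top ?_ (lintegral_mono hb)
  rw [lintegral_add_left (by fun_prop), lintegral_one_sub_dist1, lintegral_one_sub_dist1]
  exact (ENNReal.add_lt_top.2 ⟨μ.finite_moment, ν.finite_moment⟩).ne

theorem intervalIntegral_dist1_le (μ ν : P1) {Q : ℝ} (hQ : 0 ≤ Q) :
    ∫ r in (0 : ℝ)..Q, |dist1 μ.meas r - dist1 ν.meas r| ≤ (edist μ ν).toReal := by
  rw [intervalIntegral.integral_of_le hQ, integral_eq_lintegral_of_nonneg_ae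
    (ae_of_all _ fun _ => abs_nonneg _) (by fun_prop)]
  refine ENNReal.toReal_mono (edist_ne_top' μ ν) ?_
  rw [edist_eq]
  exact lintegral_mono_set Ioc_subset_Ioi_self

/-! ### Density of the measures of finite support -/

/-- The Wasserstein distance between the image of a measure under a map and the measure itself. -/
theorem edist_le_of_map (μ ν : P1) {τ : ℝ≥0 → ℝ≥0} (hτ : Measurable τ)
    (h : ν.meas = μ.meas.map τ) : edist μ ν ≤ ∫⁻ s, edist s (τ s) ∂μ.meas := by
  have hmM : MeasurableSet {p : ℝ × ℝ≥0 | min (p.2 : ℝ) (τ p.2) ≤ p.1 ∧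
      p.1 < max (p.2 : ℝ) (τ p.2)} :=
    measurableSet_between (by fun_prop) (by fun_prop) (by fun_prop)
  have hI : Measurable fun p : ℝ × ℝ≥0 => {p : ℝ × ℝ≥0 | min (p.2 : ℝ) (τ p.2) ≤ p.1 ∧
      p.1 < max (p.2 : ℝ) (τ p.2)}.indicator (1 : ℝ × ℝ≥0 → ℝ≥0∞) p :=
    (measurable_const (a := (1 : ℝ≥0∞))).indicator hmM
  have h1 : ∀ r : ℝ, 0 < r → ENNReal.ofReal |dist1 μ.meas r - dist1 ν.meas r| ≤
      ∫⁻ s, {p : ℝ × ℝ≥0 | min (p.2 : ℝ) (τ p.2) ≤ p.1 ∧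
        p.1 < max (p.2 : ℝ) (τ p.2)}.indicator (1 : ℝ × ℝ≥0 → ℝ≥0∞) (r, s) ∂μ.meas := fun r hr => by
    have hA : MeasurableSet (Iic r.toNNReal) := measurableSet_Iic
    have hB : MeasurableSet (τ ⁻¹' Iic r.toNNReal) := hτ measurableSet_Iic
    have e1 : dist1 ν.meas r = μ.meas.real (τ ⁻¹' Iic r.toNNReal) := by
      rw [dist1, h, map_measureReal_apply hτ measurableSet_Iic]
    have e2 : ∫⁻ s, {p : ℝ × ℝ≥0 | min (p.2 : ℝ) (τ p.2) ≤ p.1 ∧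
        p.1 < max (p.2 : ℝ) (τ p.2)}.indicator (1 : ℝ × ℝ≥0 → ℝ≥0∞) (r, s) ∂μ.meas =
        μ.meas {s : ℝ≥0 | min (s : ℝ) (τ s) ≤ r ∧ r < max (s : ℝ) (τ s)} := by
      rw [← lintegral_indicator_one (measurableSet_between (by fun_prop) (by fun_prop) (by fun_prop))]
      rfl
    rw [e1, e2, dist1]
    refine (ENNReal.ofReal_le_ofReal (abs_measureReal_sub_le_measureReal_symmDiff hA.nullMeasurableSet hB.nullMeasurableSet)).trans ?_
    rw [ofReal_measureReal]
    refine measure_mono fun s hs => ?_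
    have c1 : s ∈ Iic r.toNNReal ↔ (s : ℝ) ≤ r := Real.le_toNNReal_iff_coe_le hr.le
    have c2 : s ∈ τ ⁻¹' Iic r.toNNReal ↔ (τ s : ℝ) ≤ r := Real.le_toNNReal_iff_coe_le hr.le
    rcases hs with ⟨ha, hb⟩ | ⟨ha, hb⟩
    · exact ⟨(min_le_left _ _).trans (c1.1 ha), lt_max_of_lt_right (not_le.1 fun h' => hb (c2.2 h'))⟩
    · exact ⟨(min_le_right _ _).trans (c2.1 ha), lt_max_of_lt_left (not_le.1 fun h' => hb (c1.2 h'))⟩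
  rw [edist_eq]
  refine (setLIntegral_mono' measurableSet_Ioi fun r hr => h1 r hr).trans ?_
  rw [lintegral_lintegral_swap hI.aemeasurable]
  refine lintegral_mono fun s => ?_
  have hs : MeasurableSet {r : ℝ | min (s : ℝ) (τ s) ≤ r ∧ r < max (s : ℝ) (τ s)} := measurableSet_Ico
  have e3 : ∀ r : ℝ, {p : ℝ × ℝ≥0 | min (p.2 : ℝ) (τ p.2) ≤ p.1 ∧
      p.1 < max (p.2 : ℝ) (τ p.2)}.indicator (1 : ℝ × ℝ≥0 → ℝ≥0∞) (r, s) =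
      {r : ℝ | min (s : ℝ) (τ s) ≤ r ∧ r < max (s : ℝ) (τ s)}.indicator 1 r := fun r => rfl
  simp_rw [e3]
  rw [lintegral_indicator_one hs]
  refine (Measure.restrict_apply_le _ _).trans ?_
  change volume (Ico (min (s : ℝ) (τ s)) (max (s : ℝ) (τ s))) ≤ _
  rw [Real.volume_Ico, max_sub_min_eq_abs', edist_dist, NNReal.dist_eq]

/-- A probability measure carried by a finite set is the measure of a ladder. -/
theorem exists_ladder (ν : Measure ℝ≥0) [IsProbabilityMeasure ν] (s : Finset ℝ≥0)
    (hν : ν (s : Set ℝ≥0)ᶜ = 0) : ∃ d : Ladder, d.measure = ν := by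
  classical
  -- Points without mass are discarded, since the parameters `ζ` must increase strictly.
  set A : Finset ℝ≥0 := s.filter fun x => ν {x} ≠ 0 with hA
  have hsum : ∀ t : Set ℝ≥0, MeasurableSet t → ν t = ∑ x ∈ A, ν {x} * t.indicator 1 x := fun t ht => by
    have h1 : ν t = ν (t ∩ s) := by
      refine (measure_inter_conull' ?_).symm
      exact measure_mono_null (fun x hx => hx.2) hν
    have h2 : t ∩ s = ((s.filter fun x => x ∈ t : Finset ℝ≥0) : Set ℝ≥0) := by
      ext x; simp [and_comm]
    rw [h1, h2, ← sum_measure_singleton, Finset.sum_filter, hA, Finset.sum_filter]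
    refine Finset.sum_congr rfl fun x _ => ?_
    by_cases hx : x ∈ t <;> by_cases hz : ν {x} = 0 <;> simp [hx, hz]
  have htot : ∑ x ∈ A, ν {x} = 1 := by
    have := hsum univ MeasurableSet.univ
    simpa using this.symm
  have hne : A.card ≠ 0 := by
    intro h
    rw [Finset.card_eq_zero.1 h] at htot
    simp at htot
  obtain ⟨k, hk⟩ := Nat.exists_eq_succ_of_ne_zero hne
  set q : Fin (k + 1) ↪o ℝ≥0 := A.orderEmbOfFin hk with hq
  have hpos : ∀ ℓ, 0 < ν.real {q ℓ} := fun ℓ => by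
    have := A.orderEmbOfFin_mem hk ℓ
    replace this := (Finset.mem_filter.1 this)
    exact ENNReal.toReal_pos this.2 (measure_ne_top _ _)
  have hqsum : ∀ F : ℝ≥0 → ℝ≥0∞, ∑ ℓ, F (q ℓ) = ∑ x ∈ A, F x := fun F => by
    rw [← Finset.image_orderEmbOfFin_univ A hk, Finset.sum_image fun a _ b _ h => q.injective h]
  set ζ : Fin (k + 2) → ℝ := fun j => ∑ i : Fin (k + 1), if i.castSucc < j then ν.real {q i} else 0
    with hζ
  have hstep : ∀ ℓ : Fin (k + 1), ζ ℓ.succ - ζ ℓ.castSucc = ν.real {q ℓ} := fun ℓ => by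
    simp only [hζ]
    rw [← Finset.sum_sub_distrib, Finset.sum_eq_single ℓ]
    · simp
    · intro i _ hi
      have : i.castSucc < ℓ.succ ↔ i.castSucc < ℓ.castSucc := by
        simp only [Fin.castSucc_lt_succ_iff, Fin.castSucc_lt_castSucc_iff]
        exact ⟨fun h => lt_of_le_of_ne h hi, le_of_lt⟩
      simp [this]
    · simp
  refine ⟨⟨k, ζ, q, ?_, ?_, ?_, q.strictMono⟩, ?_⟩
  · rw [Fin.strictMono_iff_lt_succ]
    intro ℓ
    have := hpos ℓ
    have := hstep ℓ
    linarith
  · simp [hζ]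
  · simp only [hζ, Fin.castSucc_lt_last, if_true]
    have h1 : ∑ i, ν {q i} = 1 := (hqsum fun x => ν {x}).trans htot
    have h2 := congrArg ENNReal.toReal h1
    rw [ENNReal.toReal_sum fun i _ => measure_ne_top _ _] at h2
    simpa [measureReal_def] using h2
  · refine Measure.ext fun t ht => ?_
    rw [Ladder.measure, Measure.finsetSum_apply, hsum t ht]
    simp only [hstep]
    rw [← hqsum fun x => ν {x} * t.indicator 1 x]
    refine Finset.sum_congr rfl fun ℓ _ => ?_
    rw [Measure.smul_apply, Measure.dirac_apply' _ ht, smul_eq_mul, ofReal_measureReal]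

/-- Rounding down to a multiple of `1/(n+1)`, with truncation. -/
def roundDown (n : ℕ) (s : ℝ≥0) : ℝ≥0 := (min ⌊(n + 1) * s⌋₊ ((n + 1) * n) : ℕ) / (n + 1)

theorem measurable_roundDown (n : ℕ) : Measurable (roundDown n) := by
  unfold roundDown
  have h1 : Measurable fun s : ℝ≥0 => ⌊((n : ℝ≥0) + 1) * s⌋₊ :=
    Nat.measurable_floor.comp (by fun_prop)
  have h2 : Measurable fun m : ℕ => ((min m ((n + 1) * n) : ℕ) : ℝ≥0) / (n + 1) :=
    measurable_of_countable _
  exact h2.comp h1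

theorem roundDown_le (n : ℕ) (s : ℝ≥0) : roundDown n s ≤ s := by
  unfold roundDown
  rw [div_le_iff₀ (by positivity)]
  calc ((min ⌊(n + 1) * s⌋₊ ((n + 1) * n) : ℕ) : ℝ≥0) ≤ (⌊(n + 1) * s⌋₊ : ℝ≥0) :=
        Nat.cast_le.2 (min_le_left _ _)
    _ ≤ (n + 1) * s := Nat.floor_le (by positivity)
    _ = _ := mul_comm _ _

theorem edist_roundDown_le (n : ℕ) (s : ℝ≥0) (hn : s ≤ n) :
    edist s (roundDown n s) ≤ ENNReal.ofReal (1 / (n + 1)) := by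
  have h1 := roundDown_le n s
  rw [edist_dist, NNReal.dist_eq, abs_of_nonneg (sub_nonneg.2 (NNReal.coe_le_coe.2 h1))]
  refine ENNReal.ofReal_le_ofReal ?_
  have hle : ⌊(n + 1) * s⌋₊ ≤ (n + 1) * n := by
    have : ((n : ℝ≥0) + 1) * s ≤ (((n + 1) * n : ℕ) : ℝ≥0) := by push_cast; gcongr
    exact Nat.floor_le_of_le this
  unfold roundDown
  rw [min_eq_left hle]
  have h2 := (Nat.lt_floor_add_one (((n : ℝ≥0) + 1) * s)).le
  have h3 : ((n : ℝ) + 1) * s ≤ (⌊((n : ℝ≥0) + 1) * s⌋₊ : ℝ) + 1 := by exact_mod_cast h2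
  push_cast
  have hp : (0 : ℝ) < n + 1 := by positivity
  rw [sub_le_iff_le_add, ← add_div, le_div_iff₀ hp]
  linarith

theorem tendsto_lintegral_roundDown (μ : P1) :
    Tendsto (fun n => ∫⁻ s, edist s (roundDown n s) ∂μ.meas) atTop (𝓝 0) := by
  have h := tendsto_lintegral_of_dominated_convergence (μ := μ.meas)
    (F := fun n s => edist s (roundDown n s)) (f := fun _ => 0) (fun s : ℝ≥0 => (s : ℝ≥0∞))
    (fun n => measurable_id.edist (measurable_roundDown n))
    (fun n => ae_of_all _ fun s => ?_) μ.finite_moment.ne (ae_of_all _ fun s => ?_)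
  · simpa using h
  · beta_reduce
    have h1 := roundDown_le n s
    rw [edist_dist, NNReal.dist_eq, abs_of_nonneg (sub_nonneg.2 (NNReal.coe_le_coe.2 h1)),
      ← ENNReal.ofReal_coe_nnreal]
    exact ENNReal.ofReal_le_ofReal (sub_le_self _ (NNReal.coe_nonneg _))
  · have h1 : Tendsto (fun n : ℕ => ENNReal.ofReal (1 / ((n : ℝ) + 1))) atTop (𝓝 0) := by
      rw [← ENNReal.ofReal_zero]
      exact ENNReal.tendsto_ofReal tendsto_one_div_add_atTop_nhds_zero_nat
    refine tendsto_of_tendsto_of_tendsto_of_le_of_le' tendsto_const_nhds h1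
      (Eventually.of_forall fun _ => zero_le) ?_
    obtain ⟨m, hm⟩ := exists_nat_ge s
    filter_upwards [eventually_ge_atTop m] with n hn
    exact edist_roundDown_le n s (hm.trans (Nat.cast_le.2 hn))

/-- The image of `μ` under rounding down with truncation has finite support, and it is close to `μ`
because the displacement is dominated by the integrable function `s`. -/
theorem denseRange_toP1 : DenseRange Ladder.toP1 := by
  intro μ
  rw [EMetric.mem_closure_iff]
  intro ε hε
  obtain ⟨n, hn⟩ := ((tendsto_lintegral_roundDown μ).eventually (gt_mem_nhds hε)).exists
  have hτ := measurable_roundDown n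
  have : IsProbabilityMeasure (μ.meas.map (roundDown n)) :=
    Measure.isProbabilityMeasure_map hτ.aemeasurable
  set s : Finset ℝ≥0 := (Finset.range ((n + 1) * n + 1)).image fun m : ℕ => (m : ℝ≥0) / (n + 1)
    with hs
  have hmem : ∀ x, roundDown n x ∈ s := fun x => by
    rw [hs, Finset.mem_image]
    exact ⟨_, Finset.mem_range.2 (Nat.lt_succ_of_le (min_le_right _ _)), rfl⟩
  obtain ⟨d, hd⟩ := exists_ladder (μ.meas.map (roundDown n)) s
    (by
      rw [Measure.map_apply hτ s.measurableSet.compl]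
      have : roundDown n ⁻¹' (s : Set ℝ≥0)ᶜ = ∅ := by
        ext y
        simp [hmem y]
      rw [this, measure_empty])
  exact ⟨d.toP1, ⟨d, rfl⟩, (edist_le_of_map μ d.toP1 hτ hd).trans_lt hn⟩

/-! ### Extension of Lipschitz functions -/

/-- Existence is the extension of a real Lipschitz function from a subset; uniqueness is density. -/
theorem existsUnique_extension {ι : Type} {e : ι → P1} (he : DenseRange e) {f : ι → ℝ} {K : ℝ≥0}
    (hf : ∀ i j, |f i - f j| ≤ K * (edist (e i) (e j)).toReal) :
    ∃! G : P1 → ℝ, IsContinuousExtension e f G := by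
  classical
  let : PseudoMetricSpace P1 := PseudoEMetricSpace.toPseudoMetricSpace edist_ne_top'
  -- `e` need not be injective: one measure has many admissible `q` in `Bounded`. The Lipschitz
  -- bound makes `f` constant on the fibres, so the choice is immaterial.
  set f' : P1 → ℝ := fun x => if h : ∃ i, e i = x then f h.choose else 0 with hf'
  have hval : ∀ i, f' (e i) = f i := fun i => by
    have h : ∃ j, e j = e i := ⟨i, rfl⟩
    simp only [hf', dif_pos h]
    have := hf h.choose i
    rw [h.choose_spec, edist_self, ENNReal.toReal_zero, mul_zero] at this
    exact sub_eq_zero.1 (abs_nonpos_iff.1 this)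
  have hL : LipschitzOnWith K f' (range e) := by
    refine LipschitzOnWith.of_dist_le_mul ?_
    rintro _ ⟨i, rfl⟩ _ ⟨j, rfl⟩
    rw [hval, hval, Real.dist_eq]
    exact hf i j
  obtain ⟨g, hg, hgf⟩ := hL.extend_real
  refine ⟨g, ⟨hg.continuous, fun i => by rw [← hgf ⟨i, rfl⟩, hval]⟩, fun G hG => ?_⟩
  refine hG.1.ext_on he hg.continuous ?_
  rintro _ ⟨i, rfl⟩
  rw [hG.2, ← hgf ⟨i, rfl⟩, hval]

theorem continuousExtension_spec {ι : Type} {e : ι → P1} {f : ι → ℝ}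
    (h : ∃! G : P1 → ℝ, IsContinuousExtension e f G) :
    IsContinuousExtension e f (continuousExtension e f) := Classical.epsilon_spec h.exists

/-- A continuous function that is Lipschitz on a dense set is Lipschitz. -/
theorem abs_sub_le_of_dense {ι : Type} {e : ι → P1} (he : DenseRange e) {G : P1 → ℝ}
    (hG : Continuous G) {K : ℝ≥0} (hf : ∀ i j, |G (e i) - G (e j)| ≤ K * (edist (e i) (e j)).toReal)
    (μ ν : P1) : |G μ - G ν| ≤ K * (edist μ ν).toReal := by
  let : PseudoMetricSpace P1 := PseudoEMetricSpace.toPseudoMetricSpace edist_ne_top'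
  have hc : IsClosed {p : P1 × P1 | |G p.1 - G p.2| ≤ K * dist p.1 p.2} :=
    isClosed_le (by fun_prop) (by fun_prop)
  have := (he.prodMap he).induction_on (p := fun p : P1 × P1 => |G p.1 - G p.2| ≤ K * dist p.1 p.2)
    (μ, ν) hc fun i => hf i.1 i.2
  exact this


variable {N : ℕ}

/-! ### The averaged free energy is Lipschitz -/

section Bounded

variable {P : Measure (Fin N → ℝ)} [IsProbabilityMeasure P] {R : ℝ}

theorem val_base_levels (hP : ∀ᵐ σ ∂P, len σ ≤ R) (d : Ladder) {Q : ℝ}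
    (hQ : (d.q (Fin.last d.k) : ℝ) ≤ Q) :
    val (base P (d.q (Fin.last d.k))) d.levels =
      val (base P Q) (d.levels ++ [(1, Q - d.q (Fin.last d.k))]) := by
  rw [val_append]
  have := T_one_base hP (d.q (Fin.last d.k)) (sub_nonneg.2 hQ)
  rw [add_sub_cancel] at this
  rw [val, val, this]

/-- Appending an interval with value `1` brings both measures to the common endpoint `Q`, without
changing the value of `val` or the step function. The `L¹` estimate for `val` then applies and is
divided by `N`. -/
theorem abs_meanFreeEnergy_sub_le (hR : 0 ≤ R) (hP : ∀ᵐ σ ∂P, len σ ≤ R) (d d' : Ladder) :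
    |meanFreeEnergy N P d - meanFreeEnergy N P d'| ≤
      (R ^ 2 / N) * (edist d.toP1 d'.toP1).toReal := by
  set Q : ℝ := max (d.q (Fin.last d.k)) (d'.q (Fin.last d'.k)) with hQ
  have hQ0 : 0 ≤ Q := (NNReal.coe_nonneg _).trans (le_max_left _ _)
  have hv : ∀ d : Ladder, (d.q (Fin.last d.k) : ℝ) ≤ Q →
      Valid (d.levels ++ [(1, Q - d.q (Fin.last d.k))]) := fun d hd p hp => by
    rcases List.mem_append.1 hp with hp | hp
    · exact d.valid_levels p hp
    · rw [List.mem_singleton.1 hp]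
      exact ⟨zero_le_one, le_rfl, sub_nonneg.2 hd⟩
  have ht : ∀ d : Ladder, total (d.levels ++ [(1, Q - d.q (Fin.last d.k))]) = Q := fun d => by
    have := d.total_levels
    rw [total] at this ⊢
    rw [List.map_append, List.sum_append, this]
    simp
  have h1 : (d.q (Fin.last d.k) : ℝ) ≤ Q := le_max_left _ _
  have h2 : (d'.q (Fin.last d'.k) : ℝ) ≤ Q := le_max_right _ _
  have key := Reg.abs_val_sub_le hR (reg_base hR hP Q) (hv d h1) (hv d' h2)
    ((ht d).trans (ht d').symm) 0
  simp only [stepFun_append_one, ht] at key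
  rw [(integrable_freeEnergy_and_mean P hR hP d).2, (integrable_freeEnergy_and_mean P hR hP d').2,
    val_base_levels hP d h1, val_base_levels hP d' h2, ← mul_sub, abs_mul, abs_neg,
    abs_of_nonneg (by positivity : (0 : ℝ) ≤ 1 / N)]
  have h3 : ∫ r in (0 : ℝ)..Q, |stepFun d.levels r - stepFun d'.levels r| ≤
      (edist d.toP1 d'.toP1).toReal := by
    refine le_trans (le_of_eq ?_) (intervalIntegral_dist1_le d.toP1 d'.toP1 hQ0)
    refine intervalIntegral.integral_congr fun r hr => ?_
    rw [uIcc_of_le hQ0] at hr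
    rw [d.stepFun_levels hr.1, d'.stepFun_levels hr.1]
    rfl
  calc 1 / (N : ℝ) * _ ≤ 1 / (N : ℝ) * (R ^ 2 * (edist d.toP1 d'.toP1).toReal) := by
        gcongr
        exact key.trans (by gcongr)
    _ = _ := by ring

theorem existsUnique_meanFreeEnergy (hR : 0 ≤ R) (hP : ∀ᵐ σ ∂P, len σ ≤ R) :
    ∃! G : P1 → ℝ, IsContinuousExtension Ladder.toP1 (meanFreeEnergy N P) G :=
  existsUnique_extension denseRange_toP1 (K := ⟨R ^ 2 / N, by positivity⟩)
    (abs_meanFreeEnergy_sub_le hR hP)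

theorem fbarWellDefined_of_bounded (hR : 0 ≤ R) (hP : ∀ᵐ σ ∂P, len σ ≤ R) :
    FbarWellDefined N P :=
  ⟨fun d => (integrable_freeEnergy_and_mean P hR hP d).1, existsUnique_meanFreeEnergy hR hP⟩

theorem Fbar_spec (hR : 0 ≤ R) (hP : ∀ᵐ σ ∂P, len σ ≤ R) :
    IsContinuousExtension Ladder.toP1 (meanFreeEnergy N P) (Fbar N P) :=
  continuousExtension_spec (existsUnique_meanFreeEnergy hR hP)

theorem abs_Fbar_sub_le (hR : 0 ≤ R) (hP : ∀ᵐ σ ∂P, len σ ≤ R) (μ ν : P1) :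
    |Fbar N P μ - Fbar N P ν| ≤ (R ^ 2 / N) * (edist μ ν).toReal :=
  abs_sub_le_of_dense denseRange_toP1 (Fbar_spec hR hP).1 (K := ⟨R ^ 2 / N, by positivity⟩)
    (fun d d' => by
      rw [(Fbar_spec hR hP).2, (Fbar_spec hR hP).2]
      exact abs_meanFreeEnergy_sub_le hR hP d d') μ ν

end Bounded

/-! ### Product measures -/

theorem stdG_map_eval (i : Fin N) :
    MeasurePreserving (fun (z : Fin N → ℝ) (_ : Fin 1) => z i) (stdG N) (stdG 1) := by
  have h1 : MeasurePreserving (Function.eval i) (stdG N) (gaussianReal 0 1) :=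
    measurePreserving_eval (fun _ : Fin N => gaussianReal 0 1) i
  have h2 := (measurePreserving_funUnique (gaussianReal 0 1) (Fin 1)).symm
  exact h2.comp h1

theorem integral_stdG_prod (g : Fin N → ℝ → ℝ) :
    ∫ z, ∏ i, g i (z i) ∂stdG N = ∏ i, ∫ s, g i s ∂gaussianReal 0 1 :=
  integral_fintype_prod_eq_prod g

/-- The coordinates of the increment are independent, so the exponential moment of a sum over
coordinates is a product, and its logarithm is again a sum. -/
theorem T_sum {R : ℝ} {φ : (Fin 1 → ℝ) → ℝ} (hφ : Lip R φ) (m δ : ℝ) :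
    T m δ (fun x : Fin N → ℝ => ∑ i, φ fun _ => x i) = fun x => ∑ i, T m δ φ fun _ => x i := by
  have hm := hφ.continuous.measurable
  ext x
  set a := √(2 * δ) with ha
  have hmap : ∀ (i : Fin N) (g : (Fin 1 → ℝ) → ℝ), Measurable g →
      ∫ z, g (fun _ => z i) ∂stdG N = ∫ z, g z ∂stdG 1 := fun i g hg => by
    rw [← (stdG_map_eval i).map_eq, integral_map (stdG_map_eval i).measurable.aemeasurable
      hg.aestronglyMeasurable]
  by_cases h0 : m = 0
  · simp only [T, expMean, if_pos h0]
    rw [integral_finsetSum]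
    · exact Finset.sum_congr rfl fun i _ => hmap i (fun z => φ ((fun _ => x i) + a • z)) (by fun_prop)
    · intro i _
      exact (stdG_map_eval i).integrable_comp_of_integrable (hφ.expInt (fun _ => x i) a).integrable
  · simp only [T, expMean, if_neg h0]
    rw [← Finset.mul_sum]
    congr 1
    rw [← Real.log_prod fun i _ => (integral_exp_pos (hφ.expInt (fun _ => x i) a m)).ne']
    congr 1
    simp_rw [Finset.mul_sum, Real.exp_sum]
    refine (integral_stdG_prod fun i s =>
      Real.exp (m * φ ((fun _ => x i) + a • fun _ => s))).trans ?_
    refine Finset.prod_congr rfl fun i _ => ?_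
    rw [← hmap i (fun z => Real.exp (m * φ ((fun _ => x i) + a • z))) (by fun_prop)]
    have h1 := measurePreserving_eval (fun _ : Fin N => gaussianReal 0 1) i
    have hg : Measurable fun s : ℝ => Real.exp (m * φ ((fun _ => x i) + a • fun _ => s)) := by
      fun_prop
    have h2 := integral_map (μ := stdG N) h1.measurable.aemeasurable hg.aestronglyMeasurable
    rw [show (stdG N).map (Function.eval i) = gaussianReal 0 1 from h1.map_eq] at h2
    exact h2

theorem val_sum {R : ℝ} {φ : (Fin 1 → ℝ) → ℝ} (hφ : Lip R φ) (L : List (ℝ × ℝ))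
    (hL : ∀ p ∈ L, 0 ≤ p.1) :
    val (fun x : Fin N → ℝ => ∑ i, φ fun _ => x i) L = fun x => ∑ i, val φ L fun _ => x i := by
  induction L with
  | nil => rfl
  | cons p L ih =>
    have hL' : ∀ p ∈ L, 0 ≤ p.1 := fun p hp => hL p (List.mem_cons_of_mem _ hp)
    rw [val, ih hL', T_sum (hφ.val hL'), val]

theorem base_pi (ρ : Measure ℝ) [IsProbabilityMeasure ρ] {R : ℝ} (hρ : ∀ᵐ s ∂ρ, |s| ≤ R) (Q : ℝ) :
    base (Measure.pi fun _ : Fin N => ρ) Q = fun x =>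
      ∑ i, base (Measure.pi fun _ : Fin 1 => ρ) Q fun _ => x i := by
  have hlog : ∀ (M : ℕ) (x : Fin M → ℝ), base (Measure.pi fun _ : Fin M => ρ) Q x =
      ∑ i, Real.log (∫ s, Real.exp (x i * s - Q * s ^ 2) ∂ρ) := fun M x => by
    rw [base_eq_log, ← Real.log_prod]
    · congr 1
      rw [← integral_fintype_prod_eq_prod]
      refine integral_congr_ae (ae_of_all _ fun σ => ?_)
      beta_reduce
      rw [← Real.exp_sum, Finset.sum_sub_distrib, ← Finset.mul_sum]
      simp only [dotProduct, sq]
    · intro i _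
      refine (integral_exp_pos ?_).ne'
      refine Integrable.of_bound (C := Real.exp (|x i| * R + |Q| * R ^ 2)) (by fun_prop) ?_
      filter_upwards [hρ] with s hs
      rw [Real.norm_of_nonneg (Real.exp_pos _).le]
      refine Real.exp_le_exp.2 ((le_abs_self _).trans ((abs_sub _ _).trans ?_))
      rw [abs_mul, abs_mul, abs_pow]
      gcongr
  ext x
  rw [hlog]
  exact Finset.sum_congr rfl fun i _ => by rw [hlog]; simp

theorem ae_len_le_pi (ρ : Measure ℝ) [IsProbabilityMeasure ρ] {R : ℝ} (hR : 0 ≤ R)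
    (hρ : ∀ᵐ s ∂ρ, |s| ≤ R) : ∀ᵐ σ ∂(Measure.pi fun _ : Fin N => ρ), len σ ≤ √N * R := by
  have h1 : ∀ i : Fin N, ∀ᵐ σ ∂(Measure.pi fun _ : Fin N => ρ), |σ i| ≤ R := fun i =>
    (measurePreserving_eval (fun _ : Fin N => ρ) i).quasiMeasurePreserving.ae hρ
  filter_upwards [ae_all_iff.2 h1] with σ hσ
  refine abs_le_of_sq_le_sq' ?_ (by positivity) |>.2
  rw [len_sq, mul_pow, Real.sq_sqrt (Nat.cast_nonneg _), dotProduct]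
  calc ∑ i, σ i * σ i ≤ ∑ _i : Fin N, R ^ 2 := Finset.sum_le_sum fun i _ => by
        rw [← sq, ← sq_abs]; exact pow_le_pow_left₀ (abs_nonneg _) (hσ i) 2
    _ = N * R ^ 2 := by simp

theorem meanFreeEnergy_pi (ρ : Measure ℝ) [IsProbabilityMeasure ρ] {R : ℝ} (hR : 0 ≤ R)
    (hρ : ∀ᵐ s ∂ρ, |s| ≤ R) (hN : 1 ≤ N) (d : Ladder) :
    meanFreeEnergy N (Measure.pi fun _ : Fin N => ρ) d =
      -val (base (Measure.pi fun _ : Fin 1 => ρ) (d.q (Fin.last d.k))) d.levels 0 := by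
  have hlip := (reg_base (by positivity) (ae_len_le_pi (N := 1) ρ hR hρ) (d.q (Fin.last d.k))).lip
  rw [(integrable_freeEnergy_and_mean _ (by positivity) (ae_len_le_pi ρ hR hρ) d).2, base_pi ρ hρ,
    val_sum hlip _ fun p hp => (d.valid_levels p hp).1]
  have hN' : (N : ℝ) ≠ 0 := by positivity
  have e : (fun _ : Fin 1 => (0 : Fin N → ℝ)) = fun _ => 0 := rfl
  simp only [Pi.zero_apply, Finset.sum_const, Finset.card_univ, Fintype.card_fin, nsmul_eq_mul]
  rw [neg_mul, ← mul_assoc, one_div_mul_cancel hN', one_mul]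
  rfl

theorem Fbar_pi (ρ : Measure ℝ) [IsProbabilityMeasure ρ] {R : ℝ} (hR : 0 ≤ R)
    (hρ : ∀ᵐ s ∂ρ, |s| ≤ R) (hN : 1 ≤ N) :
    Fbar N (Measure.pi fun _ : Fin N => ρ) = Fbar 1 (Measure.pi fun _ : Fin 1 => ρ) := by
  -- Both sides extend functions on the ladders by the same choice, so equality on the ladders is
  -- enough.
  rw [Fbar, Fbar]
  congr 1
  ext d
  rw [meanFreeEnergy_pi ρ hR hρ hN, meanFreeEnergy_pi ρ hR hρ le_rfl]


/-! ### Polar coordinates -/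

theorem lintegral_polar {E : Type*} [NormedAddCommGroup E] [NormedSpace ℝ E] [MeasurableSpace E]
    [BorelSpace E] [FiniteDimensional ℝ E] [Nontrivial E] (μ : Measure E) [μ.IsAddHaarMeasure]
    {Φ : ℝ → ℝ≥0∞} {Ψ : E → ℝ≥0∞} (hΦ : Measurable Φ) (hΨ : Measurable Ψ) :
    ∫⁻ x, Φ ‖x‖ * Ψ (‖x‖⁻¹ • x) ∂μ =
      (∫⁻ r, Φ r ∂Measure.volumeIoiPow (Module.finrank ℝ E - 1)) * ∫⁻ u, Ψ u ∂μ.toSphere := by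
  have h0 : MeasurableSet ({0}ᶜ : Set E) := (measurableSet_singleton _).compl
  have h1 : ∫⁻ x, Φ ‖x‖ * Ψ (‖x‖⁻¹ • x) ∂μ =
      ∫⁻ x : ({0}ᶜ : Set E), Φ ‖x.1‖ * Ψ (‖x.1‖⁻¹ • x.1) ∂(μ.comap (↑)) := by
    rw [lintegral_subtype_comap h0 fun x => Φ ‖x‖ * Ψ (‖x‖⁻¹ • x), restrict_compl_singleton]
  rw [h1]
  have hm : Measurable fun p : Metric.sphere (0 : E) 1 × Ioi (0 : ℝ) => Φ p.2 * Ψ p.1 :=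
    (hΦ.comp (by fun_prop)).mul (hΨ.comp (by fun_prop))
  have h2 := (Measure.measurePreserving_homeomorphUnitSphereProd μ).lintegral_comp hm
  simp only [homeomorphUnitSphereProd_apply_snd_coe, homeomorphUnitSphereProd_apply_fst_coe] at h2
  rw [h2]
  simp_rw [mul_comm (Φ _)]
  rw [lintegral_prod_mul (f := fun u : Metric.sphere (0 : E) 1 => Ψ u)
    (g := fun r : Ioi (0 : ℝ) => Φ r) (hΨ.comp measurable_subtype_coe).aemeasurable
    (hΦ.comp measurable_subtype_coe).aemeasurable, mul_comm]

/-- The direction of a vector, scaled to the sphere of radius `√N`. -/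
def dir {N : ℕ} (x : Fin N → ℝ) : Fin N → ℝ := (√N * (len x)⁻¹) • x

@[fun_prop]
theorem measurable_dir {N : ℕ} : Measurable (dir (N := N)) := by
  have := measurable_len (N := N)
  unfold dir; fun_prop

variable {N : ℕ}

theorem norm_toLp (x : Fin N → ℝ) : ‖WithLp.toLp 2 x‖ = len x := by
  rw [EuclideanSpace.norm_eq, len]
  congr 1
  simp [dotProduct, sq]

theorem toSphere_univ_ne (hN : 1 ≤ N) :
    (volume : Measure (EuclideanSpace ℝ (Fin N))).toSphere univ ≠ 0 ∧
      (volume : Measure (EuclideanSpace ℝ (Fin N))).toSphere univ ≠ ∞ := by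
  have : Nonempty (Fin N) := ⟨⟨0, hN⟩⟩
  refine ⟨?_, measure_ne_top _ _⟩
  rw [Ne, Measure.measure_univ_eq_zero]
  exact Measure.toSphere_ne_zero _

theorem measurable_sphereMap : Measurable
    fun (x : Metric.sphere (0 : EuclideanSpace ℝ (Fin N)) 1) (i : Fin N) => √(N : ℝ) * x.1 i := by
  fun_prop

theorem isProbabilityMeasure_sphereLaw (hN : 1 ≤ N) : IsProbabilityMeasure (sphereLaw N) := by
  obtain ⟨h1, h2⟩ := toSphere_univ_ne hN
  unfold sphereLaw
  have : IsProbabilityMeasure (((volume : Measure (EuclideanSpace ℝ (Fin N))).toSphere univ)⁻¹ •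
      (volume : Measure (EuclideanSpace ℝ (Fin N))).toSphere) :=
    ⟨by rw [Measure.smul_apply, smul_eq_mul, ENNReal.inv_mul_cancel h1 h2]⟩
  exact Measure.isProbabilityMeasure_map measurable_sphereMap.aemeasurable

theorem ae_sphereLaw : ∀ᵐ σ ∂sphereLaw N, σ ⬝ᵥ σ = (N : ℝ) := by
  unfold sphereLaw
  rw [ae_map_iff measurable_sphereMap.aemeasurable
    (measurableSet_eq_fun (by fun_prop) measurable_const)]
  refine ae_of_all _ fun u => ?_
  have h : ‖u.1‖ = 1 := by simp
  have h2 : ∑ i, u.1 i ^ 2 = 1 := by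
    have := EuclideanSpace.norm_sq_eq u.1
    rw [h] at this
    simpa using this.symm
  have e : ∀ i, √(N : ℝ) * u.1 i * (√(N : ℝ) * u.1 i) = N * u.1 i ^ 2 := fun i => by
    rw [mul_mul_mul_comm, Real.mul_self_sqrt (Nat.cast_nonneg _), sq]
  simp only [dotProduct, e, ← Finset.mul_sum, h2, mul_one]

/-- The Gaussian density is radial, so in polar coordinates it is absorbed into the radial factor
and the direction keeps the uniform law. -/
theorem lintegral_len_dir (hN : 1 ≤ N) {Φ : ℝ → ℝ≥0∞} {Ψ : (Fin N → ℝ) → ℝ≥0∞}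
    (hΦ : Measurable Φ) (hΨ : Measurable Ψ) :
    ∫⁻ x, Φ (len x) * Ψ (dir x) ∂stdG N = (∫⁻ x, Φ (len x) ∂stdG N) * ∫⁻ σ, Ψ σ ∂sphereLaw N := by
  have : Nonempty (Fin N) := ⟨⟨0, hN⟩⟩
  set S := (volume : Measure (EuclideanSpace ℝ (Fin N))).toSphere with hS
  obtain ⟨h1, h2⟩ := toSphere_univ_ne hN
  set ρ : ℝ → ℝ≥0∞ := fun r => ENNReal.ofReal ((√(2 * Real.pi))⁻¹ ^ N * Real.exp (-(r ^ 2) / 2))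
    with hρ
  have hρm : Measurable ρ := by fun_prop
  set Ψ' : EuclideanSpace ℝ (Fin N) → ℝ≥0∞ := fun u => Ψ fun i => √N * u i with hΨ'
  have hΨm : Measurable Ψ' := hΨ.comp (by fun_prop)
  set A := ∫⁻ r, ρ r * Φ r ∂Measure.volumeIoiPow (Module.finrank ℝ (EuclideanSpace ℝ (Fin N)) - 1)
    with hA
  have key : ∀ {X : (Fin N → ℝ) → ℝ≥0∞}, Measurable X →
      ∫⁻ x, Φ (len x) * X (dir x) ∂stdG N = A * ∫⁻ u, X (fun i => √N * u.1 i) ∂S := by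
    intro X hX
    have hlm := measurable_len (N := N)
    have hd : Measurable fun x : Fin N → ℝ => ENNReal.ofReal (∏ i, gaussianPDFReal 0 1 (x i)) := by
      fun_prop
    have h3 := lintegral_withDensity_eq_lintegral_mul (volume : Measure (Fin N → ℝ)) hd
      (g := fun x => Φ (len x) * X (dir x)) ((hΦ.comp hlm).mul (hX.comp measurable_dir))
    rw [stdG_eq_withDensity, h3]
    rw [← (PiLp.volume_preserving_ofLp (Fin N)).lintegral_comp]
    · refine Eq.trans ?_ (lintegral_polar volume (hρm.mul hΦ)
        (hX.comp (by fun_prop : Measurable fun (u : EuclideanSpace ℝ (Fin N)) i => √N * u i)))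
      refine lintegral_congr fun x => ?_
      have hn : ‖x‖ = len x.ofLp := norm_toLp x.ofLp
      simp only [Pi.mul_apply, hρ, prod_gaussianPDFReal, hn, len_sq, mul_assoc, Function.comp]
      congr 3
      ext i
      simp [dir, mul_assoc]
    · exact (by fun_prop : Measurable fun x : Fin N → ℝ =>
        ENNReal.ofReal (∏ i, gaussianPDFReal 0 1 (x i))).mul
          ((hΦ.comp hlm).mul (hX.comp measurable_dir))
  -- The constant function identifies `A` times the total mass of the sphere with the radial
  -- Gaussian integral, so neither has to be computed.
  have hone := key (X := fun _ => 1) measurable_const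
  simp only [mul_one, lintegral_const, one_mul] at hone
  rw [key hΨ, hone, sphereLaw, lintegral_map hΨ measurable_sphereMap, lintegral_smul_measure,
    smul_eq_mul, mul_assoc, ← mul_assoc (S univ), ENNReal.mul_inv_cancel h1 h2, one_mul]

/-- The length and the direction of a standard Gaussian vector are independent. -/
theorem stdG_map_len_dir (hN : 1 ≤ N) :
    (stdG N).map (fun x => (len x, dir x)) = ((stdG N).map len).prod (sphereLaw N) := by
  have := isProbabilityMeasure_sphereLaw hN
  have hlm := measurable_len (N := N)
  refine (Measure.prod_eq fun s t hs ht => ?_).symm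
  rw [Measure.map_apply (hlm.prodMk measurable_dir) (hs.prod ht), Measure.map_apply hlm hs]
  have h := lintegral_len_dir hN (Φ := s.indicator 1) (Ψ := t.indicator 1)
    (measurable_const.indicator hs) (measurable_const.indicator ht)
  have e1 : ∀ x : Fin N → ℝ, s.indicator (1 : ℝ → ℝ≥0∞) (len x) * t.indicator 1 (dir x) =
      ((fun x => (len x, dir x)) ⁻¹' s ×ˢ t).indicator 1 x := fun x => by
    by_cases h1 : len x ∈ s <;> by_cases h2 : dir x ∈ t <;> simp [indicator, h1, h2]
  have e2 : ∀ x : Fin N → ℝ, s.indicator (1 : ℝ → ℝ≥0∞) (len x) =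
      (len ⁻¹' s).indicator (1 : (Fin N → ℝ) → ℝ≥0∞) x := fun x => rfl
  simp_rw [e1, e2] at h
  rwa [lintegral_indicator_one ((hlm.prodMk measurable_dir) (hs.prod ht)),
    lintegral_indicator_one (hlm hs), lintegral_indicator_one ht] at h

theorem integral_len_dir (hN : 1 ≤ N) {G : ℝ × (Fin N → ℝ) → ℝ} (hG : Measurable G)
    (hi : Integrable (fun x => G (len x, dir x)) (stdG N)) :
    ∫ x, G (len x, dir x) ∂stdG N = ∫ x, ∫ σ, G (len x, σ) ∂sphereLaw N ∂stdG N := by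
  have := isProbabilityMeasure_sphereLaw hN
  have hlm := measurable_len (N := N)
  have hm : Measurable fun x : Fin N → ℝ => (len x, dir x) := hlm.prodMk measurable_dir
  have hi' : Integrable G (((stdG N).map len).prod (sphereLaw N)) := by
    rw [← stdG_map_len_dir hN, integrable_map_measure hG.aestronglyMeasurable hm.aemeasurable]
    exact hi
  rw [← integral_map (f := G) hm.aemeasurable hG.aestronglyMeasurable, stdG_map_len_dir hN,
    integral_prod _ hi', integral_map hlm.aemeasurable]
  exact (StronglyMeasurable.integral_prod_right (f := fun (r : ℝ) (σ : Fin N → ℝ) => G (r, σ))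
    hG.stronglyMeasurable).aestronglyMeasurable

theorem len_smul_dir (hN : 1 ≤ N) {x : Fin N → ℝ} (hx : len x ≠ 0) :
    (len x / √N) • dir x = x := by
  have hN' : √(N : ℝ) ≠ 0 := (Real.sqrt_pos.2 (by positivity)).ne'
  rw [dir, smul_smul]
  have : len x / √N * (√N * (len x)⁻¹) = 1 := by field_simp
  rw [this, one_smul]

theorem ae_len_ne_zero (hN : 1 ≤ N) : ∀ᵐ x ∂stdG N, len x ≠ 0 := by
  have h : ∀ᵐ s ∂gaussianReal 0 1, s ≠ 0 := by
    have := nullSingletonClass_gaussianReal (μ := 0) (v := 1) one_ne_zero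
    rw [ae_iff]
    simp
  have i : Fin N := ⟨0, hN⟩
  filter_upwards [(measurePreserving_eval (fun _ : Fin N => gaussianReal 0 1)
    i).quasiMeasurePreserving.ae h] with x hx hl
  apply hx
  have h1 : x ⬝ᵥ x = 0 := by rw [← len_sq, hl]; ring
  exact congrFun (dotProduct_self_eq_zero.1 h1) i

theorem stdG_map_neg : (stdG N).map (fun x => -x) = stdG N := by
  have h := Measure.pi_map_pi (μ := fun _ : Fin N => gaussianReal 0 1) (f := fun _ (s : ℝ) => -s)
    (fun _ => measurable_neg.aemeasurable)
  simp only [gaussianReal_map_neg, neg_zero] at h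
  exact h

theorem sphereLaw_map_neg (hN : 1 ≤ N) : (sphereLaw N).map (fun x => -x) = sphereLaw N := by
  have := isProbabilityMeasure_sphereLaw hN
  have hlm := measurable_len (N := N)
  have h1 : (stdG N).map dir = sphereLaw N := by
    have := congrArg (Measure.map Prod.snd) (stdG_map_len_dir hN)
    rw [Measure.map_map measurable_snd (hlm.prodMk measurable_dir)] at this
    have hp : IsProbabilityMeasure ((stdG N).map len) :=
      Measure.isProbabilityMeasure_map hlm.aemeasurable
    refine Eq.trans this ?_
    rw [← Measure.snd, Measure.snd_prod]
  rw [← h1, Measure.map_map measurable_neg measurable_dir]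
  conv_rhs => rw [← stdG_map_neg, Measure.map_map measurable_dir measurable_neg]
  congr 1
  ext x i
  simp [dir, len]


variable {N : ℕ}

/-! ### The Laplace transform of the uniform measure on the sphere -/

/-- The Laplace transform of the uniform measure on the sphere. -/
def sphInt (N : ℕ) (x : Fin N → ℝ) : ℝ := ∫ σ, Real.exp (x ⬝ᵥ σ) ∂sphereLaw N

theorem ae_len_sphereLaw : ∀ᵐ σ ∂sphereLaw N, len σ ≤ √N := by
  filter_upwards [ae_sphereLaw] with σ hσ
  rw [len, hσ]

theorem integrable_exp_dot_sphereLaw (hN : 1 ≤ N) (x : Fin N → ℝ) :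
    Integrable (fun σ => Real.exp (x ⬝ᵥ σ)) (sphereLaw N) := by
  have := isProbabilityMeasure_sphereLaw hN
  simpa using expInt_base ae_len_sphereLaw 0 x 1

theorem sphInt_pos (hN : 1 ≤ N) (x : Fin N → ℝ) : 0 < sphInt N x := by
  have := isProbabilityMeasure_sphereLaw hN
  exact integral_exp_pos (integrable_exp_dot_sphereLaw hN x)

theorem base_zero_eq (hN : 1 ≤ N) (x : Fin N → ℝ) :
    base (sphereLaw N) 0 x = Real.log (sphInt N x) := by
  have := isProbabilityMeasure_sphereLaw hN
  rw [base_eq_log]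
  simp [sphInt]

theorem sphInt_eq_cosh (hN : 1 ≤ N) (x : Fin N → ℝ) :
    sphInt N x = ∫ σ, Real.cosh (x ⬝ᵥ σ) ∂sphereLaw N := by
  have h1 : ∫ σ, Real.exp (-(x ⬝ᵥ σ)) ∂sphereLaw N = sphInt N x := by
    rw [sphInt]
    conv_rhs => rw [← sphereLaw_map_neg hN]
    rw [integral_map measurable_neg.aemeasurable (by fun_prop)]
    simp
  have h2 : Integrable (fun σ => Real.exp (-(x ⬝ᵥ σ))) (sphereLaw N) := by
    simpa using integrable_exp_dot_sphereLaw hN (-x)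
  simp_rw [Real.cosh_eq]
  rw [integral_div, integral_add (integrable_exp_dot_sphereLaw hN x) h2, h1, ← sphInt]
  ring

/-- By the symmetry of the sphere the exponential may be replaced by `cosh`, which increases with
the modulus of its argument. Monotonicity along rays is what allows the radius to be frozen on a
thin shell. -/
theorem sphInt_mono (hN : 1 ≤ N) (x : Fin N → ℝ) {s t : ℝ} (hs : 0 ≤ s) (hst : s ≤ t) :
    sphInt N (s • x) ≤ sphInt N (t • x) := by
  have hi : ∀ y : Fin N → ℝ, Integrable (fun σ => Real.cosh (y ⬝ᵥ σ)) (sphereLaw N) := fun y => by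
    simp_rw [Real.cosh_eq]
    refine ((integrable_exp_dot_sphereLaw hN y).add ?_).div_const 2
    simpa using integrable_exp_dot_sphereLaw hN (-y)
  rw [sphInt_eq_cosh hN, sphInt_eq_cosh hN]
  refine integral_mono (hi _) (hi _) fun σ => ?_
  simp only [smul_dotProduct, smul_eq_mul]
  rw [Real.cosh_le_cosh, abs_mul, abs_mul, abs_of_nonneg hs, abs_of_nonneg (hs.trans hst)]
  gcongr

theorem one_le_sphInt (hN : 1 ≤ N) (x : Fin N → ℝ) : 1 ≤ sphInt N x := by
  have := isProbabilityMeasure_sphereLaw hN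
  have h := sphInt_mono hN x le_rfl zero_le_one
  simpa [sphInt] using h

/-- The shell on which the standard Gaussian measure concentrates. -/
def shell (N : ℕ) (ε : ℝ) : Set (Fin N → ℝ) := {z | |z ⬝ᵥ z - N| ≤ ε * N}

theorem measurableSet_shell (ε : ℝ) : MeasurableSet (shell N ε) :=
  measurableSet_le (by fun_prop) measurable_const

theorem tendsto_shell {ε : ℝ} (hε : 0 < ε) :
    Tendsto (fun N : ℕ => (stdG N).real (shell N ε)) atTop (𝓝 1) := by
  have h := (tendsto_stdG_concentration hε).const_sub 1
  rw [sub_zero] at h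
  refine tendsto_of_tendsto_of_tendsto_of_le_of_le h tendsto_const_nhds (fun N => ?_)
    fun N => measureReal_le_one
  beta_reduce
  rw [sub_le_comm, ← probReal_compl_eq_one_sub (measurableSet_shell ε)]
  refine measureReal_mono fun z hz => ?_
  exact (not_le.1 (show ¬|z ⬝ᵥ z - N| ≤ ε * N from hz)).le

theorem mem_shell_iff {ε : ℝ} {z : Fin N → ℝ} :
    z ∈ shell N ε ↔ (1 - ε) * N ≤ z ⬝ᵥ z ∧ z ⬝ᵥ z ≤ (1 + ε) * N := by
  change |z ⬝ᵥ z - N| ≤ ε * N ↔ _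
  rw [abs_le]
  constructor <;> rintro ⟨h1, h2⟩ <;> constructor <;> linarith

theorem sqrt_le_len_div (hN : 1 ≤ N) {ε : ℝ} {z : Fin N → ℝ} (hz : z ∈ shell N ε) :
    √(1 - ε) ≤ len z / √N ∧ len z / √N ≤ √(1 + ε) := by
  have hN' : (0 : ℝ) < N := by positivity
  rw [mem_shell_iff] at hz
  rw [len, ← Real.sqrt_div (dot_self_nonneg z)]
  exact ⟨Real.sqrt_le_sqrt ((le_div_iff₀ hN').2 hz.1), Real.sqrt_le_sqrt ((div_le_iff₀ hN').2 hz.2)⟩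

/-- Length and direction of a Gaussian vector are independent. Membership in the shell depends only
on the length, so the direction can be averaged first. -/
theorem integral_shell_exp_dot (hN : 1 ≤ N) (ε : ℝ) (x : Fin N → ℝ) :
    ∫ y in shell N ε, Real.exp (x ⬝ᵥ y) ∂stdG N =
      ∫ y in shell N ε, sphInt N ((len y / √N) • x) ∂stdG N := by
  set A : Set ℝ := {r | |r ^ 2 - N| ≤ ε * N} with hA
  have hAm : MeasurableSet A := measurableSet_le (by fun_prop) measurable_const
  have hmem : ∀ y : Fin N → ℝ, len y ∈ A ↔ y ∈ shell N ε := fun y => by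
    simp [hA, shell, len_sq]
  set G : ℝ × (Fin N → ℝ) → ℝ := fun p =>
    A.indicator 1 p.1 * Real.exp ((p.1 / √N) * (x ⬝ᵥ p.2)) with hG
  have hGm : Measurable G :=
    ((measurable_const.indicator hAm).comp measurable_fst).mul (by fun_prop)
  have hlm := measurable_len (N := N)
  have h1 : ∀ᵐ y ∂stdG N, G (len y, dir y) = (shell N ε).indicator (fun y => Real.exp (x ⬝ᵥ y)) y := by
    filter_upwards [ae_len_ne_zero hN] with y hy
    have e : len y / √N * (x ⬝ᵥ dir y) = x ⬝ᵥ y := by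
      conv_rhs => rw [← len_smul_dir hN hy, dotProduct_smul, smul_eq_mul]
    simp only [hG, e]
    by_cases h : y ∈ shell N ε
    · simp [indicator, (hmem y).2 h, h]
    · simp [indicator, mt (hmem y).1 h, h]
  have hi : Integrable (fun y => Real.exp (x ⬝ᵥ y)) (stdG N) := by
    refine Integrable.mono' (integrable_exp_len (len x)) (by fun_prop) (ae_of_all _ fun y => ?_)
    rw [Real.norm_of_nonneg (Real.exp_pos _).le]
    exact Real.exp_le_exp.2 ((le_abs_self _).trans (abs_dot_le x y))
  have h2 := integral_len_dir hN hGm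
    ((hi.indicator (measurableSet_shell ε)).congr (h1.mono fun y hy => hy.symm))
  rw [integral_congr_ae h1, integral_indicator (measurableSet_shell ε)] at h2
  rw [h2, ← integral_indicator (measurableSet_shell ε)]
  refine integral_congr_ae (ae_of_all _ fun y => ?_)
  simp only [hG]
  rw [integral_const_mul]
  have e : ∀ σ : Fin N → ℝ, len y / √N * (x ⬝ᵥ σ) = ((len y / √N) • x) ⬝ᵥ σ := fun σ => by
    rw [smul_dotProduct, smul_eq_mul]
  simp_rw [e]
  by_cases h : y ∈ shell N ε
  · simp [indicator, (hmem y).2 h, h, sphInt]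
  · simp [indicator, mt (hmem y).1 h, h]

theorem integrable_shell_exp_dot (ε : ℝ) (x : Fin N → ℝ) :
    IntegrableOn (fun y => Real.exp (x ⬝ᵥ y)) (shell N ε) (stdG N) := by
  refine Integrable.integrableOn ?_
  refine Integrable.mono' (integrable_exp_len (len x)) (by fun_prop) (ae_of_all _ fun y => ?_)
  rw [Real.norm_of_nonneg (Real.exp_pos _).le]
  exact Real.exp_le_exp.2 ((le_abs_self _).trans (abs_dot_le x y))

theorem measurable_sphInt : Measurable (sphInt N) := by
  unfold sphInt
  by_cases hN : 1 ≤ N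
  · have := isProbabilityMeasure_sphereLaw hN
    exact (StronglyMeasurable.integral_prod_right (f := fun x σ : Fin N → ℝ => Real.exp (x ⬝ᵥ σ))
      (by fun_prop : Measurable fun p : (Fin N → ℝ) × (Fin N → ℝ) =>
        Real.exp (p.1 ⬝ᵥ p.2)).stronglyMeasurable).measurable
  · obtain rfl : N = 0 := by omega
    exact measurable_of_countable _

theorem integrableOn_sphInt (hN : 1 ≤ N) (ε : ℝ) (x : Fin N → ℝ) :
    IntegrableOn (fun y => sphInt N ((len y / √N) • x)) (shell N ε) (stdG N) := by
  have hlm := measurable_len (N := N)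
  refine Measure.integrableOn_of_bounded (M := sphInt N (√(1 + ε) • x)) (measure_ne_top _ _)
    (measurable_sphInt.comp (by fun_prop)).aestronglyMeasurable ?_
  filter_upwards [ae_restrict_mem (measurableSet_shell ε)] with y hy
  rw [Real.norm_of_nonneg (sphInt_pos hN _).le]
  exact sphInt_mono hN x (div_nonneg (len_nonneg y) (Real.sqrt_nonneg _)) (sqrt_le_len_div hN hy).2

theorem le_integral_shell (hN : 1 ≤ N) (ε : ℝ) (x : Fin N → ℝ) :
    (stdG N).real (shell N ε) * sphInt N (√(1 - ε) • x) ≤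
      ∫ y in shell N ε, Real.exp (x ⬝ᵥ y) ∂stdG N := by
  rw [integral_shell_exp_dot hN, ← smul_eq_mul, ← setIntegral_const]
  exact setIntegral_mono_on (integrable_const _) (integrableOn_sphInt hN ε x)
    (measurableSet_shell ε) fun y hy =>
      sphInt_mono hN x (Real.sqrt_nonneg _) (sqrt_le_len_div hN hy).1

theorem integral_shell_le (hN : 1 ≤ N) (ε : ℝ) (x : Fin N → ℝ) :
    ∫ y in shell N ε, Real.exp (x ⬝ᵥ y) ∂stdG N ≤ sphInt N (√(1 + ε) • x) := by
  rw [integral_shell_exp_dot hN]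
  calc _ ≤ ∫ y in shell N ε, sphInt N (√(1 + ε) • x) ∂stdG N :=
        setIntegral_mono_on (integrableOn_sphInt hN ε x) (integrable_const _)
          (measurableSet_shell ε) fun y hy =>
            sphInt_mono hN x (div_nonneg (len_nonneg y) (Real.sqrt_nonneg _)) (sqrt_le_len_div hN hy).2
    _ ≤ _ := by
        rw [setIntegral_const, smul_eq_mul]
        exact mul_le_of_le_one_left (sphInt_pos hN _).le measureReal_le_one

/-- The mass that a Gaussian measure with mean `b⁻¹ x` and variance `b⁻¹` gives to the shell. -/
def shellMass (N : ℕ) (ε b : ℝ) (x : Fin N → ℝ) : ℝ :=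
  ∫ z, (shell N ε).indicator 1 (b⁻¹ • x + (√b)⁻¹ • z) ∂stdG N

theorem shellMass_nonneg (ε b : ℝ) (x : Fin N → ℝ) : 0 ≤ shellMass N ε b x :=
  integral_nonneg fun _ => indicator_nonneg (fun _ _ => zero_le_one) _

theorem measurable_shell_indicator (ε : ℝ) :
    Measurable ((shell N ε).indicator (1 : (Fin N → ℝ) → ℝ)) :=
  measurable_const.indicator (measurableSet_shell ε)

theorem shell_indicator_le (ε : ℝ) (x : Fin N → ℝ) :
    (shell N ε).indicator (1 : (Fin N → ℝ) → ℝ) x ≤ 1 :=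
  indicator_le_self' (fun _ _ => zero_le_one) x

theorem integrable_shell_indicator {Ω : Type*} [MeasurableSpace Ω] {μ : Measure Ω}
    [IsFiniteMeasure μ] {g : Ω → Fin N → ℝ} (hg : Measurable g) (ε : ℝ) :
    Integrable (fun ω => (shell N ε).indicator (1 : (Fin N → ℝ) → ℝ) (g ω)) μ := by
  refine Integrable.of_bound ((measurable_shell_indicator ε).comp hg).aestronglyMeasurable 1
    (ae_of_all _ fun ω => ?_)
  have h0 : 0 ≤ (shell N ε).indicator (1 : (Fin N → ℝ) → ℝ) (g ω) :=
    indicator_nonneg (fun _ _ => zero_le_one) _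
  rw [Real.norm_of_nonneg h0]
  exact shell_indicator_le ε _

theorem shellMass_le_one (ε b : ℝ) (x : Fin N → ℝ) : shellMass N ε b x ≤ 1 := by
  refine (integral_mono (integrable_shell_indicator (by fun_prop) ε) (integrable_const 1)
    fun z => shell_indicator_le ε _).trans ?_
  simp

/-- The quadratic tilt changes the standard Gaussian into the one with mean `b⁻¹ x` and variance
`b⁻¹`. The prefactor is the normalization `b^(-N/2) exp (|x|²/(2b))`. -/
theorem integral_shell_tilt (ε : ℝ) {b : ℝ} (hb : 0 < b) (x : Fin N → ℝ) :
    ∫ y in shell N ε, Real.exp (x ⬝ᵥ y - (b - 1) * (y ⬝ᵥ y) / 2) ∂stdG N =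
      Real.exp (-(N * (Real.log b / 2)) + x ⬝ᵥ x / (2 * b)) * shellMass N ε b x := by
  rw [← integral_indicator (measurableSet_shell ε)]
  have e : ∀ y, (shell N ε).indicator (fun y => Real.exp (x ⬝ᵥ y - (b - 1) * (y ⬝ᵥ y) / 2)) y =
      Real.exp (x ⬝ᵥ y - (b - 1) * (y ⬝ᵥ y) / 2) * (shell N ε).indicator 1 y := fun y => by
    by_cases h : y ∈ shell N ε <;> simp [h]
  simp_rw [e]
  rw [integral_stdG_square hb, Real.exp_add, shellMass]
  congr 2
  rw [← Real.exp_log (inv_pos.2 (Real.sqrt_pos.2 hb)), ← Real.exp_nat_mul, Real.log_inv,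
    Real.log_sqrt hb.le]
  congr 1
  ring

theorem integrable_shell_tilt (ε b : ℝ) (x : Fin N → ℝ) :
    IntegrableOn (fun y => Real.exp (x ⬝ᵥ y - (b - 1) * (y ⬝ᵥ y) / 2)) (shell N ε) (stdG N) := by
  have h3 : ∀ y ∈ shell N ε, Real.exp (x ⬝ᵥ y - (b - 1) * (y ⬝ᵥ y) / 2) ≤
      Real.exp (|b - 1| * ε * N / 2 - (b - 1) * N / 2) * Real.exp (x ⬝ᵥ y) := fun y hy => by
    rw [← Real.exp_add]
    refine Real.exp_le_exp.2 ?_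
    have h2 : -((b - 1) * (y ⬝ᵥ y - N)) ≤ |b - 1| * (ε * N) :=
      (neg_le_abs _).trans (by rw [abs_mul]; exact mul_le_mul_of_nonneg_left hy (abs_nonneg _))
    nlinarith
  refine Integrable.mono' ((integrable_shell_exp_dot ε x).const_mul
    (Real.exp (|b - 1| * ε * N / 2 - (b - 1) * N / 2))) (by fun_prop) ?_
  filter_upwards [ae_restrict_mem (measurableSet_shell ε)] with y hy
  rw [Real.norm_of_nonneg (Real.exp_pos _).le]
  exact h3 y hy

/-- Upper bound for the Laplace transform of the uniform measure on the sphere. -/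
theorem sphInt_upper (hN : 1 ≤ N) (ε : ℝ) {b : ℝ} (hb : 0 < b) (x : Fin N → ℝ) :
    (stdG N).real (shell N ε) * sphInt N (√(1 - ε) • x) ≤
      Real.exp (N * ((b - 1 - Real.log b) / 2 + |b - 1| * ε / 2) + x ⬝ᵥ x / (2 * b)) := by
  refine (le_integral_shell hN ε x).trans ?_
  -- On the shell `|y|²` is `N` up to `ε N`, so the quadratic tilt is nearly constant there and `b`
  -- is a free parameter.
  have h1 : ∀ y ∈ shell N ε, Real.exp (x ⬝ᵥ y) ≤
      Real.exp (N * ((b - 1) / 2 + |b - 1| * ε / 2)) *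
        Real.exp (x ⬝ᵥ y - (b - 1) * (y ⬝ᵥ y) / 2) := fun y hy => by
    rw [← Real.exp_add]
    refine Real.exp_le_exp.2 ?_
    have h2 : (b - 1) * (y ⬝ᵥ y - N) ≤ |b - 1| * (ε * N) :=
      (le_abs_self _).trans (by rw [abs_mul]; exact mul_le_mul_of_nonneg_left hy (abs_nonneg _))
    nlinarith
  refine (setIntegral_mono_on (integrable_shell_exp_dot ε x)
    ((integrable_shell_tilt ε b x).const_mul _)
    (measurableSet_shell ε) h1).trans ?_
  rw [integral_const_mul, integral_shell_tilt ε hb, ← mul_assoc, ← Real.exp_add]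
  refine (mul_le_of_le_one_right (Real.exp_pos _).le (shellMass_le_one _ _ _)).trans ?_
  refine Real.exp_le_exp.2 (le_of_eq ?_)
  ring

/-- Lower bound for the Laplace transform of the uniform measure on the sphere. -/
theorem sphInt_lower (hN : 1 ≤ N) (ε : ℝ) {b : ℝ} (hb : 1 ≤ b) (x : Fin N → ℝ) :
    Real.exp (N * ((b - 1) * (1 - ε) / 2 - Real.log b / 2) + x ⬝ᵥ x / (2 * b)) *
      shellMass N ε b x ≤ sphInt N (√(1 + ε) • x) := by
  have hb0 : 0 < b := one_pos.trans_le hb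
  have h := integral_shell_tilt ε hb0 x
  have e : Real.exp (N * ((b - 1) * (1 - ε) / 2 - Real.log b / 2) + x ⬝ᵥ x / (2 * b)) *
      shellMass N ε b x = Real.exp (N * ((b - 1) * (1 - ε) / 2)) *
        ∫ y in shell N ε, Real.exp (x ⬝ᵥ y - (b - 1) * (y ⬝ᵥ y) / 2) ∂stdG N := by
    rw [h, ← mul_assoc, ← Real.exp_add]
    congr 2
    ring
  rw [e, ← integral_const_mul]
  refine le_trans ?_ (integral_shell_le hN ε x)
  refine setIntegral_mono_on ((integrable_shell_tilt ε b x).const_mul _)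
    (integrable_shell_exp_dot ε x) (measurableSet_shell ε) fun y hy => ?_
  rw [← Real.exp_add]
  refine Real.exp_le_exp.2 ?_
  have := (mem_shell_iff.1 hy).1
  nlinarith

/-! ### Asymptotics of the Laplace transform of the uniform measure on the sphere -/

/-- `sphInt_upper` is applied to `x / √(1 - ε)` with parameter `b / (1 - ε)`, so that the quadratic
term is exactly `|x|²/(2b)`. The bound is uniform in `x`, as its use under the operators requires.
-/
theorem eventually_base_le {b η : ℝ} (hb : 0 < b) (hη : 0 < η) :
    ∀ᶠ N : ℕ in atTop, ∀ x : Fin N → ℝ,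
      base (sphereLaw N) 0 x ≤ x ⬝ᵥ x / (2 * b) + N * ((b - 1 - Real.log b) / 2 + η) := by
  set φ : ℝ → ℝ := fun ε => (b / (1 - ε) - 1 - Real.log (b / (1 - ε))) / 2 +
    |b / (1 - ε) - 1| * ε / 2 with hφ
  have hφc : ContinuousAt φ 0 := by
    have h1 : ContinuousAt (fun ε : ℝ => b / (1 - ε)) 0 :=
      continuousAt_const.div (by fun_prop) (by norm_num)
    have h2 : ContinuousAt (fun ε : ℝ => Real.log (b / (1 - ε))) 0 :=
      h1.log (by simpa using hb.ne')
    exact (((h1.sub continuousAt_const).sub h2).div_const 2).add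
      ((((h1.sub continuousAt_const).abs).mul continuousAt_id).div_const 2)
  have hφ0 : φ 0 = (b - 1 - Real.log b) / 2 := by simp [hφ]
  have h3 : ∀ᶠ ε in 𝓝 (0 : ℝ), φ ε < (b - 1 - Real.log b) / 2 + η / 2 := by
    have := hφc.tendsto
    rw [hφ0] at this
    exact this.eventually (gt_mem_nhds (by linarith))
  obtain ⟨ε, ⟨hε, hε1⟩, hε0⟩ := ((h3.and (gt_mem_nhds one_pos)).filter_mono
    (nhdsWithin_le_nhds (s := Ioi 0)) |>.and self_mem_nhdsWithin).exists
  have hε0 : 0 < ε := hε0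
  have h1ε : 0 < 1 - ε := by linarith
  -- A shell of mass at least `1/2` costs `log 2`, which is eventually below `N η / 2`.
  have h4 := (tendsto_shell hε0).eventually (lt_mem_nhds (by norm_num : (1 / 2 : ℝ) < 1))
  have h5 : ∀ᶠ N : ℕ in atTop, Real.log 2 ≤ N * (η / 2) :=
    (tendsto_natCast_atTop_atTop.atTop_mul_const (half_pos hη)).eventually_ge_atTop _
  filter_upwards [h4, h5, eventually_ge_atTop 1] with N hN4 hN5 hN x
  rw [base_zero_eq hN]
  have hs : √(1 - ε) ≠ 0 := (Real.sqrt_pos.2 h1ε).ne'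
  have h6 := sphInt_upper hN ε (div_pos hb h1ε) ((√(1 - ε))⁻¹ • x)
  rw [smul_smul, mul_inv_cancel₀ hs, one_smul, smul_dotProduct, dotProduct_smul, smul_eq_mul,
    smul_eq_mul, ← mul_assoc, ← mul_inv, Real.mul_self_sqrt h1ε.le] at h6
  have e : (1 - ε)⁻¹ * (x ⬝ᵥ x) / (2 * (b / (1 - ε))) = x ⬝ᵥ x / (2 * b) := by
    field_simp
  rw [e] at h6
  have h7 : sphInt N x ≤ 2 * Real.exp (N * φ ε + x ⬝ᵥ x / (2 * b)) := by
    have := sphInt_pos hN x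
    nlinarith
  have h8 := Real.log_le_log (sphInt_pos hN x) h7
  rw [Real.log_mul two_ne_zero (Real.exp_pos _).ne', Real.log_exp] at h8
  have h9 : (N : ℝ) * φ ε ≤ N * ((b - 1 - Real.log b) / 2 + η / 2) := by gcongr
  linarith

theorem lip_base_sphere (hN : 1 ≤ N) : Lip √N (base (sphereLaw N) 0) := by
  have := isProbabilityMeasure_sphereLaw hN
  exact (reg_base (Real.sqrt_nonneg _) ae_len_sphereLaw 0).lip

theorem measurable_shellMass (ε b : ℝ) : Measurable (shellMass N ε b) := by
  unfold shellMass
  exact (StronglyMeasurable.integral_prod_right (f := fun x z : Fin N → ℝ =>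
    (shell N ε).indicator (1 : (Fin N → ℝ) → ℝ) (b⁻¹ • x + (√b)⁻¹ • z))
    ((measurable_shell_indicator ε).comp (by fun_prop :
      Measurable fun p : (Fin N → ℝ) × (Fin N → ℝ) =>
        b⁻¹ • p.1 + (√b)⁻¹ • p.2)).stronglyMeasurable).measurable

/-- If `x` is Gaussian of variance `b² - b`, then `b⁻¹ x + b^(-1/2) z` has variance `(b² - b)/b² +
1/b = 1`. The tilted measure at a typical such `x` therefore charges the shell, and no exponential
factor is lost. -/
theorem integral_shellMass (ε : ℝ) {b : ℝ} (hb : 1 ≤ b) :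
    ∫ z, shellMass N ε b (√(b ^ 2 - b) • z) ∂stdG N = (stdG N).real (shell N ε) := by
  have hb0 : 0 < b := one_pos.trans_le hb
  have h := integral_stdG_add (N := N) (b⁻¹ * √(b ^ 2 - b)) (√b)⁻¹
    (measurable_shell_indicator (N := N) ε)
  have e : √((b⁻¹ * √(b ^ 2 - b)) ^ 2 + (√b)⁻¹ ^ 2) = 1 := by
    rw [mul_pow, Real.sq_sqrt (by nlinarith), inv_pow, inv_pow, Real.sq_sqrt hb0.le]
    rw [Real.sqrt_eq_one]
    field_simp
    ring
  rw [e] at h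
  simp only [one_smul] at h
  rw [integral_indicator_one (measurableSet_shell ε)] at h
  rw [← h, integral_prod _ (integrable_shell_indicator (by fun_prop) ε)]
  simp only [shellMass, smul_smul]

/-- With high probability `sphInt_lower` is sharp to leading order at `√(b² - b) z`; its exponent is
about `N ((b - 1)/2 - log b / 2)` plus `N (b - 1)/2` from the quadratic term. Off this event `base ≥
0` suffices, and the Lipschitz bound removes the factor `√(1 + ε)`. -/
theorem eventually_le_integral_base {b η : ℝ} (hb : 1 ≤ b) (hη : 0 < η) :
    ∀ᶠ N : ℕ in atTop, N * (b - 1 - Real.log b / 2 - η) ≤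
      ∫ z, base (sphereLaw N) 0 (√(b ^ 2 - b) • z) ∂stdG N := by
  have hb0 : 0 < b := one_pos.trans_le hb
  set v := b ^ 2 - b with hv
  have hv0 : 0 ≤ v := by rw [hv]; nlinarith
  -- `(b - 1) ε` is the loss in `κ`, and `√v ε` the loss from undoing the factor `√(1 + ε)`.
  obtain ⟨ε, hε0, hε⟩ : ∃ ε : ℝ, 0 < ε ∧ ((b - 1) + √v) * ε ≤ η / 2 := by
    have hd : 0 < (b - 1) + √v + 1 := by have := Real.sqrt_nonneg v; linarith
    refine ⟨η / 2 / ((b - 1) + √v + 1), by positivity, ?_⟩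
    rw [← mul_div_assoc, div_le_iff₀ hd]
    nlinarith
  set κ := (b - 1) * (1 - ε) - Real.log b / 2 with hκ
  set good : (N : ℕ) → Set (Fin N → ℝ) := fun N =>
    shell N ε ∩ {z | 1 / 2 ≤ shellMass N ε b (√v • z)} with hgood
  have hgm : ∀ N, MeasurableSet (good N) := fun N =>
    (measurableSet_shell ε).inter
      (measurableSet_le measurable_const ((measurable_shellMass ε b).comp (by fun_prop)))
  have hgood1 : Tendsto (fun N => (stdG N).real (good N)) atTop (𝓝 1) := by
    have h1 : Tendsto (fun N : ℕ => 1 - 3 * (1 - (stdG N).real (shell N ε))) atTop (𝓝 1) := by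
      have := (((tendsto_shell hε0).const_sub 1).const_mul 3).const_sub 1
      simpa using this
    refine tendsto_of_tendsto_of_tendsto_of_le_of_le h1 tendsto_const_nhds (fun N => ?_)
      fun N => measureReal_le_one
    beta_reduce
    have hi1 := integrable_shell_indicator (μ := stdG N) (g := fun z : Fin N → ℝ => z)
      measurable_id ε
    have hi2 : Integrable (fun z => shellMass N ε b (√v • z)) (stdG N) := by
      refine Integrable.of_bound ((measurable_shellMass ε b).comp
        (by fun_prop)).aestronglyMeasurable 1 (ae_of_all _ fun z => ?_)
      rw [Real.norm_of_nonneg (shellMass_nonneg _ _ _)]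
      exact shellMass_le_one _ _ _
    -- A pointwise form of Markov's inequality for both defining conditions of `good N`. With `p`
    -- the mass of the shell, integration gives `3p - 2 = 1 - 3(1 - p)`.
    have hle : ∀ z, (shell N ε).indicator (1 : (Fin N → ℝ) → ℝ) z - 2 +
        2 * shellMass N ε b (√v • z) ≤ (good N).indicator 1 z := fun z => by
      have a1 := shellMass_le_one ε b (√v • z)
      have a2 := shell_indicator_le ε z
      by_cases hz : z ∈ good N
      · rw [indicator_of_mem hz, Pi.one_apply]; linarith
      · rw [indicator_of_notMem hz]
        by_cases hz1 : z ∈ shell N ε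
        · have : shellMass N ε b (√v • z) < 1 / 2 := by
            by_contra hc
            exact hz ⟨hz1, not_lt.1 hc⟩
          linarith
        · rw [indicator_of_notMem hz1]; linarith
    have hi3 : Integrable (fun z => (shell N ε).indicator (1 : (Fin N → ℝ) → ℝ) z - 2) (stdG N) :=
      hi1.sub (integrable_const 2)
    have h2 := integral_mono (hi3.add (hi2.const_mul 2))
      ((integrable_const 1).indicator (hgm N)) hle
    rw [integral_indicator_one (hgm N)] at h2
    simp only [Pi.add_apply] at h2
    rw [integral_add hi3 (hi2.const_mul 2), integral_sub hi1 (integrable_const 2),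
      integral_const_mul, integral_shellMass ε hb, integral_indicator_one (measurableSet_shell ε)]
      at h2
    simp only [integral_const, probReal_univ, smul_eq_mul] at h2
    linarith
  have hlim : Tendsto (fun N : ℕ => (stdG N).real (good N) * (κ - Real.log 2 / N)) atTop
      (𝓝 (1 * (κ - 0))) :=
    hgood1.mul ((tendsto_const_div_atTop_nhds_zero_nat _).const_sub κ)
  rw [one_mul, sub_zero] at hlim
  filter_upwards [hlim.eventually (lt_mem_nhds (by linarith : κ - η / 2 < κ)),
    eventually_ge_atTop 1] with N hN1 hN
  have hNp : (0 : ℝ) < N := by positivity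
  have hlip := lip_base_sphere hN
  have hi : ∀ a : ℝ, Integrable (fun z => base (sphereLaw N) 0 (a • z)) (stdG N) := fun a => by
    have := (hlip.expInt 0 a).integrable
    simpa using this
  -- the bound on the good event
  have hb1 : ∀ z, (good N).indicator (fun _ => N * κ - Real.log 2) z ≤
      base (sphereLaw N) 0 ((√(1 + ε) * √v) • z) := fun z => by
    rw [base_zero_eq hN]
    by_cases hz : z ∈ good N
    · rw [indicator_of_mem hz]
      have h1 := sphInt_lower hN ε hb (√v • z)
      rw [smul_smul, smul_dotProduct, dotProduct_smul, smul_eq_mul, smul_eq_mul, ← mul_assoc,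
        Real.mul_self_sqrt hv0] at h1
      have h2 : v * (z ⬝ᵥ z) / (2 * b) = (b - 1) / 2 * (z ⬝ᵥ z) := by
        rw [hv]; field_simp
      rw [h2] at h1
      have h3 := (mem_shell_iff.1 hz.1).1
      have h4 : (1 / 2 : ℝ) ≤ shellMass N ε b (√v • z) := hz.2
      set X := N * ((b - 1) * (1 - ε) / 2 - Real.log b / 2) + (b - 1) / 2 * (z ⬝ᵥ z) with hX
      have h5 : Real.exp X * (1 / 2) ≤ sphInt N ((√(1 + ε) * √v) • z) :=
        (mul_le_mul_of_nonneg_left h4 (Real.exp_pos _).le).trans h1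
      have h6 := Real.log_le_log (by positivity) h5
      rw [Real.log_mul (Real.exp_pos _).ne' (by norm_num), Real.log_exp, one_div, Real.log_inv] at h6
      have h7 : N * κ ≤ X := by rw [hX, hκ]; nlinarith
      linarith
    · rw [indicator_of_notMem hz]
      exact Real.log_nonneg (one_le_sphInt hN _)
  have h1 := integral_mono ((integrable_const _).indicator (hgm N)) (hi _) hb1
  rw [integral_indicator_const _ (hgm N), smul_eq_mul] at h1
  -- the effect of the scaling
  have hs1 : √(1 + ε) - 1 ≤ ε := by
    have : √(1 + ε) ≤ 1 + ε := Real.sqrt_le_iff.2 ⟨by linarith, by nlinarith⟩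
    linarith
  have hs0 : 0 ≤ √(1 + ε) - 1 := by
    rw [sub_nonneg, Real.one_le_sqrt]; linarith
  have hb2 : ∀ z, base (sphereLaw N) 0 ((√(1 + ε) * √v) • z) ≤
      base (sphereLaw N) 0 (√v • z) + √N * (ε * √v) * len z := fun z => by
    have h2 := (le_abs_self _).trans (hlip (√v • z) (((√(1 + ε) - 1) * √v) • z))
    have e : √v • z + ((√(1 + ε) - 1) * √v) • z = (√(1 + ε) * √v) • z := by
      rw [← add_smul]; congr 1; ring
    rw [e, len_smul, abs_of_nonneg (mul_nonneg hs0 (Real.sqrt_nonneg _))] at h2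
    have h3 : √N * ((√(1 + ε) - 1) * √v * len z) ≤ √N * (ε * √v * len z) := by
      have := len_nonneg z
      gcongr
    linarith
  have hlen : Integrable (fun z : Fin N → ℝ => len z) (stdG N) := by
    simpa using integrable_len_pow (N := N) 1
  have h2 := integral_mono (hi _) ((hi √v).add (hlen.const_mul (√N * (ε * √v)))) hb2
  simp only [Pi.add_apply] at h2
  rw [integral_add (hi _) (hlen.const_mul _), integral_const_mul] at h2
  -- The inequality of arithmetic and geometric means for `√N` and `|z|²/√N`.
  have hE : ∫ z : Fin N → ℝ, len z ∂stdG N ≤ √N := by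
    have h3 : ∀ z : Fin N → ℝ, len z ≤ (√N + (z ⬝ᵥ z) / √N) / 2 := fun z => by
      have hs := Real.sqrt_pos.2 hNp
      rw [← len_sq]
      have : 0 ≤ (√N - len z) ^ 2 / √N := by positivity
      have e : (√N - len z) ^ 2 / √N = √N - 2 * len z + len z ^ 2 / √N := by
        field_simp
        ring
      linarith
    have hi4 : Integrable (fun z : Fin N → ℝ => z ⬝ᵥ z) (stdG N) := by
      simpa [len_sq] using integrable_len_pow (N := N) 2
    have h4 := integral_mono hlen (((integrable_const (√N)).add (hi4.div_const _)).div_const 2) h3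
    refine h4.trans (le_of_eq ?_)
    simp only [Pi.add_apply]
    rw [integral_div, integral_add (integrable_const _) (hi4.div_const _), integral_div,
      integral_dot_self_stdG, Real.div_sqrt]
    simp
  have h5 : √N * (ε * √v) * ∫ z : Fin N → ℝ, len z ∂stdG N ≤ N * (√v * ε) := by
    calc _ ≤ √N * (ε * √v) * √N := by gcongr
      _ = N * (√v * ε) := by
        rw [mul_comm, ← mul_assoc, Real.mul_self_sqrt hNp.le]; ring
  have h6 : N * (κ - η / 2) ≤ (stdG N).real (good N) * (N * κ - Real.log 2) := by
    have e : (stdG N).real (good N) * (N * κ - Real.log 2) =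
        N * ((stdG N).real (good N) * (κ - Real.log 2 / N)) := by
      field_simp
    rw [e]
    gcongr
  have h7 : N * (b - 1 - Real.log b / 2 - η) ≤ N * (κ - η / 2) - N * (√v * ε) := by
    rw [← mul_sub]
    refine mul_le_mul_of_nonneg_left ?_ hNp.le
    rw [hκ]
    nlinarith
  linarith


/-! ### Comparison with quadratic functions -/

variable {N : ℕ}

/-- Measurable functions of at most quadratic growth. -/
def QuadGrowth (F : (Fin N → ℝ) → ℝ) : Prop :=
  Measurable F ∧ ∃ A B : ℝ, 0 ≤ B ∧ ∀ z, |F z| ≤ A + B * (z ⬝ᵥ z)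

theorem QuadGrowth.integrable {F : (Fin N → ℝ) → ℝ} (h : QuadGrowth F) :
    Integrable F (stdG N) := by
  obtain ⟨hm, A, B, -, hF⟩ := h
  have hi : Integrable (fun z : Fin N → ℝ => z ⬝ᵥ z) (stdG N) := by
    simpa [len_sq] using integrable_len_pow (N := N) 2
  exact ((integrable_const A).add (hi.const_mul B)).mono' hm.aestronglyMeasurable
    (ae_of_all _ hF)

theorem QuadGrowth.comp {F : (Fin N → ℝ) → ℝ} (h : QuadGrowth F) (u : Fin N → ℝ) (a : ℝ) :
    QuadGrowth fun z => F (u + a • z) := by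
  obtain ⟨hm, A, B, hB, hF⟩ := h
  refine ⟨by fun_prop, A + B * (2 * (u ⬝ᵥ u)), B * (2 * a ^ 2), by positivity, fun z =>
    (hF _).trans ?_⟩
  have h1 := dot_self_nonneg (u - a • z)
  simp only [dotProduct_add, add_dotProduct, dotProduct_sub, sub_dotProduct, smul_dotProduct,
    dotProduct_smul, smul_eq_mul] at h1 ⊢
  rw [dotProduct_comm z u] at h1 ⊢
  nlinarith

theorem QuadGrowth.integrable_prod {F : (Fin N → ℝ) → ℝ} (h : QuadGrowth F) (a b : ℝ) :
    Integrable (fun p : (Fin N → ℝ) × (Fin N → ℝ) => F (a • p.1 + b • p.2))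
      ((stdG N).prod (stdG N)) := by
  have hm := h.1
  have h1 := (h.comp 0 √(a ^ 2 + b ^ 2)).integrable
  simp only [zero_add] at h1
  have h2 := (integrable_map_measure (μ := stdG N) (g := F)
    (f := fun z => √(a ^ 2 + b ^ 2) • z) hm.aestronglyMeasurable (by fun_prop)).2 h1
  rw [← stdG_prod_map] at h2
  exact (integrable_map_measure hm.aestronglyMeasurable (by fun_prop)).1 h2

theorem QuadGrowth.integral_integral {F : (Fin N → ℝ) → ℝ} (h : QuadGrowth F) (a b : ℝ) :
    ∫ y, ∫ z, F (a • y + b • z) ∂stdG N ∂stdG N = ∫ z, F (√(a ^ 2 + b ^ 2) • z) ∂stdG N := by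
  rw [← integral_stdG_add a b h.1, integral_prod _ (h.integrable_prod a b)]

/-- The difference of `f` and the quadratic function `y ↦ y ⬝ y / (2 D) + c`. -/
def defect (f : (Fin N → ℝ) → ℝ) (D c : ℝ) (y : Fin N → ℝ) : ℝ :=
  f y - (y ⬝ᵥ y / (2 * D) + c)

theorem Lip.le_len {R : ℝ} {f : (Fin N → ℝ) → ℝ} (hf : Lip R f) (y : Fin N → ℝ) :
    |f y| ≤ |f 0| + R * len y := by
  have h := hf 0 y
  rw [zero_add] at h
  linarith [abs_sub_abs_le_abs_sub (f y) (f 0)]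

theorem Lip.quadGrowth_defect {R : ℝ} {f : (Fin N → ℝ) → ℝ} (hf : Lip R f) (D c : ℝ) :
    QuadGrowth (defect f D c) := by
  have hm := hf.continuous.measurable
  refine ⟨by unfold defect; fun_prop, |f 0| + |R| + |c|, |R| + |1 / (2 * D)|, by positivity,
    fun y => ?_⟩
  have h1 := hf.le_len y
  have h2 := abs_sub (f y) (y ⬝ᵥ y / (2 * D) + c)
  have h3 := abs_add_le (y ⬝ᵥ y / (2 * D)) c
  have h4 : |y ⬝ᵥ y / (2 * D)| = |1 / (2 * D)| * (y ⬝ᵥ y) := by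
    rw [div_eq_mul_one_div, abs_mul, abs_of_nonneg (dot_self_nonneg y), mul_comm]
  have h5 : R * len y ≤ |R| * (1 + y ⬝ᵥ y) := by
    refine mul_le_mul (le_abs_self R) ?_ (len_nonneg y) (abs_nonneg R)
    rw [← len_sq]
    nlinarith [sq_nonneg (len y - 1), sq_nonneg (len y)]
  unfold defect
  linarith

theorem Lip.integrable_exp_defect {R : ℝ} {f : (Fin N → ℝ) → ℝ} (hf : Lip R f) {D : ℝ}
    (hD : 0 < D) (c : ℝ) {m : ℝ} (hm : 0 ≤ m) (u : Fin N → ℝ) (a : ℝ) :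
    Integrable (fun z => Real.exp (m * defect f D c (u + a • z))) (stdG N) := by
  have hmf := (hf.quadGrowth_defect D c).1
  have h1 := (hf.expInt u a).add_const (-c) m
  refine h1.mono' (Real.measurable_exp.comp ((hmf.comp (g := defect f D c)
    (f := fun z => u + a • z) (by fun_prop)).const_mul m)).aestronglyMeasurable
    (ae_of_all _ fun z => ?_)
  rw [Real.norm_of_nonneg (Real.exp_pos _).le]
  refine Real.exp_le_exp.2 (mul_le_mul_of_nonneg_left ?_ hm)
  have : 0 ≤ (u + a • z) ⬝ᵥ (u + a • z) / (2 * D) := div_nonneg (dot_self_nonneg _) (by positivity)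
  unfold defect
  linarith

theorem expMean_nonpos {Ω : Type*} [MeasurableSpace Ω] {μ : Measure Ω} [IsProbabilityMeasure μ]
    {m : ℝ} (hm : 0 ≤ m) {W : Ω → ℝ} (hW : ∀ ω, W ω ≤ 0) : expMean μ m W ≤ 0 := by
  unfold expMean
  split_ifs with h0
  · exact integral_nonpos hW
  · refine mul_nonpos_of_nonneg_of_nonpos (inv_nonneg.2 hm) (Real.log_nonpos
      (integral_nonneg fun _ => (Real.exp_pos _).le) ?_)
    have h1 : ∀ ω, Real.exp (m * W ω) ≤ 1 := fun ω =>
      Real.exp_le_one_iff.2 (mul_nonpos_of_nonneg_of_nonpos hm (hW ω))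
    have := integral_mono_of_nonneg (μ := μ) (ae_of_all _ fun ω => (Real.exp_pos (m * W ω)).le)
      (integrable_const 1) (ae_of_all _ h1)
    simpa using this

theorem integral_le_expMean {Ω : Type*} [MeasurableSpace Ω] {μ : Measure Ω}
    [IsProbabilityMeasure μ] {m : ℝ} (hm : 0 ≤ m) {W : Ω → ℝ} (hW : Integrable W μ)
    (hE : Integrable (fun ω => Real.exp (m * W ω)) μ) : ∫ ω, W ω ∂μ ≤ expMean μ m W := by
  unfold expMean
  split_ifs with h0
  · exact le_rfl
  · have hm' : 0 < m := lt_of_le_of_ne hm (Ne.symm h0)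
    have h1 := convexOn_exp.map_integral_le (μ := μ) Real.continuous_exp.continuousOn isClosed_univ
      (ae_of_all _ fun _ => mem_univ _) (hW.const_mul m) hE
    have h2 := Real.log_le_log (Real.exp_pos _) h1
    rw [Real.log_exp, integral_const_mul] at h2
    rwa [inv_mul_eq_div, le_div_iff₀ hm', mul_comm]

/-- The increment of the constant term in one step. -/
def stepConst (m δ D : ℝ) : ℝ :=
  if m = 0 then δ / D else 1 / (2 * m) * Real.log (D / (D - 2 * m * δ))

/-- `f` is written as a quadratic function plus its defect. The operator acts explicitly on the
quadratic part, changing `D` into `D - 2mδ`, and its exponential weight changes the mean and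
variance of the Gaussian seen by the defect. -/
theorem Lip.T_eq {R : ℝ} {f : (Fin N → ℝ) → ℝ} (hf : Lip R f) {m δ D : ℝ} (hm : 0 ≤ m)
    (hδ : 0 ≤ δ) (hD : 0 < D - 2 * m * δ) (c : ℝ) (x : Fin N → ℝ) :
    T m δ f x = x ⬝ᵥ x / (2 * (D - 2 * m * δ)) + (c + N * stepConst m δ D) +
      expMean (stdG N) m fun z => defect f D c
        ((D / (D - 2 * m * δ)) • x + √(2 * δ * D / (D - 2 * m * δ)) • z) := by
  have hD0 : 0 < D := by nlinarith [mul_nonneg hm hδ]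
  set a := √(2 * δ) with ha
  have ha2 : a ^ 2 = 2 * δ := Real.sq_sqrt (by positivity)
  have hf1 : ∀ z : Fin N → ℝ, f (x + a • z) = defect f D c (x + a • z) +
      ((x ⬝ᵥ x + 2 * a * (x ⬝ᵥ z) + a ^ 2 * (z ⬝ᵥ z)) / (2 * D) + c) := fun z => by
    unfold defect
    simp only [dotProduct_add, add_dotProduct, smul_dotProduct, dotProduct_smul, smul_eq_mul]
    rw [dotProduct_comm z x]
    ring
  rcases eq_or_ne m 0 with rfl | hm0
  · simp only [mul_zero, zero_mul, sub_zero, T, expMean, stepConst, if_true, ← ha]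
    have e1 : √(2 * δ * D / D) = a := by rw [mul_div_cancel_right₀ _ hD0.ne']
    rw [e1, div_self hD0.ne']
    simp only [one_smul]
    have hi := ((hf.quadGrowth_defect D c).comp x a).integrable
    have hx : Integrable (fun z : Fin N → ℝ => x ⬝ᵥ z) (stdG N) := by
      refine (((integrable_len_pow (N := N) 1).const_mul (len x))).mono' (by fun_prop)
        (ae_of_all _ fun z => ?_)
      rw [pow_one]; exact abs_dot_le x z
    -- By symmetry: the combinations with coefficients `(0, -1)` and `(0, 1)` have the same law.
    have hx0 : ∫ z : Fin N → ℝ, x ⬝ᵥ z ∂stdG N = 0 := by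
      have h2 := stdG_prod_map N 0 (-1)
      have h3 := stdG_prod_map N 0 1
      have h4 : ((stdG N).prod (stdG N)).map (fun p => (0 : ℝ) • p.1 + (-1 : ℝ) • p.2) =
          ((stdG N).prod (stdG N)).map (fun p => (0 : ℝ) • p.1 + (1 : ℝ) • p.2) := by
        rw [h2, h3]; norm_num
      have h5 := congrArg (fun μ => ∫ z, x ⬝ᵥ z ∂μ) h4
      beta_reduce at h5
      rw [integral_map (by fun_prop) (by fun_prop), integral_map (by fun_prop) (by fun_prop)] at h5
      simp only [zero_smul, zero_add, one_smul, neg_smul, dotProduct_neg] at h5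
      rw [integral_neg, integral_fun_snd (fun z => x ⬝ᵥ z)] at h5
      simp only [probReal_univ, one_smul] at h5
      linarith
    have hz : Integrable (fun z : Fin N → ℝ => z ⬝ᵥ z) (stdG N) := by
      simpa [len_sq] using integrable_len_pow (N := N) 2
    simp_rw [hf1]
    have i1 : Integrable (fun z : Fin N → ℝ => x ⬝ᵥ x + 2 * a * (x ⬝ᵥ z)) (stdG N) :=
      (integrable_const _).add (hx.const_mul _)
    have i2 : Integrable (fun z : Fin N → ℝ =>
        x ⬝ᵥ x + 2 * a * (x ⬝ᵥ z) + a ^ 2 * (z ⬝ᵥ z)) (stdG N) := i1.add (hz.const_mul _)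
    have i3 : Integrable (fun z : Fin N → ℝ =>
        (x ⬝ᵥ x + 2 * a * (x ⬝ᵥ z) + a ^ 2 * (z ⬝ᵥ z)) / (2 * D) + c) (stdG N) :=
      (i2.div_const _).add (integrable_const _)
    rw [integral_add hi i3, integral_add (i2.div_const _) (integrable_const _), integral_div,
      integral_add i1 (hz.const_mul _), integral_add (integrable_const _) (hx.const_mul _),
      integral_const_mul, integral_const_mul,
      hx0, integral_dot_self_stdG, ha2]
    simp only [integral_const, probReal_univ, one_smul]
    field_simp
    ring
  · have hm' : 0 < m := lt_of_le_of_ne hm (Ne.symm hm0)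
    set D' := D - 2 * m * δ with hD'
    -- The inverse variance of the Gaussian after the tilt by `m` times the quadratic part.
    set γ := D' / D with hγ
    have hγ0 : 0 < γ := div_pos hD hD0
    have e1 : (D / D') • x = x + a • (γ⁻¹ • ((m * a / D) • x)) := by
      rw [smul_smul, smul_smul]
      nth_rw 2 [← one_smul ℝ x]
      rw [← add_smul]
      congr 1
      rw [hγ]
      field_simp
      rw [ha2, hD']
      ring
    have e2 : √(2 * δ * D / D') = a * (√γ)⁻¹ := by
      rw [← Real.sqrt_inv, ha, ← Real.sqrt_mul (by positivity), hγ, inv_div, mul_div_assoc]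
    have h := integral_stdG_square hγ0 ((m * a / D) • x)
      fun z => Real.exp (m * defect f D c (x + a • z))
    have e3 : ∀ z : Fin N → ℝ, Real.exp (m * f (x + a • z)) =
        Real.exp (m * (x ⬝ᵥ x / (2 * D) + c)) *
        (Real.exp ((m * a / D) • x ⬝ᵥ z - (γ - 1) * (z ⬝ᵥ z) / 2) *
          Real.exp (m * defect f D c (x + a • z))) := fun z => by
      rw [← Real.exp_add, ← Real.exp_add, hf1, smul_dotProduct, smul_eq_mul, ha2, hγ, hD']
      congr 1
      field_simp
      ring
    have e4 : ∀ z : Fin N → ℝ, (D / D') • x + √(2 * δ * D / D') • z =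
        x + a • (γ⁻¹ • ((m * a / D) • x) + (√γ)⁻¹ • z) := fun z => by
      rw [e1, e2, smul_add, ← add_assoc, smul_smul a (√γ)⁻¹ z]
    have hpos : 0 < ∫ z, Real.exp (m * defect f D c ((D / D') • x + √(2 * δ * D / D') • z)) ∂stdG N :=
      integral_exp_pos (hf.integrable_exp_defect hD0 c hm _ _)
    simp_rw [T, expMean, stepConst, if_neg hm0, ← ha, e3]
    simp_rw [e4] at hpos ⊢
    have hs : 0 < √γ := Real.sqrt_pos.2 hγ0
    rw [integral_const_mul, h, Real.log_mul (Real.exp_pos _).ne' (by positivity), Real.log_exp,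
      Real.log_mul (by positivity) hpos.ne', Real.log_mul (by positivity) (Real.exp_pos _).ne',
      Real.log_exp, Real.log_pow, Real.log_inv, Real.log_sqrt hγ0.le, smul_dotProduct,
      dotProduct_smul, smul_eq_mul, smul_eq_mul, hγ, Real.log_div hD.ne' hD0.ne',
      Real.log_div hD0.ne' hD.ne']
    have e5 : m * a / D * (m * a / D * (x ⬝ᵥ x)) / (2 * (D' / D)) =
        m ^ 2 * δ / (D * D') * (x ⬝ᵥ x) := by
      field_simp
      rw [ha2]; ring
    rw [e5]
    have e6 : m⁻¹ * (m * (x ⬝ᵥ x / (2 * D) + c)) + m⁻¹ * (m ^ 2 * δ / (D * D') * (x ⬝ᵥ x)) =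
        x ⬝ᵥ x / (2 * D') + c := by
      field_simp
      rw [hD']; ring
    have e7 : m⁻¹ * (N * -((Real.log D' - Real.log D) / 2)) =
        N * (1 / (2 * m) * (Real.log D - Real.log D')) := by
      field_simp; ring
    linear_combination e6 + e7

/-! ### The recursion for the parameters -/

/-- The final value of the parameter. -/
def dEnd : List (ℝ × ℝ) → ℝ → ℝ
  | [], b => b
  | p :: L, b => dEnd L b - 2 * p.1 * p.2

/-- The sum of the constant terms. -/
def kSum : List (ℝ × ℝ) → ℝ → ℝ
  | [], _ => 0
  | p :: L, b => kSum L b + stepConst p.1 p.2 (dEnd L b)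

/-- The variance of the Gaussian vector in the lower bound. -/
def vq : List (ℝ × ℝ) → ℝ → ℝ
  | [], _ => 0
  | p :: L, b => vq L b + 2 * p.2 / (dEnd L b * dEnd (p :: L) b)

theorem Valid.dEnd_le {p : ℝ × ℝ} {L : List (ℝ × ℝ)} (h : Valid (p :: L)) (b : ℝ) :
    dEnd (p :: L) b ≤ dEnd L b := by
  have := mul_nonneg h.head.1 h.head.2.2
  simp only [dEnd]
  linarith

theorem Valid.vq_nonneg {L : List (ℝ × ℝ)} (h : Valid L) {b : ℝ} (hD : 0 < dEnd L b) :
    0 ≤ vq L b := by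
  induction L with
  | nil => exact le_rfl
  | cons p L ih =>
    have h1 := hD.trans_le (h.dEnd_le b)
    have h2 := h.head.2.2
    have := ih h.tail h1
    unfold vq
    positivity

/-- A nonpositive defect has a nonpositive exponential mean, so the quadratic upper bound is
transported through each operator. -/
theorem Lip.val_le {R : ℝ} {f : (Fin N → ℝ) → ℝ} (hf : Lip R f) {L : List (ℝ × ℝ)}
    (h : Valid L) {b c : ℝ} (hD : 0 < dEnd L b) (hfb : ∀ y, f y ≤ y ⬝ᵥ y / (2 * b) + c)
    (x : Fin N → ℝ) : SpinGlass.val f L x ≤ x ⬝ᵥ x / (2 * dEnd L b) + (c + N * kSum L b) := by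
  induction L generalizing x with
  | nil => simpa [dEnd, kSum, SpinGlass.val] using hfb x
  | cons p L ih =>
    have h1 := ih h.tail (hD.trans_le (h.dEnd_le b))
    have hl : Lip R (SpinGlass.val f L) := hf.val fun q hq => (h.tail q hq).1
    simp only [SpinGlass.val]
    rw [hl.T_eq h.head.1 h.head.2.2 hD (c + N * kSum L b)]
    have h2 := expMean_nonpos (μ := stdG N) h.head.1 (W := fun z =>
      defect (SpinGlass.val f L) (dEnd L b) (c + N * kSum L b)
        ((dEnd L b / (dEnd L b - 2 * p.1 * p.2)) • x +
        √(2 * p.2 * dEnd L b / (dEnd L b - 2 * p.1 * p.2)) • z)) fun z => by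
      unfold defect
      linarith [h1 ((dEnd L b / (dEnd L b - 2 * p.1 * p.2)) • x +
        √(2 * p.2 * dEnd L b / (dEnd L b - 2 * p.1 * p.2)) • z)]
    simp only [dEnd, kSum]
    linarith

/-- At each level Jensen's inequality replaces the exponential mean of the defect by its mean. The
affine Gaussian shifts of the successive levels then compose into one Gaussian law of variance `b²
vq`. -/
theorem Lip.le_val {R : ℝ} {f : (Fin N → ℝ) → ℝ} (hf : Lip R f) {L : List (ℝ × ℝ)}
    (h : Valid L) {b : ℝ} (c : ℝ) (hD : 0 < dEnd L b) (x : Fin N → ℝ) :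
    x ⬝ᵥ x / (2 * dEnd L b) + (c + N * kSum L b) +
      ∫ z, defect f b c ((b / dEnd L b) • x + (b * √(vq L b)) • z) ∂stdG N ≤
        SpinGlass.val f L x := by
  induction L generalizing x with
  | nil =>
    simp only [dEnd] at hD
    simp [dEnd, kSum, SpinGlass.val, vq, hD.ne', defect]
  | cons p L ih =>
    have hD1 := hD.trans_le (h.dEnd_le b)
    have h1 := ih h.tail hD1
    have hl : Lip R (SpinGlass.val f L) := hf.val fun q hq => (h.tail q hq).1
    simp only [SpinGlass.val]
    rw [hl.T_eq h.head.1 h.head.2.2 hD (c + N * kSum L b)]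
    set D := dEnd L b with hDdef
    have hDe : dEnd (p :: L) b = D - 2 * p.1 * p.2 := rfl
    rw [hDe] at hD ⊢
    set D' := D - 2 * p.1 * p.2 with hD'
    set s := √(2 * p.2 * D / D') with hs
    have hs2 : s ^ 2 = 2 * p.2 * D / D' := by
      have := h.head.2.2
      exact Real.sq_sqrt (by positivity)
    have hG := hl.quadGrowth_defect D (c + N * kSum L b)
    have h2 := integral_le_expMean (μ := stdG N) h.head.1 (hG.comp ((D / D') • x) s).integrable
      (hl.integrable_exp_defect hD1 _ h.head.1 _ _)
    have hq := (hf.quadGrowth_defect b c).comp ((b / D') • x) 1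
    have hq1 := hq.integrable_prod (b / D * s) (b * √(vq L b))
    have h3 : ∀ z, ∫ w, defect f b c ((b / D') • x + (1 : ℝ) •
        ((b / D * s) • z + (b * √(vq L b)) • w)) ∂stdG N ≤
        defect (SpinGlass.val f L) D (c + N * kSum L b) ((D / D') • x + s • z) := fun z => by
      have h4 := h1 ((D / D') • x + s • z)
      have e : ∀ w : Fin N → ℝ, (b / D) • ((D / D') • x + s • z) + (b * √(vq L b)) • w =
          (b / D') • x + (1 : ℝ) • ((b / D * s) • z + (b * √(vq L b)) • w) := fun w => by
        rw [smul_add, smul_smul, smul_smul, one_smul, add_assoc, div_mul_div_cancel₀ hD1.ne']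
      simp_rw [e] at h4
      rw [defect]
      linarith
    have h5 := integral_mono hq1.integral_prod_left
      (hG.comp ((D / D') • x) s).integrable h3
    rw [hq.integral_integral] at h5
    -- The variances of the new increment and of the previous levels add up; this identity dictates
    -- the recursion for `vq`.
    have e2 : √((b / D * s) ^ 2 + (b * √(vq L b)) ^ 2) = |b| * √(vq (p :: L) b) := by
      rw [← Real.sqrt_sq_eq_abs, ← Real.sqrt_mul (sq_nonneg b)]
      congr 1
      rw [mul_pow, mul_pow, hs2, Real.sq_sqrt (h.tail.vq_nonneg hD1)]
      simp only [vq, hDe, ← hDdef]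
      field_simp
      ring
    have hb : |b| = b := by
      refine abs_of_nonneg ?_
      have hle : ∀ L : List (ℝ × ℝ), Valid L → dEnd L b ≤ b := fun L => by
        induction L with
        | nil => intro _; exact le_rfl
        | cons p L ih => intro h; exact (h.dEnd_le b).trans (ih h.tail)
      exact hD1.le.trans (hle L h.tail)
    rw [e2, hb] at h5
    simp only [one_smul] at h5
    simp only [kSum, ← hDdef]
    linarith


/-! ### Measurable functions with values in the unit interval -/

/-- Measurable functions with values in `[0, 1]`. -/
def UnitValued (g : ℝ → ℝ) : Prop := Measurable g ∧ ∀ r, g r ∈ Icc (0 : ℝ) 1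

namespace UnitValued

variable {g : ℝ → ℝ}

theorem intervalIntegrable (h : UnitValued g) (a b : ℝ) : IntervalIntegrable g volume a b := by
  have hm := h.1
  refine (intervalIntegrable_const (c := (1 : ℝ))).mono_fun (by fun_prop) (ae_of_all _ fun r => ?_)
  beta_reduce
  rw [Real.norm_of_nonneg (h.2 r).1, norm_one]
  exact (h.2 r).2

theorem continuous_integral (h : UnitValued g) (Q : ℝ) : Continuous fun s => ∫ r in s..Q, g r := by
  simp_rw [fun s => intervalIntegral.integral_symm (f := g) (μ := volume) Q s]
  exact (intervalIntegral.continuous_primitive h.intervalIntegrable Q).neg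

theorem integral_nonneg (h : UnitValued g) {s Q : ℝ} (hs : s ≤ Q) : 0 ≤ ∫ r in s..Q, g r :=
  intervalIntegral.integral_nonneg hs fun r _ => (h.2 r).1

theorem integral_anti (h : UnitValued g) {s t : ℝ} (hs : s ≤ t) (Q : ℝ) :
    ∫ r in t..Q, g r ≤ ∫ r in s..Q, g r := by
  rw [← intervalIntegral.integral_add_adjacent_intervals (h.intervalIntegrable s t)
    (h.intervalIntegrable t Q)]
  linarith [h.integral_nonneg hs]

theorem sub_pos (h : UnitValued g) {b Q : ℝ} (hb : 2 * ∫ r in (0 : ℝ)..Q, g r < b) {s : ℝ}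
    (hs : 0 ≤ s) : 0 < b - 2 * ∫ r in s..Q, g r := by
  linarith [h.integral_anti hs Q]

theorem intervalIntegrable_inv (h : UnitValued g) {b Q : ℝ}
    (hb : 2 * ∫ r in (0 : ℝ)..Q, g r < b) {s t : ℝ} (hs : 0 ≤ s) (ht : 0 ≤ t) :
    IntervalIntegrable (fun s => 1 / (b - 2 * ∫ r in s..Q, g r)) volume s t := by
  refine ContinuousOn.intervalIntegrable fun x hx => ContinuousAt.continuousWithinAt ?_
  have := (h.continuous_integral Q).continuousAt (x := x)
  have hx0 : 0 ≤ x := (le_min hs ht).trans hx.1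
  exact continuousAt_const.div (continuousAt_const.sub (this.const_mul 2)) (h.sub_pos hb hx0).ne'

end UnitValued

theorem Valid.unitValued {L : List (ℝ × ℝ)} (h : Valid L) : UnitValued (stepFun L) :=
  ⟨measurable_stepFun L, h.stepFun_mem⟩

theorem integral_stepFun_cons_of_le {m δ : ℝ} {L : List (ℝ × ℝ)} (h : Valid ((m, δ) :: L)) {s : ℝ}
    (hs : 0 ≤ s) :
    ∫ r in (s + δ)..(δ + total L), stepFun ((m, δ) :: L) r = ∫ r in s..total L, stepFun L r := by
  have := intervalIntegral.integral_comp_add_right (stepFun ((m, δ) :: L)) δ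
    (a := s) (b := total L)
  rw [add_comm (total L)] at this
  rw [← this]
  refine intervalIntegral.integral_congr fun r hr => ?_
  have h0 : 0 ≤ r := (le_min hs h.tail.total_nonneg).trans hr.1
  have : ¬ (r + δ < δ) := by linarith
  simp only [stepFun, if_neg this, add_sub_cancel_right]

theorem integral_stepFun_cons_of_lt {m δ : ℝ} {L : List (ℝ × ℝ)} (h : Valid ((m, δ) :: L)) {s : ℝ}
    (hs : s ≤ δ) :
    ∫ r in s..(δ + total L), stepFun ((m, δ) :: L) r =
      m * (δ - s) + ∫ r in (0 : ℝ)..total L, stepFun L r := by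
  rw [← intervalIntegral.integral_add_adjacent_intervals (b := δ)
    (h.unitValued.intervalIntegrable _ _) (h.unitValued.intervalIntegrable _ _),
    ← integral_stepFun_cons_of_le h le_rfl, zero_add]
  congr 1
  rw [intervalIntegral.integral_of_le hs, ← integral_Ico_eq_integral_Ioc,
    setIntegral_congr_fun (g := fun _ => m) measurableSet_Ico]
  · simp [hs, mul_comm]
  · intro r hr
    simp only [stepFun, if_pos hr.2]

theorem Valid.dEnd_eq {L : List (ℝ × ℝ)} (h : Valid L) (b : ℝ) :
    dEnd L b = b - 2 * ∫ r in (0 : ℝ)..total L, stepFun L r := by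
  induction L with
  | nil => simp [dEnd, total]
  | cons p L ih =>
    rw [total_cons, integral_stepFun_cons_of_lt h h.head.2.2, dEnd, ih h.tail]
    ring

theorem integral_inv_affine {m δ D : ℝ} (hm : 0 ≤ m) (hδ : 0 ≤ δ) (hD : 0 < D - 2 * m * δ) :
    ∫ s in (0 : ℝ)..δ, 1 / (D - 2 * (m * (δ - s))) = stepConst m δ D := by
  unfold stepConst
  split_ifs with h0
  · simp [h0, div_eq_mul_inv]
  · have hpos : ∀ s ∈ uIcc 0 δ, 0 < D - 2 * (m * (δ - s)) := fun s hs => by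
      rw [uIcc_of_le hδ] at hs
      nlinarith [hs.1]
    have hd : ∀ s ∈ uIcc 0 δ, HasDerivAt
        (fun s => 1 / (2 * m) * Real.log (D - 2 * (m * (δ - s)))) (1 / (D - 2 * (m * (δ - s)))) s := by
      intro s hs
      have h1 : HasDerivAt (fun s => D - 2 * (m * (δ - s))) (2 * m) s := by
        have := ((((hasDerivAt_id s).const_sub δ).const_mul m).const_mul 2).const_sub D
        simpa using this
      have h2 := (h1.log (hpos s hs).ne').const_mul (1 / (2 * m))
      exact h2.congr_deriv (by rw [← mul_div_assoc, one_div_mul_cancel (by positivity)])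
    rw [intervalIntegral.integral_eq_sub_of_hasDerivAt hd]
    · have hD0 : 0 < D := by nlinarith [mul_nonneg hm hδ]
      rw [Real.log_div hD0.ne' hD.ne']
      simp only [sub_self, mul_zero, sub_zero, ← mul_assoc]
      ring
    · exact ContinuousOn.intervalIntegrable fun s hs => ContinuousAt.continuousWithinAt
        (continuousAt_const.div (by fun_prop) (hpos s hs).ne')

/-- On each interval the integrand is the reciprocal of an affine function, with integral
`stepConst`. -/
theorem Valid.kSum_eq {L : List (ℝ × ℝ)} (h : Valid L) {b : ℝ} (hD : 0 < dEnd L b) :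
    kSum L b = ∫ s in (0 : ℝ)..total L, 1 / (b - 2 * ∫ r in s..total L, stepFun L r) := by
  induction L with
  | nil => simp [kSum, total]
  | cons p L ih =>
    obtain ⟨m, δ⟩ := p
    have hD1 := hD.trans_le (h.dEnd_le b)
    have hb : 2 * ∫ r in (0 : ℝ)..(δ + total L), stepFun ((m, δ) :: L) r < b := by
      rw [h.dEnd_eq, total_cons] at hD
      exact sub_pos.1 hD
    have hδ : 0 ≤ δ := h.head.2.2
    have ht := h.tail.total_nonneg
    rw [kSum, ih h.tail hD1, total_cons, ← intervalIntegral.integral_add_adjacent_intervals (b := δ)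
      (h.unitValued.intervalIntegrable_inv hb le_rfl hδ)
      (h.unitValued.intervalIntegrable_inv hb hδ (add_nonneg hδ ht)), add_comm]
    congr 1
    · rw [← integral_inv_affine h.head.1 hδ hD]
      refine intervalIntegral.integral_congr fun s hs => ?_
      rw [uIcc_of_le hδ] at hs
      simp only
      rw [integral_stepFun_cons_of_lt h hs.2, h.tail.dEnd_eq]
      congr 1
      ring
    · have := intervalIntegral.integral_comp_add_right
        (fun s => 1 / (b - 2 * ∫ r in s..(δ + total L), stepFun ((m, δ) :: L) r)) δ
        (a := 0) (b := total L)
      rw [zero_add, add_comm (total L)] at this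
      rw [← this]
      refine intervalIntegral.integral_congr fun s hs => ?_
      rw [uIcc_of_le ht] at hs
      rw [integral_stepFun_cons_of_le h hs.1]

/-! ### The critical parameter -/

/-- The differences `1/D' - 1/D = 2mδ/(D D')` telescope, and `m ≤ 1` bounds each by the matching
term of `vq`. -/
theorem Valid.inv_sub_inv_le_vq {L : List (ℝ × ℝ)} (h : Valid L) {b : ℝ} (hD : 0 < dEnd L b) :
    1 / dEnd L b - 1 / b ≤ vq L b := by
  induction L with
  | nil => simp [dEnd, vq]
  | cons p L ih =>
    have hD1 := hD.trans_le (h.dEnd_le b)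
    have h1 := ih h.tail hD1
    have h2 : 1 / dEnd (p :: L) b - 1 / dEnd L b ≤ 2 * p.2 / (dEnd L b * dEnd (p :: L) b) := by
      rw [div_sub_div _ _ hD.ne' hD1.ne', mul_comm (dEnd L b)]
      refine div_le_div_of_nonneg_right ?_ (by positivity)
      simp only [dEnd]
      nlinarith [h.head.2.1, h.head.2.2]
    simp only [vq]
    linarith

theorem Valid.vq_le {L : List (ℝ × ℝ)} (h : Valid L) {b : ℝ} (hD : 0 < dEnd L b) :
    vq L b ≤ 2 * total L / dEnd L b ^ 2 := by
  induction L with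
  | nil => simp [vq, total]
  | cons p L ih =>
    have hle := h.dEnd_le b
    have hD1 := hD.trans_le hle
    have h1 := ih h.tail hD1
    have ht := h.tail.total_nonneg
    have hp := h.head.2.2
    have h2 : 2 * total L / dEnd L b ^ 2 ≤ 2 * total L / dEnd (p :: L) b ^ 2 := by gcongr
    have h3 : 2 * p.2 / (dEnd L b * dEnd (p :: L) b) ≤ 2 * p.2 / dEnd (p :: L) b ^ 2 := by
      rw [sq]; gcongr
    rw [total_cons, mul_add, add_div]
    simp only [vq]
    linarith

theorem continuous_dEnd (L : List (ℝ × ℝ)) : Continuous (dEnd L) := by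
  induction L with
  | nil => exact continuous_id
  | cons p L ih => exact ih.sub continuous_const

theorem Valid.continuousAt_vq {L : List (ℝ × ℝ)} (h : Valid L) {b : ℝ} (hD : 0 < dEnd L b) :
    ContinuousAt (vq L) b := by
  induction L with
  | nil => exact continuousAt_const
  | cons p L ih =>
    have hD1 := hD.trans_le (h.dEnd_le b)
    exact (ih h.tail hD1).add (continuousAt_const.div ((continuous_dEnd L).mul
      (continuous_dEnd (p :: L))).continuousAt (mul_pos hD1 hD).ne')

/-- The equation is the stationarity of `limObj`, as `-vq / 2` is the derivative of `kSum` in `b`. A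
solution is found by the intermediate value theorem. -/
theorem Valid.exists_critical {L : List (ℝ × ℝ)} (h : Valid L) :
    ∃ b, 1 ≤ b ∧ 0 < dEnd L b ∧ vq L b = 1 - 1 / b := by
  have ht := h.total_nonneg
  have hM := h.unitValued.integral_nonneg ht
  set M := ∫ r in (0 : ℝ)..total L, stepFun L r with hMdef
  have hd : ∀ b, dEnd L b = b - 2 * M := h.dEnd_eq
  have hle : 2 * M + 1 ≤ 2 * M + (2 + 2 * total L) := by linarith
  have hc : ContinuousOn (fun b => vq L b - (1 - 1 / b))
      (Icc (2 * M + 1) (2 * M + (2 + 2 * total L))) := fun b hb => by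
    have h0 : 0 < dEnd L b := by rw [hd]; linarith [hb.1]
    have hb0 : b ≠ 0 := by linarith [hb.1]
    exact ((h.continuousAt_vq h0).sub (continuousAt_const.sub
      (continuousAt_const.div continuousAt_id hb0))).continuousWithinAt
  -- At this endpoint `dEnd = 1`, so the lower bound `1 / dEnd - 1 / b` for `vq` is exactly `1 - 1 /
  -- b`.
  have hl : 0 ≤ vq L (2 * M + 1) - (1 - 1 / (2 * M + 1)) := by
    have e : dEnd L (2 * M + 1) = 1 := by rw [hd]; ring
    have := h.inv_sub_inv_le_vq (b := 2 * M + 1) (by rw [e]; norm_num)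
    rw [e] at this
    linarith
  -- At this endpoint both `vq` and `1 / b` are at most `1/2`.
  have hr : vq L (2 * M + (2 + 2 * total L)) - (1 - 1 / (2 * M + (2 + 2 * total L))) ≤ 0 := by
    have e : dEnd L (2 * M + (2 + 2 * total L)) = 2 + 2 * total L := by rw [hd]; ring
    have h1 := h.vq_le (b := 2 * M + (2 + 2 * total L)) (by rw [e]; positivity)
    rw [e] at h1
    have h2 : 2 * total L / (2 + 2 * total L) ^ 2 ≤ 1 / 2 := by
      rw [div_le_iff₀ (by positivity)]
      nlinarith
    have h3 : 1 / (2 * M + (2 + 2 * total L)) ≤ 1 / 2 :=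
      one_div_le_one_div_of_le two_pos (by linarith)
    linarith
  obtain ⟨b, hb, hb0⟩ := intermediate_value_Icc' hle hc ⟨hr, hl⟩
  refine ⟨b, by linarith [hb.1], by rw [hd]; linarith [hb.1], ?_⟩
  simp only at hb0
  linarith

/-! ### The limit for measures of finite support -/

theorem base_sphere {N : ℕ} (hN : 1 ≤ N) (Q : ℝ) (x : Fin N → ℝ) :
    base (sphereLaw N) Q x = base (sphereLaw N) 0 x - Q * N := by
  have := isProbabilityMeasure_sphereLaw hN
  have hp : 0 < ∫ σ, Real.exp (x ⬝ᵥ σ - 0 * (σ ⬝ᵥ σ)) ∂sphereLaw N := by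
    rw [← exp_base ae_len_sphereLaw]; exact Real.exp_pos _
  rw [base_eq_log, base_eq_log, sub_eq_add_neg, ← Real.log_exp (-(Q * N)),
    ← Real.log_mul hp.ne' (Real.exp_pos _).ne', ← integral_mul_const]
  congr 1
  refine integral_congr_ae ?_
  filter_upwards [ae_sphereLaw (N := N)] with σ hσ
  rw [← Real.exp_add, hσ]
  ring_nf

/-- The function minimized in the limit. -/
def limObj (L : List (ℝ × ℝ)) (b : ℝ) : ℝ := kSum L b + (b - 1 - Real.log b) / 2

theorem Valid.eventually_val_le {L : List (ℝ × ℝ)} (h : Valid L) {b η : ℝ} (hD : 0 < dEnd L b)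
    (hb : 0 < b) (hη : 0 < η) (Q : ℝ) : ∀ᶠ N : ℕ in atTop,
      1 / N * val (base (sphereLaw N) Q) L 0 ≤ limObj L b - Q + η := by
  filter_upwards [eventually_base_le hb hη, eventually_ge_atTop 1] with N h1 hN
  have := isProbabilityMeasure_sphereLaw hN
  have hl : Lip √N (base (sphereLaw N) Q) :=
    (reg_base (Real.sqrt_nonneg _) ae_len_sphereLaw Q).lip
  have h2 := hl.val_le h hD (c := N * ((b - 1 - Real.log b) / 2 + η) - Q * N)
    (fun y => by rw [base_sphere hN]; linarith [h1 y]) 0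
  have hN0 : (0 : ℝ) < N := by exact_mod_cast hN
  rw [one_div_mul_eq_div, div_le_iff₀ hN0]
  unfold limObj
  simp only [zero_dotProduct, zero_div] at h2
  linarith

/-- At the critical `b` the Gaussian seen by the defect has variance `b² - b`, for which the mean of
`base` is known from below. Subtracting the mean `N (b - 1)/2` of the quadratic part leaves `N (b -
1 - log b)/2`, which matches the upper bound. -/
theorem Valid.eventually_le_val {L : List (ℝ × ℝ)} (h : Valid L) {b η : ℝ} (hD : 0 < dEnd L b)
    (hb : 1 ≤ b) (hv : vq L b = 1 - 1 / b) (hη : 0 < η) (Q : ℝ) : ∀ᶠ N : ℕ in atTop,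
      limObj L b - Q - η ≤ 1 / N * val (base (sphereLaw N) Q) L 0 := by
  filter_upwards [eventually_le_integral_base hb hη, eventually_ge_atTop 1] with N h1 hN
  have := isProbabilityMeasure_sphereLaw hN
  have hb0 : 0 < b := by linarith
  have hl : Lip √N (base (sphereLaw N) Q) :=
    (reg_base (Real.sqrt_nonneg _) ae_len_sphereLaw Q).lip
  have h2 := hl.le_val h (-(Q * N)) hD 0
  have e1 : b * √(vq L b) = √(b ^ 2 - b) := by
    rw [hv, ← Real.sqrt_sq hb0.le, ← Real.sqrt_mul (sq_nonneg _), Real.sqrt_sq hb0.le]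
    congr 1
    field_simp
  have e2 : ∀ z : Fin N → ℝ, defect (base (sphereLaw N) Q) b (-(Q * N))
      ((b / dEnd L b) • 0 + √(b ^ 2 - b) • z) =
      base (sphereLaw N) 0 (√(b ^ 2 - b) • z) - (b - 1) / 2 * (z ⬝ᵥ z) := fun z => by
    have h0 : 0 ≤ b ^ 2 - b := by nlinarith
    rw [smul_zero, zero_add, defect, base_sphere hN, smul_dotProduct, dotProduct_smul, smul_eq_mul,
      smul_eq_mul, ← mul_assoc, Real.mul_self_sqrt h0]
    field_simp
    ring
  have hi : Integrable (fun z : Fin N → ℝ => z ⬝ᵥ z) (stdG N) := by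
    simpa [len_sq] using integrable_len_pow (N := N) 2
  have hi2 : Integrable (fun z => base (sphereLaw N) 0 (√(b ^ 2 - b) • z)) (stdG N) := by
    simpa using ((lip_base_sphere hN).expInt 0 √(b ^ 2 - b)).integrable
  rw [e1] at h2
  simp_rw [e2] at h2
  rw [integral_sub hi2 (hi.const_mul _), integral_const_mul, integral_dot_self_stdG] at h2
  have hN0 : (0 : ℝ) < N := by exact_mod_cast hN
  rw [one_div_mul_eq_div, le_div_iff₀ hN0]
  unfold limObj
  simp only [zero_dotProduct, zero_div] at h2
  linarith

theorem Valid.tendsto_val {L : List (ℝ × ℝ)} (h : Valid L) (Q : ℝ) :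
    Tendsto (fun N : ℕ => 1 / N * val (base (sphereLaw N) Q) L 0) atTop
      (𝓝 (sInf ((fun b => limObj L b - Q) '' Ioi (2 * ∫ r in (0 : ℝ)..total L, stepFun L r)))) := by
  obtain ⟨b, hb1, hD, hv⟩ := h.exists_critical
  have hM := h.unitValued.integral_nonneg h.total_nonneg
  -- Minimality needs no calculus: the lower bound at `b` and the upper bound at `b'` concern the
  -- same sequence.
  have hmin : ∀ b', 0 < dEnd L b' → 0 < b' → limObj L b ≤ limObj L b' := fun b' hD' hb' => by
    refine le_of_forall_pos_le_add fun η hη => ?_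
    obtain ⟨N, h1, h2⟩ := ((h.eventually_val_le hD' hb' (half_pos hη) Q).and
      (h.eventually_le_val hD hb1 hv (half_pos hη) Q)).exists
    linarith
  have e : sInf ((fun b => limObj L b - Q) '' Ioi (2 * ∫ r in (0 : ℝ)..total L, stepFun L r)) =
      limObj L b - Q := by
    refine IsLeast.csInf_eq ⟨⟨b, ?_, rfl⟩, ?_⟩
    · rw [h.dEnd_eq] at hD
      exact sub_pos.1 hD
    · rintro _ ⟨b', hb', rfl⟩
      have hb'' := mem_Ioi.1 hb'
      refine sub_le_sub_right (hmin b' ?_ (by linarith)) _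
      rw [h.dEnd_eq]
      exact sub_pos.2 hb''
  rw [e, Metric.tendsto_nhds]
  intro ε hε
  filter_upwards [h.eventually_val_le hD (by linarith) (half_pos hε) Q,
    h.eventually_le_val hD hb1 hv (half_pos hε) Q] with N h1 h2
  rw [Real.dist_eq, abs_lt]
  constructor <;> linarith

theorem tendsto_meanFreeEnergy_sphere (d : Ladder) :
    Tendsto (fun N : ℕ => meanFreeEnergy N (sphereLaw N) d) atTop
      (𝓝 (psiCirc d.measure (d.q (Fin.last d.k)))) := by
  have h := (d.valid_levels.tendsto_val (d.q (Fin.last d.k) : ℝ)).neg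
  have hq : (0 : ℝ) ≤ d.q (Fin.last d.k) := NNReal.coe_nonneg _
  have e0 : ∀ s : ℝ, 0 ≤ s → ∫ r in s..(d.q (Fin.last d.k) : ℝ), stepFun d.levels r =
      cdfIntegral d.measure s (d.q (Fin.last d.k)) := fun s hs => by
    refine intervalIntegral.integral_congr fun r hr => ?_
    exact d.stepFun_levels ((le_min hs hq).trans hr.1)
  have e1 : psiCirc d.measure (d.q (Fin.last d.k)) =
      -sInf ((fun b => limObj d.levels b - (d.q (Fin.last d.k) : ℝ)) ''
        Ioi (2 * ∫ r in (0 : ℝ)..total d.levels, stepFun d.levels r)) := by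
    rw [psiCirc, d.total_levels, e0 0 le_rfl]
    congr 2
    refine image_congr fun b hb => ?_
    have hD : 0 < dEnd d.levels b := by
      rw [d.valid_levels.dEnd_eq, d.total_levels, e0 0 le_rfl]
      exact sub_pos.2 hb
    rw [sphereObjective, limObj, d.valid_levels.kSum_eq hD, d.total_levels]
    have e2 : ∫ s in (0 : ℝ)..(d.q (Fin.last d.k) : ℝ),
        1 / (b - 2 * cdfIntegral d.measure s (d.q (Fin.last d.k))) =
        ∫ s in (0 : ℝ)..(d.q (Fin.last d.k) : ℝ),
          1 / (b - 2 * ∫ r in s..(d.q (Fin.last d.k) : ℝ), stepFun d.levels r) := by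
      refine intervalIntegral.integral_congr fun s hs => ?_
      rw [uIcc_of_le hq] at hs
      rw [e0 s hs.1]
    rw [e2]
    ring
  rw [e1]
  refine h.congr' ?_
  filter_upwards [eventually_ge_atTop 1] with N hN
  have := isProbabilityMeasure_sphereLaw hN
  rw [(integrable_freeEnergy_and_mean (sphereLaw N) (Real.sqrt_nonneg _) ae_len_sphereLaw d).2]
  ring


/-! ### The limit functional -/

theorem sphereObjective_eq (μ : Measure ℝ≥0) (q : ℝ≥0) (b : ℝ) : sphereObjective μ q b =
    (∫ s in (0 : ℝ)..q, 1 / (b - 2 * ∫ r in s..q, dist1 μ r)) + (1 / 2) * (b - 1 - Real.log b) - q :=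
  rfl

section PsiCirc

variable (μ ν : Measure ℝ≥0) [IsProbabilityMeasure μ] [IsProbabilityMeasure ν]

theorem unitValued_dist1 : UnitValued (dist1 μ) :=
  ⟨measurable_dist1 μ, fun r => ⟨dist1_nonneg μ r, dist1_le_one μ r⟩⟩

variable {μ}

theorem dist1_eq_one {q : ℝ≥0} (hq : μ (Iic q) = 1) {r : ℝ} (hr : (q : ℝ) ≤ r) :
    dist1 μ r = 1 := by
  refine le_antisymm (dist1_le_one μ r) ?_
  have h := dist1_mono μ hr
  rwa [dist1, Real.toNNReal_coe, measureReal_def, hq, ENNReal.toReal_one] at h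

/-- Beyond `q` the distribution function is `1`. The shift of `b` leaves the denominators on `[0,
q]` unchanged; the integral over `[q, q']` is half the increment of `log b`, and half the increment
of `b` is `q' - q`, so all changes cancel. -/
theorem sphereObjective_shift {q q' : ℝ≥0} (hq : μ (Iic q) = 1) (hqq : q ≤ q') {b : ℝ}
    (hb : 2 * ∫ r in (0 : ℝ)..q, dist1 μ r < b) :
    sphereObjective μ q' (b + 2 * (q' - q)) = sphereObjective μ q b := by
  have hu := unitValued_dist1 μ
  have hqq' : (q : ℝ) ≤ q' := NNReal.coe_le_coe.2 hqq
  have hq0 : (0 : ℝ) ≤ q := NNReal.coe_nonneg q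
  have h1 : ∀ s : ℝ, (q : ℝ) ≤ s → s ≤ q' → ∫ r in s..q', dist1 μ r = q' - s := fun s hs hs' => by
    rw [intervalIntegral.integral_congr (g := fun _ => (1 : ℝ)) fun r hr => ?_]
    · simp
    · rw [uIcc_of_le hs'] at hr
      exact dist1_eq_one hq (hs.trans hr.1)
  have h2 : ∀ s : ℝ, ∫ r in s..q', dist1 μ r = (∫ r in s..q, dist1 μ r) + (q' - q) := fun s => by
    rw [← h1 q le_rfl hqq', intervalIntegral.integral_add_adjacent_intervals
      (hu.intervalIntegrable _ _) (hu.intervalIntegrable _ _)]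
  have hb0 : 0 < b := lt_of_le_of_lt (mul_nonneg two_pos.le (hu.integral_nonneg hq0)) hb
  have hb' : 2 * ∫ r in (0 : ℝ)..q', dist1 μ r < b + 2 * (q' - q) := by rw [h2]; linarith
  rw [sphereObjective_eq, sphereObjective_eq,
    ← intervalIntegral.integral_add_adjacent_intervals (b := (q : ℝ))
      (hu.intervalIntegrable_inv hb' le_rfl hq0)
      (hu.intervalIntegrable_inv hb' hq0 (hq0.trans hqq'))]
  have e1 : ∫ s in (0 : ℝ)..q, 1 / (b + 2 * ((q' : ℝ) - q) - 2 * ∫ r in s..q', dist1 μ r) =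
      ∫ s in (0 : ℝ)..q, 1 / (b - 2 * ∫ r in s..q, dist1 μ r) := by
    refine intervalIntegral.integral_congr fun s _ => ?_
    rw [h2]
    congr 1
    ring
  have e2 : ∫ s in (q : ℝ)..q', 1 / (b + 2 * ((q' : ℝ) - q) - 2 * ∫ r in s..q', dist1 μ r) =
      1 / 2 * (Real.log (b + 2 * (q' - q)) - Real.log b) := by
    have h3 := integral_inv_affine (m := 1) (δ := (q' : ℝ) - q) (D := b + 2 * (q' - q)) zero_le_one
      (sub_nonneg.2 hqq') (by linarith)
    have h4 := intervalIntegral.integral_comp_sub_right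
      (fun s => 1 / (b + 2 * ((q' : ℝ) - q) - 2 * (1 * ((q' : ℝ) - q - s)))) (q : ℝ)
      (a := q) (b := q')
    rw [sub_self, h3] at h4
    have e3 : stepConst 1 ((q' : ℝ) - q) (b + 2 * (q' - q)) =
        1 / 2 * (Real.log (b + 2 * (q' - q)) - Real.log b) := by
      have hp : 0 < b + 2 * ((q' : ℝ) - q) := by linarith
      rw [stepConst, if_neg one_ne_zero, mul_one, add_sub_cancel_right,
        Real.log_div hp.ne' hb0.ne']
    rw [← e3, ← h4]
    refine intervalIntegral.integral_congr fun s hs => ?_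
    rw [uIcc_of_le hqq'] at hs
    rw [h1 s hs.1 hs.2]
    congr 1
    ring
  rw [e1, e2]
  ring

theorem psiCirc_eq_of_le {q q' : ℝ≥0} (hq : μ (Iic q) = 1) (hqq : q ≤ q') :
    psiCirc μ q = psiCirc μ q' := by
  have hu := unitValued_dist1 μ
  have hqq' : (q : ℝ) ≤ q' := NNReal.coe_le_coe.2 hqq
  have h2 : ∫ r in (0 : ℝ)..q', dist1 μ r = (∫ r in (0 : ℝ)..q, dist1 μ r) + (q' - q) := by
    rw [← intervalIntegral.integral_add_adjacent_intervals (b := (q : ℝ))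
      (hu.intervalIntegrable _ _) (hu.intervalIntegrable _ _)]
    congr 1
    rw [intervalIntegral.integral_congr (g := fun _ => (1 : ℝ)) fun r hr => ?_]
    · simp
    · rw [uIcc_of_le hqq'] at hr
      exact dist1_eq_one hq hr.1
  have e : Ioi (2 * cdfIntegral μ 0 q') =
      (fun b => b + 2 * ((q' : ℝ) - q)) '' Ioi (2 * cdfIntegral μ 0 q) := by
    rw [image_add_const_Ioi]
    congr 1
    change 2 * ∫ r in (0 : ℝ)..q', dist1 μ r = 2 * (∫ r in (0 : ℝ)..q, dist1 μ r) + _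
    rw [h2]
    ring
  rw [psiCirc, psiCirc, e, image_image]
  congr 2
  exact image_congr fun b hb => (sphereObjective_shift hq hqq hb).symm

theorem psiCirc_eq {q q' : ℝ≥0} (hq : μ (Iic q) = 1) (hq' : μ (Iic q') = 1) :
    psiCirc μ q = psiCirc μ q' := by
  rcases le_total q q' with h | h
  · exact psiCirc_eq_of_le hq h
  · exact (psiCirc_eq_of_le hq' h).symm

variable (μ)

theorem bddBelow_sphereObjective (q : ℝ≥0) :
    BddBelow (sphereObjective μ q '' Ioi (2 * cdfIntegral μ 0 q)) := by
  have hu := unitValued_dist1 μ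
  have hq0 : (0 : ℝ) ≤ q := NNReal.coe_nonneg q
  refine ⟨-q, ?_⟩
  rintro _ ⟨b, hb, rfl⟩
  have hb1 : 2 * ∫ r in (0 : ℝ)..q, dist1 μ r < b := hb
  have hb0 : 0 < b := lt_of_le_of_lt (mul_nonneg two_pos.le (hu.integral_nonneg hq0)) hb1
  rw [sphereObjective_eq]
  have h1 : 0 ≤ ∫ s in (0 : ℝ)..q, 1 / (b - 2 * ∫ r in s..q, dist1 μ r) :=
    intervalIntegral.integral_nonneg hq0 fun s hs => by
      have := hu.sub_pos hb1 hs.1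
      positivity
  have h2 := Real.log_le_sub_one_of_pos hb0
  linarith

/-- With `W` the `L¹` distance, replacing `b` by `b + 2W` makes every denominator for `μ` at least
the one for `ν`. The linear term costs `W`, and the logarithm only lowers the objective. -/
theorem psiCirc_sub_le (q : ℝ≥0) :
    psiCirc ν q - psiCirc μ q ≤ ∫ r in (0 : ℝ)..q, |dist1 μ r - dist1 ν r| := by
  have hu := unitValued_dist1 μ
  have hv := unitValued_dist1 ν
  have hq0 : (0 : ℝ) ≤ q := NNReal.coe_nonneg q
  set W := ∫ r in (0 : ℝ)..q, |dist1 μ r - dist1 ν r| with hW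
  have hi : ∀ s t : ℝ, IntervalIntegrable (fun r => |dist1 μ r - dist1 ν r|) volume s t :=
    fun s t => ((hu.intervalIntegrable s t).sub (hv.intervalIntegrable s t)).abs
  have hW0 : 0 ≤ W := intervalIntegral.integral_nonneg hq0 fun _ _ => abs_nonneg _
  have hcmp : ∀ s : ℝ, 0 ≤ s → s ≤ q →
      ∫ r in s..q, dist1 μ r ≤ (∫ r in s..q, dist1 ν r) + W := fun s hs hsq => by
    have h1 : ∫ r in s..q, (dist1 μ r - dist1 ν r) ≤ ∫ r in s..q, |dist1 μ r - dist1 ν r| :=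
      intervalIntegral.integral_mono_on hsq
        ((hu.intervalIntegrable _ _).sub (hv.intervalIntegrable _ _)) (hi _ _)
        fun _ _ => le_abs_self _
    rw [intervalIntegral.integral_sub (hu.intervalIntegrable _ _) (hv.intervalIntegrable _ _)] at h1
    have h2 : 0 ≤ ∫ r in (0 : ℝ)..s, |dist1 μ r - dist1 ν r| :=
      intervalIntegral.integral_nonneg hs fun _ _ => abs_nonneg _
    have h3 := intervalIntegral.integral_add_adjacent_intervals (hi 0 s) (hi s q)
    rw [← hW] at h3
    linarith
  have key : ∀ x ∈ sphereObjective ν q '' Ioi (2 * cdfIntegral ν 0 q),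
      sInf (sphereObjective μ q '' Ioi (2 * cdfIntegral μ 0 q)) - W ≤ x := by
    rintro _ ⟨b, hb, rfl⟩
    have hb1 : 2 * ∫ r in (0 : ℝ)..q, dist1 ν r < b := hb
    have hb0 : 0 < b := lt_of_le_of_lt (mul_nonneg two_pos.le (hv.integral_nonneg hq0)) hb1
    have hb2 : 2 * ∫ r in (0 : ℝ)..q, dist1 μ r < b + 2 * W := by
      linarith [hcmp 0 le_rfl hq0]
    have h1 := csInf_le (bddBelow_sphereObjective μ q) (mem_image_of_mem (sphereObjective μ q)
      (show b + 2 * W ∈ Ioi (2 * cdfIntegral μ 0 q) from hb2))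
    have h2 : ∫ s in (0 : ℝ)..q, 1 / (b + 2 * W - 2 * ∫ r in s..q, dist1 μ r) ≤
        ∫ s in (0 : ℝ)..q, 1 / (b - 2 * ∫ r in s..q, dist1 ν r) := by
      refine intervalIntegral.integral_mono_on hq0 (hu.intervalIntegrable_inv hb2 le_rfl hq0)
        (hv.intervalIntegrable_inv hb1 le_rfl hq0) fun s hs => ?_
      exact one_div_le_one_div_of_le (hv.sub_pos hb1 hs.1) (by linarith [hcmp s hs.1 hs.2])
    have h3 := Real.log_le_log hb0 (by linarith : b ≤ b + 2 * W)
    rw [sphereObjective_eq] at h1 ⊢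
    linarith
  have h := le_csInf (nonempty_Ioi.image _) key
  simp only [psiCirc]
  linarith

end PsiCirc

theorem abs_psiCirc_sub_le (p p' : Bounded) :
    |psiCirc p.1.1.meas p.1.2 - psiCirc p'.1.1.meas p'.1.2| ≤
      ((1 : ℝ≥0) : ℝ) * (edist p.1.1 p'.1.1).toReal := by
  obtain ⟨⟨μ, q⟩, hq⟩ := p
  obtain ⟨⟨ν, q'⟩, hq'⟩ := p'
  simp only at hq hq' ⊢
  have h1 : ∀ {μ : P1} {q q' : ℝ≥0}, μ.meas (Iic q) = 1 → q ≤ q' → μ.meas (Iic q') = 1 :=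
    fun {μ q q'} hq h => le_antisymm prob_le_one (hq ▸ measure_mono (Iic_subset_Iic.2 h))
  rw [psiCirc_eq hq (h1 hq (le_max_left q q')), psiCirc_eq hq' (h1 hq' (le_max_right q q')),
    NNReal.coe_one, one_mul]
  have hd := intervalIntegral_dist1_le μ ν (NNReal.coe_nonneg (max q q'))
  have hd' := intervalIntegral_dist1_le ν μ (NNReal.coe_nonneg (max q q'))
  rw [edist_comm] at hd'
  rw [abs_le]
  constructor
  · linarith [psiCirc_sub_le μ.meas ν.meas (max q q')]
  · linarith [psiCirc_sub_le ν.meas μ.meas (max q q')]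

theorem Ladder.measure_Iic_last (d : Ladder) : d.toP1.meas (Iic (d.q (Fin.last d.k))) = 1 := by
  change d.measure _ = 1
  rw [← d.sum_weights, Ladder.measure, Measure.finsetSum_apply]
  refine Finset.sum_congr rfl fun ℓ _ => ?_
  rw [Measure.smul_apply, Measure.dirac_apply_of_mem
    (mem_Iic.2 (d.q_strictMono.monotone (Fin.le_last ℓ))), smul_eq_mul, mul_one]

theorem denseRange_bounded : DenseRange fun p : Bounded => p.1.1 :=
  denseRange_toP1.mono <| by
    rintro _ ⟨d, rfl⟩
    exact ⟨⟨(d.toP1, d.q (Fin.last d.k)), d.measure_Iic_last⟩, rfl⟩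

theorem existsUnique_psi : ∃! Ψ : P1 → ℝ, IsContinuousExtension (fun p : Bounded => p.1.1)
    (fun p => psiCirc p.1.1.meas p.1.2) Ψ :=
  existsUnique_extension denseRange_bounded abs_psiCirc_sub_le

theorem psiExt_spec : IsContinuousExtension (fun p : Bounded => p.1.1)
    (fun p => psiCirc p.1.1.meas p.1.2) psiExt := continuousExtension_spec existsUnique_psi

theorem psiExt_toP1 (d : Ladder) : psiExt d.toP1 = psiCirc d.measure (d.q (Fin.last d.k)) :=
  psiExt_spec.2 ⟨(d.toP1, d.q (Fin.last d.k)), d.measure_Iic_last⟩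

theorem abs_psiExt_sub_le (μ ν : P1) : |psiExt μ - psiExt ν| ≤ (edist μ ν).toReal := by
  have h := abs_sub_le_of_dense denseRange_bounded psiExt_spec.1 (K := 1) (fun p p' => by
    rw [psiExt_spec.2, psiExt_spec.2]
    exact abs_psiCirc_sub_le p p') μ ν
  simpa using h

/-- On the sphere `R² / N = 1`, so `Fbar N` is `1`-Lipschitz for every `N ≥ 1`, as is `psiExt`.
Approximating `μ` within `ε / 3` by a measure of finite support reduces the claim to the case
already proved. -/
theorem tendsto_Fbar_sphere (μ : P1) :
    Tendsto (fun N : ℕ => Fbar N (sphereLaw N) μ) atTop (𝓝 (psiExt μ)) := by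
  rw [Metric.tendsto_nhds]
  intro ε hε
  obtain ⟨_, ⟨d, rfl⟩, hd⟩ := EMetric.mem_closure_iff.1 (denseRange_toP1 μ)
    (ENNReal.ofReal (ε / 3)) (ENNReal.ofReal_pos.2 (by positivity))
  have hd' : (edist μ d.toP1).toReal < ε / 3 :=
    (ENNReal.lt_ofReal_iff_toReal_lt (edist_ne_top' _ _)).1 hd
  filter_upwards [(Metric.tendsto_nhds.1 (tendsto_meanFreeEnergy_sphere d)) (ε / 3) (by positivity),
    eventually_ge_atTop 1] with N h1 hN
  have := isProbabilityMeasure_sphereLaw hN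
  have h2 := abs_Fbar_sub_le (Real.sqrt_nonneg (N : ℝ)) (ae_len_sphereLaw (N := N)) μ d.toP1
  have hN0 : (0 : ℝ) < N := by exact_mod_cast hN
  rw [Real.sq_sqrt hN0.le, div_self hN0.ne', one_mul,
    (Fbar_spec (Real.sqrt_nonneg (N : ℝ)) ae_len_sphereLaw).2] at h2
  have h3 := abs_psiExt_sub_le μ d.toP1
  rw [psiExt_toP1] at h3
  rw [Real.dist_eq] at h1 ⊢
  rw [abs_le] at h2 h3
  rw [abs_lt] at h1 ⊢
  constructor <;> linarith [h1.1, h1.2, h2.1, h2.2, h3.1, h3.2]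

end SpinGlass

end

theorem propositionp :
    (∀ ρ : MeasureTheory.Measure ℝ, MeasureTheory.IsProbabilityMeasure ρ →
      (∃ R : ℝ, ∀ᵐ x ∂ρ, |x| ≤ R) →
        (∀ N : ℕ, 1 ≤ N →
          SpinGlass.FbarWellDefined N (MeasureTheory.Measure.pi fun _ : Fin N => ρ)) ∧
        (∀ N : ℕ, 1 ≤ N →
          SpinGlass.Fbar N (MeasureTheory.Measure.pi fun _ : Fin N => ρ) =
            SpinGlass.Fbar 1 (MeasureTheory.Measure.pi fun _ : Fin 1 => ρ))) ∧
    ((∀ μ : MeasureTheory.Measure NNReal, MeasureTheory.IsProbabilityMeasure μ →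
        ∀ q q' : NNReal, μ (Set.Iic q) = 1 → μ (Set.Iic q') = 1 →
          SpinGlass.psiCirc μ q = SpinGlass.psiCirc μ q') ∧
      (∃! Ψ : SpinGlass.P1 → ℝ,
        SpinGlass.IsContinuousExtension (fun p : SpinGlass.Bounded => p.1.1)
          (fun p => SpinGlass.psiCirc p.1.1.meas p.1.2) Ψ) ∧
      (∀ N : ℕ, 1 ≤ N → SpinGlass.FbarWellDefined N (SpinGlass.sphereLaw N)) ∧
      (∀ μ : SpinGlass.P1,
        Filter.Tendsto (fun N : ℕ => SpinGlass.Fbar N (SpinGlass.sphereLaw N) μ) Filter.atTop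
          (nhds (SpinGlass.psiExt μ)))) := by
  have hsphere : ∀ N : ℕ, 1 ≤ N → SpinGlass.FbarWellDefined N (SpinGlass.sphereLaw N) :=
    fun N hN => by
      have := SpinGlass.isProbabilityMeasure_sphereLaw hN
      exact SpinGlass.fbarWellDefined_of_bounded (Real.sqrt_nonneg (N : ℝ))
        SpinGlass.ae_len_sphereLaw
  refine ⟨fun ρ hρ ⟨R, hR⟩ => ?_, fun μ hμ q q' hq hq' => SpinGlass.psiCirc_eq hq hq',
    SpinGlass.existsUnique_psi, hsphere, SpinGlass.tendsto_Fbar_sphere⟩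
  have hR' : ∀ᵐ x ∂ρ, |x| ≤ |R| := by
    filter_upwards [hR] with x hx using hx.trans (le_abs_self R)
  exact ⟨fun N _ => SpinGlass.fbarWellDefined_of_bounded (by positivity)
    (SpinGlass.ae_len_le_pi ρ (abs_nonneg R) hR'),
    fun N hN => SpinGlass.Fbar_pi ρ (abs_nonneg R) hR' hN⟩
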